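/- **Conventions.** A *geometric planar graph* $P=(V,E)$ is a connected graph whose vertices are distinct points of $\mathbb R^2$ and whose edges are straight segments that meet only in common endpoints and contain no further vertices; its complexity is $p=|V|+|E|$. A *trajectory* $Q$ of complexity $q\ge 1$ is the polygonal curve through a sequence of $q$ points of $\mathbb R^2$. A *path* $\pi$ in $P$ is a sequence $u_1,\dots,u_k$ ($k\ge1$) of vertices with $u_iu_{i+1}\in E$, regarded as a polygonal curve, and $d_F$ is the Fréchet distance. A *$2.999$-approximation* of $r^*=\min_\pi d_F(\pi,Q)$ is a (rational) number $r$ with $r^*\le r\le 2.999\,r^*$. Algorithms are deterministic programs for a random access machine on integers (with $+,-,\times$, integer division, comparison, indirect addressing) under the logarithmic cost criterion. **Hypotheses.** SETH: for every $\delta>0$ there is a $k$ such that $k$-SAT with $N$ variables and $M$ clauses cannot be solved in time $O((2-\delta)^N\,\mathrm{poly}(N,M))$. SETH$'$: for no $\delta>0$ can CNF-SAT be solved in time $O((2-\delta)^N\,\mathrm{poly}(N,M))$. OV: given $n\ge 1$ vectors $A$ and $m\ge 1$ vectors $B$ in $\{0,1\}^d$, decide whether some $a\in A$ and $b\in B$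 are orthogonal. OVH: for all rational $\gamma>0$ and real $0<c_1<c_2$, $\delta>0$, OV restricted to instances with $c_1n^\gamma\le m\le c_2n^\gamma$ cannot be solved in time $O((nm)^{1-\delta}\,\mathrm{poly}(d))$. **Lemma.** Assume that at least one of SETH, SETH$'$, OVH holds. Let $\gamma>0$, $\varepsilon\ge0$, $0<c_1<c_2$ be real numbers, where $\gamma$ is rational if $\varepsilon=0$, let $\kappa\ge2$ be an integer, and let $\delta>0$. Then no algorithm computes, for all geometric planar graphs $P$ of complexity $p$ and all trajectories $Q$ of complexity $q$ with $c_1p^{\gamma-\varepsilon}\le q\le c_2p^{\gamma+\varepsilon}$ and all of whose vertices (of $P$ and $Q$) have integer coordinates of absolute value at most $(p+q)^\kappa$, a $2.999$-approximation of $\min_\pi d_F(\pi,Q)$ in time $O((pq)^{1-\delta})$, where $\pi$ ranges over all paths in $P$. (In particular, with $\varepsilon=0$, this holds for the restriction $q=\Theta(p^\gamma)$.) Consequently, under the same restrictions, no such algorithm improves the $O(pq\log p)$ running time of the algorithm of Alt, Efrat, Rote and Wenk by a polynomial factor: none runs in time $O\bigl(pq\log(p+1)/(pq)^{\delta}\bigr)$.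 -/

import Mathlib

/-! ### Random access machines with logarithmic cost

Programs are structured (sequencing, branching, `while`) over a random access memory whose cells
hold integers and are addressed by integers.  Computing, reading or writing a value costs its
bit length (the usual logarithmic cost criterion), so the model agrees with the word RAM with
`O(log n)`-bit words up to polylogarithmic factors. -/

namespace RAM

/-- The contents of the memory. -/
abbrev Memory := ℤ → ℤ

/-- The cost of handling the integer `z`: its number of bits (plus one for the sign). -/
def bitLen (z : ℤ) : ℕ := z.natAbs.size + 1

/-- Integer expressions. `cell a` is the content of the memory cell whose address is `a`;
`div` is integer division. -/
inductive Expr where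
  | lit (z : ℤ)
  | cell (a : Expr)
  | add (a b : Expr)
  | sub (a b : Expr)
  | mul (a b : Expr)
  | div (a b : Expr)

/-- The value of an expression. -/
def Expr.eval (M : Memory) : Expr → ℤ
  | .lit z => z
  | .cell a => M (a.eval M)
  | .add a b => a.eval M + b.eval M
  | .sub a b => a.eval M - b.eval M
  | .mul a b => a.eval M * b.eval M
  | .div a b => a.eval M / b.eval M

/-- The cost of evaluating an expression: the total bit length of all its intermediate values,
including the addresses used and the result. -/
def Expr.cost (M : Memory) : Expr → ℕ
  | .lit z => bitLen z
  | .cell a => a.cost M + bitLen ((Expr.cell a).eval M)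
  | .add a b => a.cost M + b.cost M + bitLen ((Expr.add a b).eval M)
  | .sub a b => a.cost M + b.cost M + bitLen ((Expr.sub a b).eval M)
  | .mul a b => a.cost M + b.cost M + bitLen ((Expr.mul a b).eval M)
  | .div a b => a.cost M + b.cost M + bitLen ((Expr.div a b).eval M)

/-- Programs. `store a v` writes the value of `v` into the cell with address `a`;
`ite e c₁ c₂` runs `c₁` if `e` is positive and `c₂` otherwise;
`loop e c` runs `c` as long as `e` is positive. -/
inductive Prog where
  | skip
  | store (a v : Expr)
  | seq (c₁ c₂ : Prog)
  | ite (e : Expr) (c₁ c₂ : Prog)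
  | loop (e : Expr) (c : Prog)

/-- `Run c M t M'`: started on memory `M`, the program `c` halts after time `t` with memory `M'`. -/
inductive Run : Prog → Memory → ℕ → Memory → Prop where
  | skip (M : Memory) : Run .skip M 1 M
  | store (a v : Expr) (M : Memory) :
      Run (.store a v) M (a.cost M + v.cost M + 1) (Function.update M (a.eval M) (v.eval M))
  | seq {c₁ c₂ : Prog} {M M' M'' : Memory} {t t' : ℕ} :
      Run c₁ M t M' → Run c₂ M' t' M'' → Run (.seq c₁ c₂) M (t + t' + 1) M''
  | ite_pos {e : Expr} {c₁ c₂ : Prog} {M M' : Memory} {t : ℕ} :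
      0 < e.eval M → Run c₁ M t M' → Run (.ite e c₁ c₂) M (e.cost M + t + 1) M'
  | ite_neg {e : Expr} {c₁ c₂ : Prog} {M M' : Memory} {t : ℕ} :
      ¬ 0 < e.eval M → Run c₂ M t M' → Run (.ite e c₁ c₂) M (e.cost M + t + 1) M'
  | loop_stop {e : Expr} {c : Prog} {M : Memory} :
      ¬ 0 < e.eval M → Run (.loop e c) M (e.cost M + 1) M
  | loop_step {e : Expr} {c : Prog} {M M' M'' : Memory} {t t' : ℕ} :
      0 < e.eval M → Run c M t M' → Run (.loop e c) M' t' M'' →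
      Run (.loop e c) M (e.cost M + t + t' + 1) M''

/-- The initial memory for an input: the input stands in the cells `0, 1, 2, …`, and all other
cells are `0`. -/
def init (l : List ℤ) : Memory := fun a => if 0 ≤ a then l.getD a.toNat 0 else 0

/-- Some program decides the problem `yes` on all admissible inputs `x` in time at most `T x`.
The answer is `1` (yes) or `0` (no) in cell `0`. -/
def DecidableIn {ι : Type} (admissible : ι → Prop) (encode : ι → List ℤ) (yes : ι → Prop)
    (T : ι → ℝ) : Prop :=
  ∃ c : Prog, ∀ x, admissible x → ∃ (t : ℕ) (M : Memory),
    Run c (init (encode x)) t M ∧ (t : ℝ) ≤ T x ∧ (yes x → M 0 = 1) ∧ (¬ yes x → M 0 = 0)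

end RAM

/-- The entries of a matrix, row by row. -/
def rowMajor {n d : ℕ} (A : Fin n → Fin d → ℤ) : List ℤ :=
  List.ofFn fun t : Fin (n * d) => A t.divNat t.modNat

/-! ### Satisfiability and the strong exponential time hypothesis -/

/-- A formula in conjunctive normal form with `N` variables and `M` clauses. The entry
`clause i j` is `1` if the variable `j` occurs in clause `i`, it is `-1` if its negation
occurs in clause `i`, and it is `0` if neither occurs. -/
structure CNF where
  N : ℕ
  M : ℕ
  clause : Fin M → Fin N → SignType

namespace CNF

/-- The formula has a satisfying assignment. -/
def Satisfiable (φ : CNF) : Prop :=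
  ∃ x : Fin φ.N → Bool, ∀ i, ∃ j, φ.clause i j = if x j then 1 else -1

/-- Every clause has at most `k` literals. -/
def Width (k : ℕ) (φ : CNF) : Prop :=
  ∀ i, (Finset.univ.filter fun j => φ.clause i j ≠ 0).card ≤ k

/-- The input representing a formula. -/
def encode (φ : CNF) : List ℤ :=
  (φ.N : ℤ) :: (φ.M : ℤ) :: rowMajor fun i j => (φ.clause i j : ℤ)

end CNF

/-- SETH: for every `δ > 0` there is a `k` such that `k`-SAT has no algorithm with running time
`O((2 - δ) ^ N)` up to polynomial factors. -/
def SETH : Prop :=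
  ∀ δ : ℝ, 0 < δ → ∃ k : ℕ, ¬ ∃ (C : ℝ) (a : ℕ),
    RAM.DecidableIn (CNF.Width k) CNF.encode CNF.Satisfiable
      (fun φ => C * (2 - δ) ^ φ.N * ((φ.N : ℝ) + φ.M + 1) ^ a)

/-- SETH′: for no `δ > 0` has CNF-SAT an algorithm with running time `O((2 - δ) ^ N)` up to
factors polynomial in the numbers `N` of variables and `M` of clauses. -/
def SETH' : Prop :=
  ∀ δ : ℝ, 0 < δ → ¬ ∃ (C : ℝ) (a : ℕ),
    RAM.DecidableIn (fun _ => True) CNF.encode CNF.Satisfiable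
      (fun φ => C * (2 - δ) ^ φ.N * ((φ.N : ℝ) + φ.M + 1) ^ a)

/-! ### Orthogonal vectors -/

/-- An instance of OV: `n` vectors and `m` vectors in `{0,1}^d`. -/
structure OVInstance where
  n : ℕ
  m : ℕ
  d : ℕ
  A : Fin n → Fin d → Bool
  B : Fin m → Fin d → Bool

namespace OVInstance

/-- Some vector of `A` is orthogonal to some vector of `B`. -/
def HasOrthogonalPair (x : OVInstance) : Prop :=
  ∃ i j, ∀ k, x.A i k = false ∨ x.B j k = false

/-- The input representing an instance. -/
def encode (x : OVInstance) : List ℤ :=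
  [(x.n : ℤ), (x.m : ℤ), (x.d : ℤ)] ++ rowMajor (fun i k => if x.A i k then 1 else 0) ++
    rowMajor (fun j k => if x.B j k then 1 else 0)

end OVInstance

/-- The orthogonal vectors hypothesis, for all polynomial restrictions: for no rational
`γ > 0` and no `0 < c₁ < c₂`, `δ > 0` has OV, restricted to non-empty instances with
`c₁ n ^ γ ≤ m ≤ c₂ n ^ γ`, an algorithm with running time `O((n m) ^ (1 - δ))` up to factors
polynomial in `d`. -/
def OVH : Prop :=
  ∀ (γ : ℚ) (c₁ c₂ δ : ℝ), 0 < γ → 0 < c₁ → c₁ < c₂ → 0 < δ → ¬ ∃ (C : ℝ) (a : ℕ),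
    RAM.DecidableIn
      (fun x : OVInstance => 0 < x.n ∧ 0 < x.m ∧
        c₁ * (x.n : ℝ) ^ (γ : ℝ) ≤ x.m ∧ (x.m : ℝ) ≤ c₂ * (x.n : ℝ) ^ (γ : ℝ))
      OVInstance.encode OVInstance.HasOrthogonalPair
      (fun x => C * ((x.n : ℝ) * x.m) ^ (1 - δ) * ((x.d : ℝ) + 1) ^ a)

/-! ### The Fréchet distance -/

/-- The Euclidean plane. -/
abbrev Plane := EuclideanSpace ℝ (Fin 2)

/-- The polygonal curve with the given vertices `a₀, …, aₙ₋₁`, as a function on `[0, n - 1]`: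
it interpolates linearly between `aᵢ` and `aᵢ₊₁` on `[i, i + 1]`. -/
noncomputable def polyline (a : List Plane) (t : ℝ) : Plane :=
  (1 - Int.fract t) • a.getD ⌊t⌋₊ 0 + Int.fract t • a.getD (⌊t⌋₊ + 1) 0

/-- A continuous non-decreasing surjection from `[0, 1]` to `[0, n - 1]`. -/
def IsReparam (n : ℕ) (α : ℝ → ℝ) : Prop :=
  ContinuousOn α (Set.Icc 0 1) ∧ MonotoneOn α (Set.Icc 0 1) ∧
    α '' Set.Icc 0 1 = Set.Icc 0 ((n : ℝ) - 1)

/-- The Fréchet distance of the polygonal curves with vertices `a` and `b`: the infimum, over all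
pairs of reparametrizations, of the maximal distance. -/
noncomputable def frechetDist (a b : List Plane) : ℝ :=
  sInf {r : ℝ | ∃ α β : ℝ → ℝ, IsReparam a.length α ∧ IsReparam b.length β ∧
    ∀ μ ∈ Set.Icc (0 : ℝ) 1, dist (polyline a (α μ)) (polyline b (β μ)) ≤ r}

/-! ### Map matching -/

/-- The point of the plane with the given integer coordinates. -/
noncomputable def toPlane (v : ℤ × ℤ) : Plane := !₂[(v.1 : ℝ), (v.2 : ℝ)]

/-- A straight-line graph (a list of vertices, and a list of edges given by the positions of their
endpoints in the list of vertices) together with a trajectory. -/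
structure MapInstance where
  verts : List (ℤ × ℤ)
  edges : List (ℕ × ℕ)
  traj : List (ℤ × ℤ)

namespace MapInstance

/-- The complexity of the graph. -/
def p (I : MapInstance) : ℕ := I.verts.length + I.edges.length

/-- The complexity of the trajectory. -/
def q (I : MapInstance) : ℕ := I.traj.length

/-- The location of the `i`-th vertex. -/
noncomputable def pt (I : MapInstance) (i : ℕ) : Plane := toPlane (I.verts.getD i (0, 0))

/-- The underlying abstract graph. -/
def graph (I : MapInstance) : SimpleGraph (Fin I.verts.length) :=
  SimpleGraph.fromRel fun i j => ((i : ℕ), (j : ℕ)) ∈ I.edges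

/-- The segment that represents an edge. -/
def edgeSegment (I : MapInstance) (e : ℕ × ℕ) : Set Plane := segment ℝ (I.pt e.1) (I.pt e.2)

/-- The instance consists of a connected geometric planar graph (distinct vertices, edges meeting
only in common endpoints, no vertex in the interior of an edge) and a non-empty trajectory. Each
edge is listed once, with its endpoints in increasing order. -/
structure Valid (I : MapInstance) : Prop where
  verts_nodup : I.verts.Nodup
  edges_nodup : I.edges.Nodup
  edges_lt : ∀ e ∈ I.edges, e.1 < e.2 ∧ e.2 < I.verts.length
  noncrossing : ∀ e ∈ I.edges, ∀ f ∈ I.edges, e ≠ f →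
    I.edgeSegment e ∩ I.edgeSegment f ⊆ {I.pt e.1, I.pt e.2} ∩ {I.pt f.1, I.pt f.2}
  vertex_free : ∀ i < I.verts.length, ∀ e ∈ I.edges, I.pt i ∈ I.edgeSegment e → i = e.1 ∨ i = e.2
  connected : I.graph.Connected
  traj_ne_nil : I.traj ≠ []

/-- All coordinates are at most `(p + q) ^ κ` in absolute value. -/
def Bounded (κ : ℕ) (I : MapInstance) : Prop :=
  ∀ v ∈ I.verts ++ I.traj, |v.1| ≤ ((I.p + I.q : ℕ) : ℤ) ^ κ ∧ |v.2| ≤ ((I.p + I.q : ℕ) : ℤ) ^ κ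

/-- The least Fréchet distance of a path in the graph to the trajectory. A path is a sequence of
vertices, consecutive ones being adjacent; vertices may repeat. -/
noncomputable def opt (I : MapInstance) : ℝ :=
  sInf {r : ℝ | ∃ (u v : Fin I.verts.length) (π : I.graph.Walk u v),
    r = frechetDist (π.support.map fun i => I.pt i) (I.traj.map toPlane)}

/-- The input representing an instance. -/
def encode (I : MapInstance) : List ℤ :=
  [(I.verts.length : ℤ), (I.edges.length : ℤ), (I.traj.length : ℤ)] ++
    I.verts.flatMap (fun v => [v.1, v.2]) ++
    I.edges.flatMap (fun e => [(e.1 : ℤ), (e.2 : ℤ)]) ++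
    I.traj.flatMap (fun v => [v.1, v.2])

end MapInstance

/-- Some program `ρ`-approximates map matching on all instances with a connected geometric planar
graph of complexity `p`, a trajectory of complexity `q` with `R p q`, and integer coordinates of
absolute value at most `(p + q) ^ κ`, in time at most `T p q`. The output is the rational number
with numerator in cell `0` and (positive) denominator in cell `1`. -/
def MapMatchingApproxIn (ρ : ℝ) (κ : ℕ) (R : ℕ → ℕ → Prop) (T : ℕ → ℕ → ℝ) : Prop :=
  ∃ c : RAM.Prog, ∀ I : MapInstance, I.Valid → I.Bounded κ → R I.p I.q →
    ∃ (t : ℕ) (M : RAM.Memory), RAM.Run c (RAM.init I.encode) t M ∧ (t : ℝ) ≤ T I.p I.q ∧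
      0 < M 1 ∧ I.opt ≤ (M 0 : ℝ) / M 1 ∧ (M 0 : ℝ) / M 1 ≤ ρ * I.opt

/-! Two reductions carry the theorem, both carried out inside the machine model: CNF satisfiability
reduces to orthogonal vectors (`SETH'.ovh`), and orthogonal vectors reduce to approximate map
matching (`OVH.not_mapMatchingApproxIn`).

Geometry. The graph is a ladder of `n + 2` nearly coinciding horizontal rows. Rows `1, …, n` encode
the vectors of `A`, and rows `0` and `n + 1` encode the zero vector. A left column joins the rows
`0, …, n`, and a right column joins the rows `1, …, n + 1`. The trajectory runs along the axis in
`m` blocks, one for each vector of `B`; each block leads from the left column to the right column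
with one wiggle for each bit. It starts and ends three units outside the columns, which forces a
walker at distance less than three units to start left of row `0` and to end right of row `n + 1`,
hence to traverse some row `y` between `1` and `n` while the trajectory passes all wiggles of some
block `j`. Let a bit have its centre at abscissa `u`. A bit `1` of a row leaves the open interval
from `u - 6` to `u + 6` free of vertices, and a bit `1` of a block makes the trajectory visit `u -
3, u + 3, u - 3, u + 3`. A walker at distance less than three units would have to turn back inside
that interval, but walkers turn only at vertices (`Gadget.no_wiggle`). For every other pair of bits,
distance one unit suffices, up to the heights of the rows (`Gadget.Walks.sweep`). So the optimum is
at least `3 * unit` without an orthogonal pair (`Gadget.le_opt`). With one it is at most `unit + n +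
1`: the walker spends the blocks before `j` in row `0`, block `j` in row `y` and the later blocks in
row `n + 1` (`Gadget.opt_le_of_orthogonal`). As `unit = 10000 * n`, a `2.999`-approximation tells
the two cases apart.

Sizes. For the exponent `r / s`, padding gives `p = 1001 * n * (2 * d + 1) ^ s` and `q = 4 * m * (2
* d + 1) ^ r`, so that `q / p ^ (r / s)` is a constant times `m / n ^ (r / s)` whatever `d` is; the
restriction on `p` and `q` becomes the restriction on `n` and `m` with rescaled constants. An
irrational exponent with `ε > 0` is handled by a rational one close to it. In the first reduction
the variables are split in the ratio `s : r`, the vectors are the partial assignments, and their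
entries record the clauses that a partial assignment leaves unsatisfied.

Machine. A reduction has to write a new input and then run a given program on it. The program is
moved into negative even cells (`RAM.Run.relocate`), which slows it down by a constant factor only
and keeps the old input readable. A small calculus (`RAM.WP`, refined to `RAM.Steps`) shows that the
generators emit the right lists in time almost linear in the output. Because `n` and `m` are both at
most a constant times a power of `n * m` with exponent below `1` (`exists_le_mul_rpow`), generation
does not spoil the polynomial saving. -/

namespace RAM

/-! ### Bit lengths and the cost of expressions -/

theorem one_le_bitLen (z : ℤ) : 1 ≤ bitLen z := by simp [bitLen]

theorem bitLen_mono {a b : ℤ} (h : |a| ≤ |b|) : bitLen a ≤ bitLen b := by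
  unfold bitLen
  have : a.natAbs ≤ b.natAbs := by rwa [Int.abs_eq_natAbs, Int.abs_eq_natAbs, Nat.cast_le] at h
  have := Nat.size_le_size this
  omega

theorem bitLen_neg (a : ℤ) : bitLen (-a) = bitLen a := by simp [bitLen]

theorem size_add_le (a b : ℕ) : (a + b).size ≤ a.size + b.size + 1 := by
  rw [Nat.size_le]
  have ha := Nat.lt_size_self a
  have hb := Nat.lt_size_self b
  have h1 : 2 ^ a.size ≤ 2 ^ (a.size + b.size) := Nat.pow_le_pow_right (by norm_num) (by omega)
  have h2 : 2 ^ b.size ≤ 2 ^ (a.size + b.size) := Nat.pow_le_pow_right (by norm_num) (by omega)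
  rw [pow_succ]; omega

theorem bitLen_add_le (a b : ℤ) : bitLen (a + b) ≤ bitLen a + bitLen b := by
  unfold bitLen
  have h1 := Nat.size_le_size (Int.natAbs_add_le a b)
  have h2 := size_add_le a.natAbs b.natAbs
  omega

theorem bitLen_sub_le (a b : ℤ) : bitLen (a - b) ≤ bitLen a + bitLen b := by
  rw [sub_eq_add_neg, ← bitLen_neg b]; exact bitLen_add_le a (-b)

theorem bitLen_mul_le (a b : ℤ) : bitLen (a * b) ≤ bitLen a + bitLen b := by
  unfold bitLen
  have h : (a.natAbs * b.natAbs).size ≤ a.natAbs.size + b.natAbs.size := by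
    rw [Nat.size_le, pow_add]
    exact Nat.mul_lt_mul'' (Nat.lt_size_self _) (Nat.lt_size_self _)
  rw [Int.natAbs_mul]; omega

theorem bitLen_ediv_le (a b : ℤ) : bitLen (a / b) ≤ bitLen a := by
  unfold bitLen
  have := Nat.size_le_size (Int.natAbs_ediv_le_natAbs a b)
  omega

/-- The bit length of the value of an expression is at most its weight times the maximal bit
length of the cells. -/
def Expr.weight : Expr → ℕ
  | .lit z => bitLen z
  | .cell _ => 1
  | .add a b => a.weight + b.weight
  | .sub a b => a.weight + b.weight
  | .mul a b => a.weight + b.weight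
  | .div a _ => a.weight

/-- The cost of an expression is at most this number times the maximal bit length of the cells. -/
def Expr.units : Expr → ℕ
  | .lit z => bitLen z
  | .cell a => a.units + 1
  | .add a b => a.units + b.units + (a.weight + b.weight)
  | .sub a b => a.units + b.units + (a.weight + b.weight)
  | .mul a b => a.units + b.units + (a.weight + b.weight)
  | .div a b => a.units + b.units + a.weight

theorem Expr.bitLen_eval_le {M : Memory} {S : ℕ} (hS : 1 ≤ S) (h : ∀ a, bitLen (M a) ≤ S)
    (e : Expr) : bitLen (e.eval M) ≤ e.weight * S := by
  induction e with
  | lit z => exact Nat.le_mul_of_pos_right _ hS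
  | cell a => simpa [Expr.eval, Expr.weight] using h _
  | add a b iha ihb =>
    have := bitLen_add_le (a.eval M) (b.eval M)
    simp only [Expr.eval, Expr.weight, add_mul]; omega
  | sub a b iha ihb =>
    have := bitLen_sub_le (a.eval M) (b.eval M)
    simp only [Expr.eval, Expr.weight, add_mul]; omega
  | mul a b iha ihb =>
    have := bitLen_mul_le (a.eval M) (b.eval M)
    simp only [Expr.eval, Expr.weight, add_mul]; omega
  | div a b iha ihb => exact (bitLen_ediv_le _ _).trans iha

theorem Expr.cost_le {M : Memory} {S : ℕ} (hS : 1 ≤ S) (h : ∀ a, bitLen (M a) ≤ S)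
    (e : Expr) : e.cost M ≤ e.units * S := by
  have key := fun e : Expr => e.bitLen_eval_le hS h
  induction e with
  | lit z => exact Nat.le_mul_of_pos_right _ hS
  | cell a iha =>
    have := h (a.eval M)
    simp only [Expr.eval, Expr.cost, Expr.units, add_mul]; omega
  | add a b iha ihb =>
    have := key (.add a b)
    simp only [Expr.weight, Expr.cost, Expr.units, add_mul] at *; omega
  | sub a b iha ihb =>
    have := key (.sub a b)
    simp only [Expr.weight, Expr.cost, Expr.units, add_mul] at *; omega
  | mul a b iha ihb =>
    have := key (.mul a b)
    simp only [Expr.weight, Expr.cost, Expr.units, add_mul] at *; omega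
  | div a b iha ihb =>
    have := key (.div a b)
    simp only [Expr.weight, Expr.cost, Expr.units, add_mul] at *; omega

theorem Expr.bitLen_eval_le_cost (M : Memory) (e : Expr) : bitLen (e.eval M) ≤ e.cost M := by
  cases e <;> simp [Expr.cost, Expr.eval]

/-- A value written by a program is paid for. -/
theorem Run.bitLen_le {c : Prog} {M M' : Memory} {t : ℕ} (h : Run c M t M') (a : ℤ) :
    bitLen (M' a) ≤ bitLen (M a) + t := by
  induction h with
  | skip M => omega
  | store b v M =>
    have := v.bitLen_eval_le_cost M
    rw [Function.update_apply]; split_ifs <;> omega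
  | seq _ _ h₁ h₂ => omega
  | ite_pos _ _ h => omega
  | ite_neg _ _ h => omega
  | loop_stop _ => omega
  | loop_step _ _ _ h₁ h₂ => omega

/-! ### Relocating the memory of a program -/

/-- An injection of the addresses into the negative even numbers. -/
def reloc (a : ℤ) : ℤ := -2 - 2 * (a * (2 * a + 1))

/-- Twice `(a - b) * (2 * (a + b) + 1)` is, up to sign, the difference of two values, and the second
factor is odd. A polynomial is used because a program can evaluate it without distinguishing the
sign of the address. -/
theorem reloc_injective : Function.Injective reloc := by
  intro a b h
  have h1 : (a - b) * (2 * (a + b) + 1) = 0 := by unfold reloc at h; linarith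
  rcases mul_eq_zero.1 h1 with h2 | h2 <;> omega

theorem reloc_neg (a : ℤ) : reloc a < 0 := by
  have : 0 ≤ a * (2 * a + 1) := by
    rcases le_or_gt 0 a with h | h
    · positivity
    · nlinarith
  unfold reloc; omega

theorem reloc_ne_odd (a i : ℤ) : reloc a ≠ -(2 * i + 1) := by unfold reloc; omega

theorem reloc_ne_nonneg {a b : ℤ} (h : 0 ≤ b) : reloc a ≠ b := by have := reloc_neg a; omega

/-- The argument occurs twice in the polynomial and is evaluated twice, hence the factor two in the
cost bound. -/
def Expr.relocAddr (e : Expr) : Expr :=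
  .sub (.lit (-2)) (.mul (.lit 2) (.mul e (.add (.mul (.lit 2) e) (.lit 1))))

theorem Expr.eval_relocAddr (M : Memory) (e : Expr) :
    e.relocAddr.eval M = RAM.reloc (e.eval M) := rfl

theorem Expr.cost_relocAddr_le (M : Memory) (e : Expr) :
    e.relocAddr.cost M ≤ 2 * e.cost M + 60 * bitLen (e.eval M) := by
  have h2 : bitLen 2 = 3 := by decide
  have h2' : bitLen (-2) = 3 := by decide
  have h1 : bitLen 1 = 2 := by decide
  have e1 := bitLen_mul_le 2 (e.eval M)
  have e2 := bitLen_add_le (2 * e.eval M) 1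
  have e3 := bitLen_mul_le (e.eval M) (2 * e.eval M + 1)
  have e4 := bitLen_mul_le 2 (e.eval M * (2 * e.eval M + 1))
  have e5 := bitLen_sub_le (-2) (2 * (e.eval M * (2 * e.eval M + 1)))
  have e6 := one_le_bitLen (e.eval M)
  simp only [relocAddr, Expr.cost, Expr.eval]
  omega

def Expr.relocate : Expr → Expr
  | .lit z => .lit z
  | .cell a => .cell a.relocate.relocAddr
  | .add a b => .add a.relocate b.relocate
  | .sub a b => .sub a.relocate b.relocate
  | .mul a b => .mul a.relocate b.relocate
  | .div a b => .div a.relocate b.relocate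

/-- A bound for the slowdown of an expression by relocation. -/
def Expr.slowdown : Expr → ℕ
  | .lit _ => 1
  | .cell a => 2 * a.slowdown + 61
  | .add a b => a.slowdown + b.slowdown + 1
  | .sub a b => a.slowdown + b.slowdown + 1
  | .mul a b => a.slowdown + b.slowdown + 1
  | .div a b => a.slowdown + b.slowdown + 1

theorem Expr.eval_relocate (M : Memory) (e : Expr) :
    e.relocate.eval M = e.eval (M ∘ RAM.reloc) := by
  induction e with
  | lit z => rfl
  | cell a ih => simp [Expr.relocate, Expr.eval, eval_relocAddr, ih]
  | add a b iha ihb => simp [Expr.relocate, Expr.eval, iha, ihb]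
  | sub a b iha ihb => simp [Expr.relocate, Expr.eval, iha, ihb]
  | mul a b iha ihb => simp [Expr.relocate, Expr.eval, iha, ihb]
  | div a b iha ihb => simp [Expr.relocate, Expr.eval, iha, ihb]

theorem Expr.cost_relocate_le (M : Memory) (e : Expr) :
    e.relocate.cost M ≤ e.slowdown * e.cost (M ∘ RAM.reloc) := by
  induction e with
  | lit z => simp [Expr.relocate, Expr.slowdown, Expr.cost]
  | cell a ih =>
    have h1 := a.relocate.cost_relocAddr_le M
    have h2 := a.bitLen_eval_le_cost (M ∘ RAM.reloc)
    simp only [Expr.relocate, Expr.slowdown, Expr.cost, Expr.eval, eval_relocAddr,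
      eval_relocate, Function.comp_apply] at *
    nlinarith
  | add a b iha ihb =>
    simp only [Expr.relocate, Expr.slowdown, Expr.cost, Expr.eval, eval_relocate]; nlinarith
  | sub a b iha ihb =>
    simp only [Expr.relocate, Expr.slowdown, Expr.cost, Expr.eval, eval_relocate]; nlinarith
  | mul a b iha ihb =>
    simp only [Expr.relocate, Expr.slowdown, Expr.cost, Expr.eval, eval_relocate]; nlinarith
  | div a b iha ihb =>
    simp only [Expr.relocate, Expr.slowdown, Expr.cost, Expr.eval, eval_relocate]; nlinarith

def Prog.relocate : Prog → Prog
  | .skip => .skip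
  | .store a v => .store a.relocate.relocAddr v.relocate
  | .seq c₁ c₂ => .seq c₁.relocate c₂.relocate
  | .ite e c₁ c₂ => .ite e.relocate c₁.relocate c₂.relocate
  | .loop e c => .loop e.relocate c.relocate

/-- A bound for the slowdown of a program by relocation. -/
def Prog.slowdown : Prog → ℕ
  | .skip => 1
  | .store a v => 2 * a.slowdown + v.slowdown + 61
  | .seq c₁ c₂ => c₁.slowdown + c₂.slowdown + 1
  | .ite e c₁ c₂ => e.slowdown + c₁.slowdown + c₂.slowdown + 1
  | .loop e c => e.slowdown + c.slowdown + 1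

/-- The relocated program does on the relocated memory what the program does, and leaves all other
cells alone. -/
theorem Run.relocate {c : Prog} {N N' : Memory} {t : ℕ} (h : Run c N t N') :
    ∀ M : Memory, M ∘ reloc = N → ∃ t' M', Run c.relocate M t' M' ∧ t' ≤ c.slowdown * t ∧
      M' ∘ reloc = N' ∧ ∀ a, (∀ b, a ≠ reloc b) → M' a = M a := by
  induction h with
  | skip N =>
    intro M hM
    exact ⟨1, M, .skip M, by simp [Prog.slowdown], hM, fun _ _ => rfl⟩
  | store a v N =>
    rintro M rfl
    refine ⟨_, _, .store _ _ M, ?_, ?_, ?_⟩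
    · have h1 := a.cost_relocate_le M
      have h2 := v.cost_relocate_le M
      have h3 := a.relocate.cost_relocAddr_le M
      have h4 := a.bitLen_eval_le_cost (M ∘ RAM.reloc)
      rw [Expr.eval_relocate] at h3
      simp only [Prog.slowdown]
      nlinarith
    · funext b
      simp only [Function.comp_apply, Expr.eval_relocAddr, Expr.eval_relocate,
        Function.update_apply, reloc_injective.eq_iff]
    · intro b hb
      rw [Expr.eval_relocAddr, Function.update_of_ne (hb _)]
  | seq _ _ h₁ h₂ =>
    intro M hM
    obtain ⟨t₁, M₁, r₁, e₁, f₁, g₁⟩ := h₁ M hM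
    obtain ⟨t₂, M₂, r₂, e₂, f₂, g₂⟩ := h₂ M₁ f₁
    refine ⟨_, _, .seq r₁ r₂, ?_, f₂, fun a ha => (g₂ a ha).trans (g₁ a ha)⟩
    simp only [Prog.slowdown]; nlinarith
  | ite_pos he _ h =>
    rintro M rfl
    obtain ⟨t₁, M₁, r₁, e₁, f₁, g₁⟩ := h M rfl
    refine ⟨_, _, .ite_pos (by rwa [Expr.eval_relocate]) r₁, ?_, f₁, g₁⟩
    have := Expr.cost_relocate_le M ‹_›
    simp only [Prog.slowdown]; nlinarith
  | ite_neg he _ h =>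
    rintro M rfl
    obtain ⟨t₁, M₁, r₁, e₁, f₁, g₁⟩ := h M rfl
    refine ⟨_, _, .ite_neg (by rwa [Expr.eval_relocate]) r₁, ?_, f₁, g₁⟩
    have := Expr.cost_relocate_le M ‹_›
    simp only [Prog.slowdown]; nlinarith
  | loop_stop he =>
    rintro M rfl
    refine ⟨_, _, Run.loop_stop (by rwa [Expr.eval_relocate]), ?_, rfl, fun _ _ => rfl⟩
    have := Expr.cost_relocate_le M ‹_›
    simp only [Prog.slowdown]; nlinarith
  | @loop_step e c' _ _ _ t₁ t₂ he _ _ h₁ h₂ =>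
    rintro M rfl
    obtain ⟨t₁', M₁, r₁, e₁, f₁, g₁⟩ := h₁ M rfl
    obtain ⟨t₂', M₂, r₂, e₂, f₂, g₂⟩ := h₂ M₁ f₁
    refine ⟨_, _, .loop_step (by rwa [Expr.eval_relocate]) r₁ r₂, ?_, f₂,
      fun a ha => (g₂ a ha).trans (g₁ a ha)⟩
    have := e.cost_relocate_le M
    simp only [Prog.slowdown] at *; nlinarith

end RAM

namespace RAM

/-! ### A calculus for programs that generate lists

A generating program reads its input from the cells `0, 1, 2, …`, keeps its variables in the
negative odd cells and writes the list it generates into the relocated cells `0, 1, 2, …`.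
Variable `0` holds the length of the list generated so far. -/

def varAddr (i : ℕ) : ℤ := -(2 * i + 1)

theorem varAddr_injective : Function.Injective varAddr := by
  intro i j h; unfold varAddr at h; omega

theorem varAddr_ne_reloc (i : ℕ) (a : ℤ) : varAddr i ≠ reloc a := (reloc_ne_odd a i).symm

theorem varAddr_neg (i : ℕ) : varAddr i < 0 := by unfold varAddr; omega

/-- Expressions over the input and the variables. -/
inductive SExpr where
  | lit (z : ℤ)
  | var (i : ℕ)
  | inp (a : SExpr)
  | add (a b : SExpr)
  | sub (a b : SExpr)
  | mul (a b : SExpr)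
  | div (a b : SExpr)

namespace SExpr

def eval (inp : List ℤ) (σ : ℕ → ℤ) : SExpr → ℤ
  | .lit z => z
  | .var i => σ i
  | .inp a => init inp (a.eval inp σ)
  | .add a b => a.eval inp σ + b.eval inp σ
  | .sub a b => a.eval inp σ - b.eval inp σ
  | .mul a b => a.eval inp σ * b.eval inp σ
  | .div a b => a.eval inp σ / b.eval inp σ

/-- The input is read at non-negative addresses only. -/
def Safe (inp : List ℤ) (σ : ℕ → ℤ) : SExpr → Prop
  | .lit _ => True
  | .var _ => True
  | .inp a => 0 ≤ a.eval inp σ ∧ a.Safe inp σ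
  | .add a b => a.Safe inp σ ∧ b.Safe inp σ
  | .sub a b => a.Safe inp σ ∧ b.Safe inp σ
  | .mul a b => a.Safe inp σ ∧ b.Safe inp σ
  | .div a b => a.Safe inp σ ∧ b.Safe inp σ

def compile : SExpr → Expr
  | .lit z => .lit z
  | .var i => .cell (.lit (varAddr i))
  | .inp a => .cell a.compile
  | .add a b => .add a.compile b.compile
  | .sub a b => .sub a.compile b.compile
  | .mul a b => .mul a.compile b.compile
  | .div a b => .div a.compile b.compile

/-- The power of an expression. -/
def pow (e : SExpr) : ℕ → SExpr
  | 0 => .lit 1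
  | n + 1 => .mul (e.pow n) e

theorem eval_pow (inp : List ℤ) (σ : ℕ → ℤ) (e : SExpr) (n : ℕ) :
    (e.pow n).eval inp σ = e.eval inp σ ^ n := by
  induction n with
  | zero => simp [pow, eval]
  | succ n ih => rw [pow, eval, ih, pow_succ]

theorem safe_pow {inp : List ℤ} {σ : ℕ → ℤ} {e : SExpr} (h : e.Safe inp σ) (n : ℕ) :
    (e.pow n).Safe inp σ := by
  induction n with
  | zero => trivial
  | succ n ih => exact ⟨ih, h⟩

end SExpr

theorem init_append_singleton (l : List ℤ) (v : ℤ) :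
    init (l ++ [v]) = Function.update (init l) l.length v := by
  funext a
  rcases eq_or_ne a l.length with rfl | h
  · simp [init]
  · rw [Function.update_of_ne h]
    unfold init
    split_ifs with h0
    · have h1 : a.toNat ≠ l.length := by omega
      rcases lt_or_gt_of_ne h1 with h2 | h2
      · rw [List.getD_append _ _ _ _ h2]
      · rw [List.getD_eq_default _ _ (by simp; omega), List.getD_eq_default _ _ (by omega)]
    · rfl

/-- The memory `M` represents the input `inp`, the values `σ` of the variables and the generated
list `l`; all cells are bounded by `X`. -/
structure Rep (X : ℕ) (inp : List ℤ) (σ : ℕ → ℤ) (l : List ℤ) (M : Memory) : Prop where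
  bound : ∀ a, |M a| ≤ X
  input : ∀ a, 0 ≤ a → M a = init inp a
  var : ∀ i, M (varAddr i) = σ i
  out : ∀ a, M (reloc a) = init l a
  ptr : σ 0 = l.length

namespace Rep

variable {X : ℕ} {inp : List ℤ} {σ : ℕ → ℤ} {l : List ℤ} {M : Memory}

/-- All negative cells of an initial memory are zero, which already represents vanishing variables
and an empty output. -/
theorem initial (h : ∀ z ∈ inp, |z| ≤ (X : ℤ)) : Rep X inp (fun _ => 0) [] (init inp) where
  bound a := by
    unfold init
    split_ifs
    · rcases lt_or_ge a.toNat inp.length with h' | h'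
      · rw [List.getD_eq_getElem _ _ h']; exact h _ (List.getElem_mem h')
      · rw [List.getD_eq_default _ _ h']; simp
    · simp
  input a _ := rfl
  var i := by simp [init, varAddr_neg i]
  out a := by simp [init, reloc_neg a]
  ptr := by simp

theorem bitLen_le (h : Rep X inp σ l M) (a : ℤ) : bitLen (M a) ≤ bitLen X :=
  bitLen_mono (by simpa using h.bound a)

/-- Safety matters because the negative cells, zero in the initial memory, now hold variables and
output. -/
theorem eval_compile (h : Rep X inp σ l M) {e : SExpr} (he : e.Safe inp σ) :
    e.compile.eval M = e.eval inp σ := by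
  induction e with
  | lit z => rfl
  | var i => exact h.var i
  | inp a iha =>
    simp only [SExpr.compile, Expr.eval, SExpr.eval, iha he.2]; exact h.input _ he.1
  | add a b iha ihb =>
    simp only [SExpr.compile, Expr.eval, SExpr.eval, iha he.1, ihb he.2]
  | sub a b iha ihb =>
    simp only [SExpr.compile, Expr.eval, SExpr.eval, iha he.1, ihb he.2]
  | mul a b iha ihb =>
    simp only [SExpr.compile, Expr.eval, SExpr.eval, iha he.1, ihb he.2]
  | div a b iha ihb =>
    simp only [SExpr.compile, Expr.eval, SExpr.eval, iha he.1, ihb he.2]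

theorem cost_le (h : Rep X inp σ l M) (e : Expr) : e.cost M ≤ e.units * bitLen X :=
  e.cost_le (one_le_bitLen _) h.bitLen_le

theorem set (h : Rep X inp σ l M) {i : ℕ} (hi : i ≠ 0) {v : ℤ} (hv : |v| ≤ X) :
    Rep X inp (Function.update σ i v) l (Function.update M (varAddr i) v) where
  bound a := by rw [Function.update_apply]; split_ifs; exacts [hv, h.bound a]
  input a ha := by
    rw [Function.update_of_ne (by have := varAddr_neg i; omega)]; exact h.input a ha
  var j := by
    simp only [Function.update_apply, varAddr_injective.eq_iff, h.var]
  out a := by rw [Function.update_of_ne (varAddr_ne_reloc i a).symm]; exact h.out a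
  ptr := by rw [Function.update_of_ne hi.symm]; exact h.ptr

theorem emit (h : Rep X inp σ l M) {v : ℤ} (hv : |v| ≤ X) (hl : l.length + 1 ≤ X) :
    Rep X inp (Function.update σ 0 (σ 0 + 1)) (l ++ [v])
      (Function.update (Function.update M (reloc (σ 0)) v) (varAddr 0) (σ 0 + 1)) where
  bound a := by
    rw [Function.update_apply, Function.update_apply]
    split_ifs
    -- The output length is itself a stored value and must obey the bound `X`.
    · rw [h.ptr, abs_of_nonneg (by positivity)]; exact_mod_cast hl
    · exact hv
    · exact h.bound a
  input a ha := by
    rw [Function.update_of_ne (by have := varAddr_neg 0; omega),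
      Function.update_of_ne (reloc_ne_nonneg ha).symm]; exact h.input a ha
  var j := by
    simp only [Function.update_apply, varAddr_injective.eq_iff, h.var, varAddr_ne_reloc, if_false]
  out a := by
    rw [Function.update_of_ne (varAddr_ne_reloc 0 a).symm, init_append_singleton, ← h.ptr]
    simp only [Function.update_apply, reloc_injective.eq_iff, h.out]
  ptr := by simp [h.ptr]

end Rep

/-- Started on the variables `σ` and the list `l`, the program `c` halts in time
`k * bitLen X`, with variables and list satisfying `Q`. -/
def WP (X : ℕ) (inp : List ℤ) (c : Prog) (k : ℕ) (Q : (ℕ → ℤ) → List ℤ → Prop) (σ : ℕ → ℤ)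
    (l : List ℤ) : Prop :=
  ∀ M, Rep X inp σ l M → ∃ t M' σ' l', Run c M t M' ∧ t ≤ k * bitLen X ∧ Rep X inp σ' l' M' ∧
    Q σ' l'

def Prog.units : Prog → ℕ
  | .skip => 1
  | .store a v => a.units + v.units + 1
  | .seq c₁ c₂ => c₁.units + c₂.units + 1
  | .ite e c₁ c₂ => e.units + c₁.units + c₂.units + 1
  | .loop e c => e.units + c.units + 1

def Prog.set (i : ℕ) (e : SExpr) : Prog := .store (.lit (varAddr i)) e.compile

def Prog.emit (e : SExpr) : Prog :=
  .seq (.store (SExpr.var 0).compile.relocAddr e.compile) (.set 0 (.add (.var 0) (.lit 1)))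

def Prog.cond (e : SExpr) (c₁ c₂ : Prog) : Prog := .ite e.compile c₁ c₂

/-- `for i < e do c` -/
def Prog.for (i : ℕ) (e : SExpr) (c : Prog) : Prog :=
  .seq (.set i (.lit 0))
    (.loop (SExpr.sub e (.var i)).compile (.seq c (.set i (.add (.var i) (.lit 1)))))

/-- The overhead of one round of a loop. -/
def Prog.forUnits (i : ℕ) (e : SExpr) : ℕ :=
  (Prog.set i (.lit 0)).units + (SExpr.sub e (.var i)).compile.units +
    (Prog.set i (.add (.var i) (.lit 1))).units + 3

section WP

variable {X : ℕ} {inp : List ℤ} {σ : ℕ → ℤ} {l : List ℤ} {Q : (ℕ → ℤ) → List ℤ → Prop}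

theorem WP.mono {c : Prog} {k k' : ℕ} {Q' : (ℕ → ℤ) → List ℤ → Prop} (h : WP X inp c k Q σ l)
    (hk : k ≤ k') (hQ : ∀ σ' l', Q σ' l' → Q' σ' l') : WP X inp c k' Q' σ l := by
  intro M hM
  obtain ⟨t, M', σ', l', r, ht, hM', hq⟩ := h M hM
  exact ⟨t, M', σ', l', r, ht.trans (Nat.mul_le_mul_right _ hk), hM', hQ _ _ hq⟩

theorem wp_seq {c₁ c₂ : Prog} {k₁ k₂ : ℕ} (h : WP X inp c₁ k₁ (WP X inp c₂ k₂ Q) σ l) :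
    WP X inp (.seq c₁ c₂) (k₁ + k₂ + 1) Q σ l := by
  intro M hM
  obtain ⟨t, M', σ', l', r, ht, hM', hq⟩ := h M hM
  obtain ⟨t', M'', σ'', l'', r', ht', hM'', hq'⟩ := hq M' hM'
  refine ⟨_, M'', σ'', l'', .seq r r', ?_, hM'', hq'⟩
  have := one_le_bitLen X
  simp only [add_mul]; omega

theorem wp_skip (h : Q σ l) : WP X inp .skip Prog.skip.units Q σ l := fun M hM =>
  ⟨1, M, σ, l, .skip M, by simpa [Prog.units] using one_le_bitLen X, hM, h⟩

theorem wp_set {i : ℕ} {e : SExpr} (hi : i ≠ 0) (he : e.Safe inp σ) (hv : |e.eval inp σ| ≤ X)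
    (hQ : Q (Function.update σ i (e.eval inp σ)) l) :
    WP X inp (.set i e) (Prog.set i e).units Q σ l := by
  intro M hM
  have h := Run.store (.lit (varAddr i)) e.compile M
  rw [hM.eval_compile he] at h
  refine ⟨_, _, _, _, h, ?_, hM.set hi hv, hQ⟩
  have h1 := hM.cost_le (.lit (varAddr i))
  have h2 := hM.cost_le e.compile
  have := one_le_bitLen X
  simp only [Prog.set, Prog.units, add_mul]; omega

theorem wp_emit {e : SExpr} (he : e.Safe inp σ) (hv : |e.eval inp σ| ≤ X)
    (hl : l.length + 1 ≤ X)
    (hQ : Q (Function.update σ 0 (σ 0 + 1)) (l ++ [e.eval inp σ])) :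
    WP X inp (.emit e) (Prog.emit e).units Q σ l := by
  intro M hM
  have h := Run.store (SExpr.var 0).compile.relocAddr e.compile M
  rw [hM.eval_compile he, Expr.eval_relocAddr, hM.eval_compile (e := .var 0) trivial,
    show (SExpr.var 0).eval inp σ = σ 0 from rfl] at h
  have h' := h.seq (Run.store (.lit (varAddr 0)) (SExpr.add (.var 0) (.lit 1)).compile _)
  have h0 : (SExpr.add (.var 0) (.lit 1)).compile.eval
      (Function.update M (reloc (σ 0)) (e.eval inp σ)) = σ 0 + 1 := by
    simp only [SExpr.compile, Expr.eval]
    rw [Function.update_of_ne (varAddr_ne_reloc _ _), hM.var]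
  have hrep := hM.emit hv hl
  have hb : ∀ a, bitLen (Function.update M (reloc (σ 0)) (e.eval inp σ) a) ≤ bitLen X := by
    intro a
    rw [Function.update_apply]
    split_ifs
    · exact bitLen_mono (by simpa using hv)
    · exact hM.bitLen_le a
  refine ⟨_, _, _, _, h', ?_, ?_, hQ⟩
  · have h1 := hM.cost_le (SExpr.var 0).compile.relocAddr
    have h2 := hM.cost_le e.compile
    have h3 := (Expr.lit (varAddr 0)).cost_le (one_le_bitLen X) hb
    have h4 := (SExpr.add (.var 0) (.lit 1)).compile.cost_le (one_le_bitLen X) hb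
    have := one_le_bitLen X
    simp only [Prog.emit, Prog.set, Prog.units, add_mul] at *; omega
  · rw [h0]; exact hrep

/-- Induction on the number of remaining rounds. The loop condition `e - i` is evaluated anew each
time, so the invariant must fix the value of `e`; the body must preserve the counter, and the next
invariant is demanded after the counter has been advanced. -/
theorem wp_for {i : ℕ} {e : SExpr} {c : Prog} {k N : ℕ} (Inv : ℕ → (ℕ → ℤ) → List ℤ → Prop)
    (hi : i ≠ 0) (hX : N ≤ X) (h0 : Inv 0 (Function.update σ i 0) l)
    (hN : ∀ j ≤ N, ∀ σ l, Inv j σ l → e.Safe inp σ ∧ e.eval inp σ = N ∧ σ i = j)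
    (hc : ∀ j < N, ∀ σ l, Inv j σ l → WP X inp c k
      (fun σ' l' => σ' i = j ∧ Inv (j + 1) (Function.update σ' i ((j + 1 : ℕ) : ℤ)) l') σ l)
    (hQ : ∀ σ l, Inv N σ l → Q σ l) :
    WP X inp (.for i e c) (N * (k + Prog.forUnits i e) + Prog.forUnits i e) Q σ l := by
  have S1 := one_le_bitLen X
  have key : ∀ r j, j + r = N → ∀ σ l, Inv j σ l →
      WP X inp (.loop (SExpr.sub e (.var i)).compile (.seq c (.set i (.add (.var i) (.lit 1)))))
        (r * (k + Prog.forUnits i e) + (SExpr.sub e (.var i)).compile.units + 1) Q σ l := by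
    intro r
    induction r with
    | zero =>
      intro j hj σ l hI M hM
      obtain ⟨h1, h2, h3⟩ := hN j (by omega) σ l hI
      have hs : (SExpr.sub e (.var i)).Safe inp σ := ⟨h1, trivial⟩
      have hv : (SExpr.sub e (.var i)).eval inp σ = 0 := by
        simp only [SExpr.eval, h2, h3]; omega
      refine ⟨_, M, σ, l, Run.loop_stop (by rw [hM.eval_compile hs, hv]; simp), ?_, hM, ?_⟩
      · have := hM.cost_le (SExpr.sub e (.var i)).compile
        simp only [add_mul] at *; omega
      · obtain rfl : j = N := by omega
        exact hQ _ _ hI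
    | succ r ih =>
      intro j hj σ l hI M hM
      obtain ⟨h1, h2, h3⟩ := hN j (by omega) σ l hI
      have hs : (SExpr.sub e (.var i)).Safe inp σ := ⟨h1, trivial⟩
      have hv : (SExpr.sub e (.var i)).eval inp σ = r + 1 := by
        simp only [SExpr.eval, h2, h3]; omega
      have hb : WP X inp (.seq c (.set i (.add (.var i) (.lit 1))))
          (k + (Prog.set i (.add (.var i) (.lit 1))).units + 1) (Inv (j + 1)) σ l := by
        apply wp_seq
        refine (hc j (by omega) σ l hI).mono le_rfl fun σ' l' h => ?_
        have h' : (SExpr.add (.var i) (.lit 1)).eval inp σ' = ((j + 1 : ℕ) : ℤ) := by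
          simp [SExpr.eval, h.1]
        refine wp_set hi ⟨trivial, trivial⟩ ?_ ?_
        · rw [h', abs_of_nonneg (by positivity)]; exact_mod_cast (by omega)
        · rw [h']; exact h.2
      obtain ⟨t, M', σ', l', r₁, ht, hM', hq⟩ := hb M hM
      obtain ⟨t', M'', σ'', l'', r₂, ht', hM'', hq'⟩ := ih (j + 1) (by omega) σ' l' hq M' hM'
      refine ⟨_, M'', σ'', l'', .loop_step (by rw [hM.eval_compile hs, hv]; omega) r₁ r₂,
        ?_, hM'', hq'⟩
      have := hM.cost_le (SExpr.sub e (.var i)).compile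
      have hu : (r + 1) * (k + Prog.forUnits i e) + (SExpr.sub e (.var i)).compile.units + 1
          ≥ (SExpr.sub e (.var i)).compile.units +
          (k + (Prog.set i (.add (.var i) (.lit 1))).units + 1) +
          (r * (k + Prog.forUnits i e) + (SExpr.sub e (.var i)).compile.units + 1) + 1 := by
        have : (r + 1) * (k + Prog.forUnits i e) =
          r * (k + Prog.forUnits i e) + (k + Prog.forUnits i e) := by ring
        rw [this]; unfold Prog.forUnits; omega
      refine le_trans ?_ (Nat.mul_le_mul_right _ hu)
      simp only [add_mul] at *; omega
  refine (wp_seq (wp_set (e := .lit 0) hi trivial (by simp [SExpr.eval]) (key N 0 (by omega) _ l h0))).mono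
    ?_ fun _ _ h => h
  unfold Prog.forUnits; omega

end WP

/-- Generating an input for a program and running the program on it. -/
theorem WP.run_relocate {X : ℕ} {inp l : List ℤ} {gen c : Prog} {k t : ℕ} {M : Memory}
    (hinp : ∀ z ∈ inp, |z| ≤ (X : ℤ))
    (hgen : WP X inp gen k (fun _ l' => l' = l) (fun _ => 0) []) (hc : Run c (init l) t M) :
    ∃ t' M', Run (.seq gen c.relocate) (init inp) t' M' ∧
      t' ≤ k * bitLen X + c.slowdown * t + 1 ∧ (∀ a, M' (reloc a) = M a) ∧
      (∀ a, 0 ≤ a → M' a = init inp a) ∧ ∀ a, bitLen (M' a) ≤ bitLen X + t' := by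
  obtain ⟨t₁, M₁, σ, l', r₁, ht₁, hM₁, rfl⟩ := hgen _ (Rep.initial hinp)
  obtain ⟨t₂, M₂, r₂, ht₂, hM₂, hM₂'⟩ := hc.relocate M₁ (funext hM₁.out)
  have r := r₁.seq r₂
  refine ⟨_, M₂, r, by omega, fun a => congrFun hM₂ a, fun a ha => ?_, fun a => ?_⟩
  -- Nonnegative cells are not relocated addresses, so the original input survives; a later test
  -- reads it again.
  · rw [hM₂' a fun b => (reloc_ne_nonneg ha).symm, hM₁.input a ha]
  · exact (r.bitLen_le a).trans (Nat.add_le_add_right ((Rep.initial hinp).bitLen_le a) _)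

end RAM

/-! ### Piecewise linear interpolation -/

section Interp

variable {E : Type*} [NormedAddCommGroup E] [NormedSpace ℝ E]

/-- The piecewise linear function with values `f 0, f 1, …` at `0, 1, …`. -/
noncomputable def interp (f : ℕ → E) (t : ℝ) : E :=
  (1 - Int.fract t) • f ⌊t⌋₊ + Int.fract t • f (⌊t⌋₊ + 1)

theorem polyline_eq_interp (a : List Plane) : polyline a = interp fun i => a.getD i 0 := rfl

theorem interp_natCast (f : ℕ → E) (n : ℕ) : interp f n = f n := by simp [interp]

theorem interp_zero (f : ℕ → E) : interp f 0 = f 0 := by simp [interp]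

theorem interp_of_mem (f : ℕ → E) {z : ℕ} {t : ℝ} (h₁ : z ≤ t) (h₂ : t ≤ z + 1) :
    interp f t = (1 - (t - z)) • f z + (t - z) • f (z + 1) := by
  rcases h₂.lt_or_eq with h | rfl
  · have hf : ⌊t⌋₊ = z := (Nat.floor_eq_iff (by have : (0:ℝ) ≤ z := z.cast_nonneg; linarith)).2 ⟨h₁, h⟩
    have hfr : Int.fract t = t - z := by
      rw [Int.fract, ← hf, natCast_floor_eq_intCast_floor (le_trans z.cast_nonneg h₁)]
    rw [interp, hf, hfr]
  · have : ((z : ℝ) + 1) = ((z + 1 : ℕ) : ℝ) := by push_cast; rfl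
    rw [this, interp_natCast]; simp

theorem interp_combo (f : ℕ → E) {z : ℕ} {x y θ : ℝ} (hx : z ≤ x) (hxy : x ≤ y) (hy : y ≤ z + 1)
    (h0 : 0 ≤ θ) (h1 : θ ≤ 1) :
    interp f ((1 - θ) * x + θ * y) = (1 - θ) • interp f x + θ • interp f y := by
  have hm : x ≤ (1 - θ) * x + θ * y := by nlinarith
  have hm' : (1 - θ) * x + θ * y ≤ y := by nlinarith
  rw [interp_of_mem f (hx.trans hm) (hm'.trans hy), interp_of_mem f hx (hxy.trans hy),
    interp_of_mem f (hx.trans hxy) hy]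
  simp only [smul_add, smul_smul]
  module

theorem exists_cell {t : ℝ} {K : ℕ} (h₀ : 0 ≤ t) (hK : t ≤ K) (hpos : 0 < K) :
    ∃ z < K, (z : ℝ) ≤ t ∧ t ≤ z + 1 := by
  rcases hK.lt_or_eq with h | rfl
  · exact ⟨⌊t⌋₊, (Nat.floor_lt h₀).2 h, Nat.floor_le h₀, (Nat.lt_floor_add_one t).le⟩
  · refine ⟨K - 1, by omega, by exact_mod_cast (by omega), ?_⟩
    rw [Nat.cast_sub hpos]; simp

theorem interp_add_one (f : ℕ → E) {t : ℝ} (h : 0 ≤ t) :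
    interp f (t + 1) = interp (fun i => f (i + 1)) t := by
  have h1 := Nat.floor_le h
  have h2 := (Nat.lt_floor_add_one t).le
  rw [interp_of_mem (z := ⌊t⌋₊ + 1) f (by push_cast; linarith) (by push_cast; linarith),
    interp_of_mem (z := ⌊t⌋₊) _ h1 h2]
  push_cast
  simp only [add_sub_add_right_eq_sub]

/-- As a sum of increments with clamped coefficients the curve is visibly continuous, and for real
values with nonnegative increments visibly monotone, without case distinctions at the integers. -/
theorem interp_eq_sum (f : ℕ → E) {t : ℝ} (ht : 0 ≤ t) (K : ℕ) (hK : t ≤ K) :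
    interp f t = f 0 + ∑ i ∈ Finset.range K, (max 0 (min (t - i) 1)) • (f (i + 1) - f i) := by
  -- The induction also needs the case `K ≤ t`, where all coefficients are saturated at `1` and the
  -- sum telescopes to `f K`.
  suffices H : ∀ K : ℕ, (t ≤ K → interp f t =
      f 0 + ∑ i ∈ Finset.range K, (max 0 (min (t - i) 1)) • (f (i + 1) - f i)) ∧
      (K ≤ t → f K =
        f 0 + ∑ i ∈ Finset.range K, (max 0 (min (t - i) 1)) • (f (i + 1) - f i)) from
    (H K).1 hK
  intro K
  induction K with
  | zero =>
    refine ⟨fun h => ?_, fun _ => by simp⟩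
    obtain rfl : t = 0 := le_antisymm (by simpa using h) ht
    simp [interp_zero]
  | succ K ih =>
    refine ⟨fun h => ?_, fun h => ?_⟩
    · rw [Finset.sum_range_succ, ← add_assoc]
      rcases le_total t K with h' | h'
      · rw [← ih.1 h', max_eq_left (by rw [min_eq_left] <;> linarith)]; simp
      · push_cast at h
        rw [← ih.2 h', min_eq_left (by linarith), max_eq_right (by linarith),
          interp_of_mem f h' h]
        module
    · push_cast at h
      rw [Finset.sum_range_succ, ← add_assoc, ← ih.2 (by linarith), min_eq_right (by linarith),
        max_eq_right (by norm_num)]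
      simp

theorem continuousOn_interp (f : ℕ → E) (K : ℕ) : ContinuousOn (interp f) (Set.Icc 0 K) := by
  have : ContinuousOn (fun t : ℝ => f 0 +
      ∑ i ∈ Finset.range K, (max 0 (min (t - i) 1)) • (f (i + 1) - f i)) (Set.Icc 0 K) := by
    fun_prop
  exact this.congr fun t ht => interp_eq_sum f ht.1 K ht.2

theorem monotoneOn_interp {f : ℕ → ℝ} {K : ℕ} (hf : ∀ i < K, f i ≤ f (i + 1)) :
    MonotoneOn (interp f) (Set.Icc 0 K) := by
  intro s hs t ht hst
  rw [interp_eq_sum f hs.1 K hs.2, interp_eq_sum f ht.1 K ht.2]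
  refine add_le_add le_rfl (Finset.sum_le_sum fun i hi => ?_)
  exact mul_le_mul_of_nonneg_right (max_le_max le_rfl (min_le_min (by linarith) le_rfl))
    (sub_nonneg.2 (hf i (Finset.mem_range.1 hi)))

/-- A linear bound at the vertices between two integer parameters holds in between. -/
theorem interp_mem_of_convex {s : Set E} (hs : Convex ℝ s) (f : ℕ → E) {a b : ℕ}
    (h : ∀ i, a ≤ i → i ≤ b → f i ∈ s) {t : ℝ} (ha : a ≤ t) (hb : t ≤ b) : interp f t ∈ s := by
  rcases hb.lt_or_eq with hb | rfl
  · have h0 : 0 ≤ t := le_trans a.cast_nonneg ha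
    have h1 : a ≤ ⌊t⌋₊ := Nat.le_floor ha
    have h2 : ⌊t⌋₊ < b := (Nat.floor_lt h0).2 hb
    rw [interp_of_mem f (Nat.floor_le h0) (Nat.lt_floor_add_one t).le]
    have := Nat.floor_le h0
    have := Nat.lt_floor_add_one t
    exact hs (h _ h1 h2.le) (h _ (by omega) h2) (by linarith) (by linarith) (by ring)
  · rw [interp_natCast]
    exact h b (by exact_mod_cast ha) le_rfl

end Interp

theorem isReparam_interp {σ : ℕ → ℝ} {K n : ℕ} (h0 : σ 0 = 0) (hK : σ K = (n : ℝ) - 1)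
    (hσ : ∀ i < K, σ i ≤ σ (i + 1)) : IsReparam n fun μ => interp σ (K * μ) := by
  have hmap : Set.MapsTo (fun μ : ℝ => (K : ℝ) * μ) (Set.Icc 0 1) (Set.Icc 0 K) := by
    intro μ hμ
    exact ⟨mul_nonneg K.cast_nonneg hμ.1, mul_le_of_le_one_right K.cast_nonneg hμ.2⟩
  have hc : ContinuousOn (fun μ => interp σ (K * μ)) (Set.Icc 0 1) :=
    (continuousOn_interp σ K).comp (by fun_prop) hmap
  have hm : MonotoneOn (fun μ => interp σ (K * μ)) (Set.Icc 0 1) := by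
    intro s hs t ht hst
    exact monotoneOn_interp hσ (hmap hs) (hmap ht) (mul_le_mul_of_nonneg_left hst K.cast_nonneg)
  have e0 : interp σ (K * 0) = 0 := by rw [mul_zero, interp_zero, h0]
  have e1 : interp σ (K * 1) = n - 1 := by rw [mul_one, interp_natCast, hK]
  refine ⟨hc, hm, Set.Subset.antisymm ?_ ?_⟩
  · rintro _ ⟨μ, hμ, rfl⟩
    have h1 := hm (by simp) hμ hμ.1
    have h2 := hm hμ (by simp) hμ.2
    simp only [e0, e1] at h1 h2
    exact ⟨h1, h2⟩
  · have := intermediate_value_Icc zero_le_one hc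
    simpa only [e0, e1] using this

theorem isReparam_linear {n : ℕ} (hn : 1 ≤ n) :
    IsReparam n fun μ => interp (fun i => (i : ℝ)) ((n - 1 : ℕ) * μ) :=
  isReparam_interp (by simp) (by simp [Nat.cast_sub hn]) (by simp)

/-! ### The Fréchet distance of polygonal curves -/

theorem frechetDist_le {a b : List Plane} {r : ℝ} {α β : ℝ → ℝ} (hα : IsReparam a.length α)
    (hβ : IsReparam b.length β)
    (h : ∀ μ ∈ Set.Icc (0 : ℝ) 1, dist (polyline a (α μ)) (polyline b (β μ)) ≤ r) :
    frechetDist a b ≤ r := by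
  refine csInf_le ⟨0, ?_⟩ ⟨α, β, hα, hβ, h⟩
  rintro s ⟨α, β, -, -, h⟩
  exact dist_nonneg.trans (h 0 (by simp))

theorem frechetDist_nonneg (a b : List Plane) : 0 ≤ frechetDist a b := by
  refine Real.sInf_nonneg ?_
  rintro s ⟨α, β, -, -, h⟩
  exact dist_nonneg.trans (h 0 (by simp))

/-- The infimum of the empty set would be `0`, so some admissible radius has to exist; polygonal
curves are bounded, and linear reparametrizations provide one. -/
theorem le_frechetDist {a b : List Plane} (ha : a ≠ []) (hb : b ≠ []) {r : ℝ}
    (h : ∀ s < r, ∀ α β : ℝ → ℝ, IsReparam a.length α → IsReparam b.length β →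
      (∀ μ ∈ Set.Icc (0 : ℝ) 1, dist (polyline a (α μ)) (polyline b (β μ)) ≤ s) → False) :
    r ≤ frechetDist a b := by
  refine le_csInf ?_ ?_
  · have bdd : ∀ l : List Plane, l ≠ [] → ∀ α, IsReparam l.length α → ∃ C, ∀ μ ∈ Set.Icc (0 : ℝ) 1,
        ‖polyline l (α μ)‖ ≤ C := by
      intro l hl α hα
      have hl' : 1 ≤ l.length := List.length_pos_iff.2 hl
      obtain ⟨C, hC⟩ := isCompact_Icc.exists_bound_of_continuousOn
        (continuousOn_interp (fun i => l.getD i 0) (l.length - 1))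
      refine ⟨C, fun μ hμ => hC _ ?_⟩
      have : α μ ∈ α '' Set.Icc 0 1 := ⟨μ, hμ, rfl⟩
      rw [hα.2.2] at this
      rwa [Nat.cast_sub hl', Nat.cast_one]
    have hα := isReparam_linear (List.length_pos_iff.2 ha)
    have hβ := isReparam_linear (List.length_pos_iff.2 hb)
    obtain ⟨C₁, h₁⟩ := bdd a ha _ hα
    obtain ⟨C₂, h₂⟩ := bdd b hb _ hβ
    exact ⟨C₁ + C₂, _, _, hα, hβ, fun μ hμ =>
      (dist_le_norm_add_norm _ _).trans (add_le_add (h₁ μ hμ) (h₂ μ hμ))⟩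
  · rintro s ⟨α, β, hα, hβ, hs⟩
    by_contra hlt
    exact h s (not_le.1 hlt) α β hα hβ hs

/-- The curves `a` and `b` are matched within distance `r` by sequences of parameters that
advance within one edge at a time. -/
def Matched (r : ℝ) (a b : List Plane) : Prop :=
  ∃ (K : ℕ) (σ τ : ℕ → ℝ), σ 0 = 0 ∧ τ 0 = 0 ∧ σ K = (a.length : ℝ) - 1 ∧
    τ K = (b.length : ℝ) - 1 ∧
    (∀ i < K, ∃ z : ℕ, z ≤ σ i ∧ σ i ≤ σ (i + 1) ∧ σ (i + 1) ≤ z + 1) ∧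
    (∀ i < K, ∃ z : ℕ, z ≤ τ i ∧ τ i ≤ τ (i + 1) ∧ τ (i + 1) ≤ z + 1) ∧
    ∀ i ≤ K, dist (polyline a (σ i)) (polyline b (τ i)) ≤ r

namespace Matched

variable {r : ℝ} {a b : List Plane} {x x' y y' z : Plane}

/-- Between consecutive parameters both points move affinely along one edge each, and the distance
of two affine motions is convex, hence bounded by its end values. -/
theorem frechetDist_le (h : Matched r a b) : frechetDist a b ≤ r := by
  obtain ⟨K, σ, τ, hσ0, hτ0, hσK, hτK, hσ, hτ, hd⟩ := h
  refine _root_.frechetDist_le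
    (isReparam_interp hσ0 hσK fun i hi => (hσ i hi).choose_spec.2.1)
    (isReparam_interp hτ0 hτK fun i hi => (hτ i hi).choose_spec.2.1) fun μ hμ => ?_
  rcases Nat.eq_zero_or_pos K with rfl | hK
  · simpa [interp_zero] using hd 0 le_rfl
  obtain ⟨i, hi, h1, h2⟩ := exists_cell (mul_nonneg K.cast_nonneg hμ.1)
    (mul_le_of_le_one_right K.cast_nonneg hμ.2) hK
  obtain ⟨p, p1, p2, p3⟩ := hσ i hi
  obtain ⟨q, q1, q2, q3⟩ := hτ i hi
  rw [interp_of_mem σ h1 h2, interp_of_mem τ h1 h2]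
  set θ : ℝ := K * μ - i
  have t0 : 0 ≤ θ := by simp only [θ]; linarith
  have t1 : θ ≤ 1 := by simp only [θ]; linarith
  simp only [smul_eq_mul]
  rw [polyline_eq_interp, polyline_eq_interp, interp_combo _ p1 p2 p3 t0 t1,
    interp_combo _ q1 q2 q3 t0 t1]
  have d1 := hd i hi.le
  have d2 := hd (i + 1) hi
  rw [polyline_eq_interp, polyline_eq_interp] at d1 d2
  refine (dist_add_add_le _ _ _ _).trans ?_
  rw [dist_smul₀, dist_smul₀, Real.norm_of_nonneg t0, Real.norm_of_nonneg (by linarith)]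
  nlinarith

theorem symm (h : Matched r a b) : Matched r b a := by
  obtain ⟨K, σ, τ, hσ0, hτ0, hσK, hτK, hσ, hτ, hd⟩ := h
  exact ⟨K, τ, σ, hτ0, hσ0, hτK, hσK, hτ, hσ, fun i hi => by rw [dist_comm]; exact hd i hi⟩

theorem single (h : dist x y ≤ r) : Matched r [x] [y] :=
  ⟨0, fun _ => 0, fun _ => 0, rfl, rfl, by simp, by simp, by simp, by simp,
    by simpa [polyline_eq_interp, interp_zero] using h⟩

theorem nonneg_of_cells {σ : ℕ → ℝ} {K : ℕ} (h0 : σ 0 = 0)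
    (h : ∀ i < K, ∃ z : ℕ, z ≤ σ i ∧ σ i ≤ σ (i + 1) ∧ σ (i + 1) ≤ z + 1) :
    ∀ i ≤ K, 0 ≤ σ i := by
  intro i hi
  rcases i with _ | i
  · rw [h0]
  · obtain ⟨z, h1, h2, -⟩ := h i (by omega)
    exact (z.cast_nonneg.trans h1).trans h2

theorem polyline_cons (x : Plane) (a : List Plane) {t : ℝ} (ht : 0 ≤ t) :
    polyline (x :: a) (t + 1) = polyline a t := by
  rw [polyline_eq_interp, interp_add_one _ ht]; rfl

theorem polyline_cons_zero (x : Plane) (a : List Plane) : polyline (x :: a) 0 = x := by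
  rw [polyline_eq_interp, interp_zero]; rfl

/-- The elementary moves of a matching, built from the end of the curves backwards: here both curves
advance by an edge; in `left` and `right` one of them rests. -/
theorem both (hd : dist x y ≤ r) (h : Matched r (x' :: a) (y' :: b)) :
    Matched r (x :: x' :: a) (y :: y' :: b) := by
  obtain ⟨K, σ, τ, hσ0, hτ0, hσK, hτK, hσ, hτ, h⟩ := h
  have cells : ∀ {ρ : ℕ → ℝ}, ρ 0 = 0 →
      (∀ i < K, ∃ z : ℕ, z ≤ ρ i ∧ ρ i ≤ ρ (i + 1) ∧ ρ (i + 1) ≤ z + 1) → ∀ i < K + 1, ∃ z : ℕ,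
      z ≤ (Nat.casesOn i 0 fun i => ρ i + 1 : ℝ) ∧
      (Nat.casesOn i 0 fun i => ρ i + 1 : ℝ) ≤ ρ i + 1 ∧ ρ i + 1 ≤ (z : ℝ) + 1 := by
    intro ρ h0 hρ i hi
    rcases i with _ | i
    · exact ⟨0, by simp [h0]⟩
    · obtain ⟨z, h1, h2, h3⟩ := hρ i (by omega)
      refine ⟨z + 1, ?_⟩
      push_cast
      exact ⟨by linarith, by linarith, by linarith⟩
  refine ⟨K + 1, fun i => Nat.casesOn i 0 fun i => σ i + 1, fun i => Nat.casesOn i 0 fun i => τ i + 1,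
    rfl, rfl, ?_, ?_, cells hσ0 hσ, cells hτ0 hτ, ?_⟩
  · simp [hσK]
  · simp [hτK]
  · intro i hi
    rcases i with _ | i
    · simpa [polyline_cons_zero] using hd
    · have := h i (by omega)
      simp only
      rwa [polyline_cons _ _ (nonneg_of_cells hσ0 hσ i (by omega)),
        polyline_cons _ _ (nonneg_of_cells hτ0 hτ i (by omega))]

theorem left (hd : dist x y ≤ r) (h : Matched r (x' :: a) (y :: b)) :
    Matched r (x :: x' :: a) (y :: b) := by
  obtain ⟨K, σ, τ, hσ0, hτ0, hσK, hτK, hσ, hτ, h⟩ := h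
  refine ⟨K + 1, fun i => Nat.casesOn i 0 fun i => σ i + 1, fun i => Nat.casesOn i 0 fun i => τ i,
    rfl, rfl, ?_, ?_, ?_, ?_, ?_⟩
  · simp [hσK]
  · simpa using hτK
  · intro i hi
    rcases i with _ | i
    · exact ⟨0, by simp [hσ0]⟩
    · obtain ⟨z, h1, h2, h3⟩ := hσ i (by omega)
      refine ⟨z + 1, ?_⟩
      push_cast
      exact ⟨by linarith, by linarith, by linarith⟩
  · intro i hi
    rcases i with _ | i
    · exact ⟨0, by simp [hτ0]⟩
    · exact hτ i (by omega)
  · intro i hi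
    rcases i with _ | i
    · simpa [polyline_cons_zero] using hd
    · have := h i (by omega)
      simp only
      rwa [polyline_cons _ _ (nonneg_of_cells hσ0 hσ i (by omega))]

theorem right (hd : dist x y ≤ r) (h : Matched r (x :: a) (y' :: b)) :
    Matched r (x :: a) (y :: y' :: b) :=
  (h.symm.left (by rwa [dist_comm])).symm

/-- A subdividing point of the first edge may be dropped. -/
theorem of_subdivided_left (hz : z ∈ segment ℝ x x') (h : Matched r (x :: z :: x' :: a) b) :
    Matched r (x :: x' :: a) b := by
  obtain ⟨K, σ, τ, hσ0, hτ0, hσK, hτK, hσ, hτ, h⟩ := h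
  rw [segment_eq_image'] at hz
  obtain ⟨l, ⟨l0, l1⟩, hz⟩ := hz
  -- Sends the vertex indices of the subdivided curve to parameters of the original one: the dropped
  -- point lies at the fraction `l` of the first edge, and later indices shift down by one.
  let ψ : ℕ → ℝ := fun i => Nat.casesOn i 0 fun i => Nat.casesOn i l fun i => (i : ℝ) + 1
  have ψcell : ∀ z : ℕ, ∃ w : ℕ, w ≤ ψ z ∧ ψ z ≤ ψ (z + 1) ∧ ψ (z + 1) ≤ w + 1 := by
    intro z
    rcases z with _ | _ | z
    · exact ⟨0, by simp [ψ, l0, l1]⟩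
    · refine ⟨0, by simpa [ψ] using l0, ?_, ?_⟩
      · change l ≤ ((0 : ℕ) : ℝ) + 1
        simpa using l1
      · change ((0 : ℕ) : ℝ) + 1 ≤ ((0 : ℕ) : ℝ) + 1
        exact le_rfl
    · exact ⟨z + 1, by simp [ψ]⟩
  have key : ∀ t, 0 ≤ t →
      polyline (x :: x' :: a) (interp ψ t) = polyline (x :: z :: x' :: a) t := by
    intro t ht
    have f1 := Nat.floor_le ht
    have f2 := (Nat.lt_floor_add_one t).le
    obtain ⟨w, w1, w2, w3⟩ := ψcell ⌊t⌋₊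
    rw [interp_of_mem ψ f1 f2, smul_eq_mul, smul_eq_mul, polyline_eq_interp,
      interp_combo _ w1 w2 w3 (by linarith) (by linarith), polyline_eq_interp,
      interp_of_mem _ f1 f2]
    have hv : ∀ i, interp (fun i => (x :: x' :: a).getD i 0) (ψ i) =
        (x :: z :: x' :: a).getD i 0 := by
      intro i
      rcases i with _ | _ | i
      · simp [ψ, interp_zero]
      · rw [interp_of_mem (z := 0) _ (by simpa [ψ] using l0) (by simpa [ψ] using l1), ← hz]
        simp [ψ]
        module
      · have : ψ (i + 2) = ((i + 1 : ℕ) : ℝ) := by simp [ψ]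
        rw [this, interp_natCast]; rfl
    rw [hv ⌊t⌋₊, hv (⌊t⌋₊ + 1)]
  refine ⟨K, fun i => interp ψ (σ i), τ, by simp [hσ0, interp_zero, ψ], hτ0, ?_, hτK, ?_, hτ, ?_⟩
  · have : σ K = ((a.length + 2 : ℕ) : ℝ) := by rw [hσK]; push_cast [List.length_cons]; ring
    simp only
    rw [this, interp_natCast]; simp [ψ]
  · intro i hi
    obtain ⟨z, h1, h2, h3⟩ := hσ i hi
    obtain ⟨w, w1, w2, w3⟩ := ψcell z
    refine ⟨w, ?_⟩
    simp only
    rw [interp_of_mem ψ h1 (h2.trans h3), interp_of_mem ψ (h1.trans h2) h3]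
    simp only [smul_eq_mul]
    refine ⟨?_, ?_, ?_⟩ <;> nlinarith
  · intro i hi
    rw [key _ (nonneg_of_cells hσ0 hσ i hi)]
    exact h i hi

theorem of_subdivided_right (hz : z ∈ segment ℝ y y') (h : Matched r a (y :: z :: y' :: b)) :
    Matched r a (y :: y' :: b) :=
  (of_subdivided_left hz h.symm).symm

end Matched

/-! ### The map matching instance of an orthogonal vectors instance -/

/-- The data of the construction: `n` vectors `a 1, …, a n` and `m` vectors `b 0, …, b (m - 1)` of
dimension `d`, the number `pads` of additional vertices, the length `blk` of the part of the
trajectory that belongs to one of the vectors `b j`, and the unit of length. -/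
structure Gadget where
  n : ℕ
  m : ℕ
  d : ℕ
  pads : ℕ
  blk : ℕ
  unit : ℕ
  a : ℕ → ℕ → Bool
  b : ℕ → ℕ → Bool

namespace Gadget

/-- The rows `0` and `n + 1` belong to the zero vector. -/
structure Good (G : Gadget) : Prop where
  n_pos : 1 ≤ G.n
  m_pos : 1 ≤ G.m
  unit_pos : 1 ≤ G.unit
  pads_pos : 1 ≤ G.pads
  blk_ge : 4 * G.d + 4 ≤ G.blk
  a_first : ∀ k, G.a 0 k = false
  a_last : ∀ k, G.a (G.n + 1) k = false

variable (G : Gadget)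

/-- The number of vertices of a row. -/
def width : ℕ := 2 * G.d + 2

/-- The number of vertices in the rows. -/
def core : ℕ := (G.n + 2) * G.width

def numVerts : ℕ := G.core + 1 + G.pads

def numEdges : ℕ := (G.n + 2) * (2 * G.d + 1) + G.n + G.n + 2 + (G.pads - 1)

/-- Half the distance of the two vertices of row `y` that represent the `k`-th bit. -/
def gap (y k : ℕ) : ℤ := if G.a y k then 6 else 2

/-- The abscissa of column `c` of row `y`. -/
def X (y : ℕ) (c : ℤ) : ℤ :=
  if c < 0 then -3 * G.unit + c + 1
  else if c = 0 then 0
  else if c ≤ 2 * G.d then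
    (16 * ((c - 1) / 2) + 10 +
      (if (c - 1) % 2 = 0 then - G.gap y ((c - 1) / 2).toNat else G.gap y ((c - 1) / 2).toNat)) *
        G.unit
  else if c = 2 * G.d + 1 then (16 * G.d + 10) * G.unit
  else (16 * G.d + 10) * G.unit + 3 * G.unit + (c - 2 * G.d - 2)

def row (v : ℕ) : ℕ := if v < G.core then v / G.width else if v = G.core then G.n + 1 else 0

def col (v : ℕ) : ℤ :=
  if v < G.core then ((v % G.width : ℕ) : ℤ)
  else if v = G.core then 2 * G.d + 2 else G.core - v

def pos (v : ℕ) : ℤ × ℤ := (G.X (G.row v) (G.col v), G.row v)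

/-- A row has one edge less than it has vertices, so the number of an edge is shifted by the number
of preceding rows. -/
def rowEdge (e : ℕ) : ℕ × ℕ := (e + e / (2 * G.d + 1), e + e / (2 * G.d + 1) + 1)

/-- With `y < n` the left column reaches the rows `0, …, n` and the right column the rows `1, …, n +
1`; the missing links force a crossing of a row strictly in between. -/
def leftEdge (y : ℕ) : ℕ × ℕ := (y * G.width, (y + 1) * G.width)

def rightEdge (y : ℕ) : ℕ × ℕ :=
  ((y + 1) * G.width + 2 * G.d + 1, (y + 2) * G.width + 2 * G.d + 1)

def padEdge (i : ℕ) : ℕ × ℕ := (G.core + 1 + i, G.core + 2 + i)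

def edges : List (ℕ × ℕ) :=
  (List.range ((G.n + 2) * (2 * G.d + 1))).map G.rowEdge ++ (List.range G.n).map G.leftEdge ++
    (List.range G.n).map G.rightEdge ++ [(G.core - 1, G.core), (0, G.core + 1)] ++
    (List.range (G.pads - 1)).map G.padEdge

/-- The abscissa, in units, of the point of the trajectory with index `r` in block `j`. -/
def wiggle (j r : ℕ) : ℤ :=
  if r < 2 then 0
  else if r < 2 + 4 * G.d then
    16 * (((r - 2) / 4 : ℕ) : ℤ) + 10 +
      (if (r - 2) % 4 = 0 then -3
       else if (r - 2) % 4 = 1 then (if G.b j ((r - 2) / 4) then 3 else 1)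
       else if (r - 2) % 4 = 2 then -(if G.b j ((r - 2) / 4) then 3 else 1)
       else 3)
  else 16 * G.d + 10

/-- The abscissas of the points of the trajectory, in units. -/
def trajX (t : ℕ) : ℤ :=
  if t = 0 then -3 else if t = G.m * G.blk - 1 then 16 * G.d + 13
  else G.wiggle (t / G.blk) (t % G.blk)

/-- The trajectory stays on the axis, while row `y` has height `y`. Heights are small against the
unit of length, so only abscissas matter. -/
def toInstance : MapInstance where
  verts := (List.range G.numVerts).map G.pos
  edges := G.edges
  traj := (List.range (G.m * G.blk)).map fun t => (G.trajX t * G.unit, 0)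

variable {G}

theorem gap_cases (G : Gadget) (y k : ℕ) : G.gap y k = 6 ∨ G.gap y k = 2 := by
  unfold gap; split_ifs <;> simp

theorem width_pos (G : Gadget) : 0 < G.width := by unfold width; omega

theorem X_zero (y : ℕ) : G.X y 0 = 0 := by simp [X]

theorem X_last (y : ℕ) : G.X y (2 * G.d + 1) = (16 * G.d + 10) * G.unit := by
  unfold X
  rw [if_neg (by omega), if_neg (by omega), if_neg (by omega), if_pos rfl]

theorem X_odd (y : ℕ) {k : ℕ} (hk : k < G.d) :
    G.X y (2 * k + 1) = (16 * k + 10 - G.gap y k) * G.unit := by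
  unfold X
  rw [if_neg (by omega), if_neg (by omega), if_pos (by omega), if_pos (by omega)]
  have : ((2 * (k : ℤ) + 1 - 1) / 2) = k := by omega
  rw [this]; simp [sub_eq_add_neg]

theorem X_even (y : ℕ) {k : ℕ} (hk : k < G.d) :
    G.X y (2 * k + 2) = (16 * k + 10 + G.gap y k) * G.unit := by
  unfold X
  rw [if_neg (by omega), if_neg (by omega), if_pos (by omega), if_neg (by omega)]
  have : ((2 * (k : ℤ) + 2 - 1) / 2) = k := by omega
  rw [this]; simp

theorem X_neg (y : ℕ) {c : ℤ} (hc : c < 0) : G.X y c = -3 * G.unit + c + 1 := by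
  unfold X; rw [if_pos hc]

theorem X_far (y : ℕ) {c : ℤ} (hc : 2 * G.d + 1 < c) :
    G.X y c = (16 * G.d + 10) * G.unit + 3 * G.unit + (c - 2 * G.d - 2) := by
  unfold X
  rw [if_neg (by omega), if_neg (by omega), if_neg (by omega), if_neg (by omega)]

theorem col_trichotomy (G : Gadget) (c : ℤ) : c < 0 ∨ c = 0 ∨ (∃ k : ℕ, k < G.d ∧ c = 2 * k + 1) ∨
    (∃ k : ℕ, k < G.d ∧ c = 2 * k + 2) ∨ c = 2 * G.d + 1 ∨ 2 * G.d + 1 < c := by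
  rcases lt_trichotomy c 0 with h | h | h
  · exact .inl h
  · exact .inr (.inl h)
  rcases lt_trichotomy c (2 * G.d + 1) with h' | h' | h'
  · rcases Int.even_or_odd' c with ⟨k, hk | hk⟩
    · exact .inr (.inr (.inr (.inl ⟨(k - 1).toNat, by omega, by omega⟩)))
    · exact .inr (.inr (.inl ⟨k.toNat, by omega, by omega⟩))
  · exact .inr (.inr (.inr (.inr (.inl h'))))
  · exact .inr (.inr (.inr (.inr (.inr h'))))

/-- The bits are centred `16` units apart and reach at most `6` units to either side, so consecutive
columns never overlap. Planarity rests on this ordering. -/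
theorem strictMono_X (hG : G.Good) (y : ℕ) : StrictMono (G.X y) := by
  have hu : (1 : ℤ) ≤ G.unit := by exact_mod_cast hG.unit_pos
  refine strictMono_int_of_lt_succ fun c => ?_
  rcases col_trichotomy G c with h | rfl | ⟨k, hk, rfl⟩ | ⟨k, hk, rfl⟩ | rfl | h
  · rw [X_neg y h]
    rcases (show c + 1 ≤ 0 by omega).lt_or_eq with h' | h'
    · rw [X_neg y h']; omega
    · rw [h', X_zero]; omega
  · rw [X_zero]
    rcases Nat.eq_zero_or_pos G.d with h' | h'
    · have := X_last (G := G) y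
      rw [h'] at this
      simp only [Nat.cast_zero, mul_zero] at this
      rw [this]; omega
    · have := X_odd y h'
      simp only [Nat.cast_zero, mul_zero] at this
      rw [this]
      rcases gap_cases G y 0 with h | h <;> rw [h] <;> omega
  · rw [show 2 * (k : ℤ) + 1 + 1 = 2 * k + 2 by ring, X_odd y hk, X_even y hk]
    rcases gap_cases G y k with h | h <;> rw [h] <;> nlinarith
  · rw [X_even y hk]
    rcases (show k + 1 ≤ G.d by omega).lt_or_eq with h' | h'
    · rw [show 2 * (k : ℤ) + 2 + 1 = 2 * ((k + 1 : ℕ) : ℤ) + 1 by push_cast; ring, X_odd y h']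
      push_cast
      rcases gap_cases G y k with h | h <;> rcases gap_cases G y (k + 1) with h'' | h'' <;>
        rw [h, h''] <;> nlinarith
    · rw [show 2 * (k : ℤ) + 2 + 1 = 2 * (G.d : ℤ) + 1 by omega, X_last, ← h']
      push_cast
      rcases gap_cases G y k with h | h <;> rw [h] <;> nlinarith
  · rw [X_last, X_far y (by omega)]; omega
  · rw [X_far y h, X_far y (by omega)]; omega

/-- Only these two columns carry edges between rows; equal abscissas make those edges vertical. -/
theorem X_congr {c : ℤ} (hc : c = 0 ∨ c = 2 * G.d + 1) (y y' : ℕ) : G.X y c = G.X y' c := by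
  rcases hc with rfl | rfl
  · rw [X_zero, X_zero]
  · rw [X_last, X_last]

/-! #### Vertices -/

theorem idx_lt_core {y c : ℕ} (hy : y < G.n + 2) (hc : c < G.width) :
    y * G.width + c < G.core := by
  unfold core
  calc y * G.width + c < (y + 1) * G.width := by rw [add_mul]; omega
    _ ≤ _ := Nat.mul_le_mul_right _ hy

theorem row_idx {y c : ℕ} (hy : y < G.n + 2) (hc : c < G.width) : G.row (y * G.width + c) = y := by
  unfold row
  rw [if_pos (idx_lt_core hy hc), mul_comm, Nat.mul_add_div (width_pos G), Nat.div_eq_of_lt hc,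
    add_zero]

theorem col_idx {y c : ℕ} (hy : y < G.n + 2) (hc : c < G.width) : G.col (y * G.width + c) = c := by
  unfold col
  rw [if_pos (idx_lt_core hy hc), mul_comm, Nat.mul_add_mod, Nat.mod_eq_of_lt hc]

theorem row_core : G.row G.core = G.n + 1 := by simp [row]

theorem col_core : G.col G.core = 2 * G.d + 2 := by simp [col]

theorem row_pad (i : ℕ) : G.row (G.core + 1 + i) = 0 := by
  unfold row; rw [if_neg (by omega), if_neg (by omega)]

theorem col_pad (i : ℕ) : G.col (G.core + 1 + i) = -(i + 1) := by
  unfold col; rw [if_neg (by omega), if_neg (by omega)]; push_cast; ring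

theorem vertex_cases {v : ℕ} (hv : v < G.numVerts) :
    (∃ y c, y < G.n + 2 ∧ c < G.width ∧ v = y * G.width + c) ∨ v = G.core ∨
      ∃ i < G.pads, v = G.core + 1 + i := by
  rcases lt_trichotomy v G.core with h | h | h
  · refine .inl ⟨v / G.width, v % G.width, ?_, Nat.mod_lt _ (width_pos G), ?_⟩
    · rwa [Nat.div_lt_iff_lt_mul (width_pos G)]
    · rw [mul_comm, Nat.div_add_mod]
  · exact .inr (.inl h)
  · unfold numVerts at hv
    exact .inr (.inr ⟨v - (G.core + 1), by omega, by omega⟩)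

theorem eq_of_row_col {v w : ℕ} (hv : v < G.numVerts) (hw : w < G.numVerts)
    (hr : G.row v = G.row w) (hc : G.col v = G.col w) : v = w := by
  rcases vertex_cases hv with ⟨y, c, hy, hc', rfl⟩ | rfl | ⟨i, -, rfl⟩ <;>
    rcases vertex_cases hw with ⟨y', c', hy', hc'', rfl⟩ | rfl | ⟨i', -, rfl⟩ <;>
    simp only [row_idx, col_idx, row_core, col_core, row_pad, col_pad, *] at hr hc
  all_goals have hw' : G.width = 2 * G.d + 2 := rfl
  · obtain rfl : c = c' := by exact_mod_cast hc
    rw [hr]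
  all_goals omega

theorem row_le {v : ℕ} (hv : v < G.numVerts) : G.row v ≤ G.n + 1 := by
  rcases vertex_cases hv with ⟨y, c, hy, hc', rfl⟩ | rfl | ⟨i, -, rfl⟩
  · rw [row_idx hy hc']; omega
  · rw [row_core]
  · rw [row_pad]; omega

/-! #### Edges -/

/-- The edge from `v` to `w` is horizontal and leads to the right. -/
def Horizontal (G : Gadget) (v w : ℕ) : Prop := G.row v = G.row w ∧ G.col w = G.col v + 1

/-- The edge from `v` to `w` is vertical. -/
def Vertical (G : Gadget) (v w : ℕ) : Prop :=
  G.col v = G.col w ∧ G.row w = G.row v + 1 ∧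
    (G.col v = 0 ∧ G.row w ≤ G.n ∨ G.col v = 2 * G.d + 1 ∧ 1 ≤ G.row v)

theorem mem_edges {e : ℕ × ℕ} : e ∈ G.edges ↔
    (∃ y c, y < G.n + 2 ∧ c < 2 * G.d + 1 ∧ e = (y * G.width + c, y * G.width + (c + 1))) ∨
    (∃ y < G.n, e = (y * G.width + 0, (y + 1) * G.width + 0)) ∨
    (∃ y < G.n, e = ((y + 1) * G.width + (2 * G.d + 1), (y + 2) * G.width + (2 * G.d + 1))) ∨
    e = (G.core - 1, G.core) ∨ e = (0, G.core + 1) ∨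
    ∃ i, i + 1 < G.pads ∧ e = (G.core + 1 + i, G.core + 1 + (i + 1)) := by
  have hrow : (∃ z < (G.n + 2) * (2 * G.d + 1), G.rowEdge z = e) ↔ ∃ y c, y < G.n + 2 ∧
      c < 2 * G.d + 1 ∧ e = (y * G.width + c, y * G.width + (c + 1)) := by
    constructor
    · rintro ⟨z, hz, rfl⟩
      refine ⟨z / (2 * G.d + 1), z % (2 * G.d + 1), ?_, Nat.mod_lt _ (by omega), ?_⟩
      · rwa [Nat.div_lt_iff_lt_mul (by omega)]
      · have h := Nat.div_add_mod z (2 * G.d + 1)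
        have : z / (2 * G.d + 1) * G.width =
            (2 * G.d + 1) * (z / (2 * G.d + 1)) + z / (2 * G.d + 1) := by
          unfold width; ring
        unfold rowEdge
        rw [this]
        simp only [Prod.mk.injEq]
        omega
    · rintro ⟨y, c, hy, hc, rfl⟩
      refine ⟨y * (2 * G.d + 1) + c, ?_, ?_⟩
      · calc _ < (y + 1) * (2 * G.d + 1) := by rw [add_mul]; omega
          _ ≤ _ := Nat.mul_le_mul_right _ hy
      · have h : (y * (2 * G.d + 1) + c) / (2 * G.d + 1) = y := by
          rw [mul_comm, Nat.mul_add_div (by omega), Nat.div_eq_of_lt hc, add_zero]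
        have : y * G.width = y * (2 * G.d + 1) + y := by unfold width; ring
        unfold rowEdge
        rw [h, this]
        simp only [Prod.mk.injEq]
        omega
  simp only [edges, List.mem_append, List.mem_map, List.mem_range, hrow, leftEdge, rightEdge,
    padEdge, List.mem_cons, List.not_mem_nil, or_false, add_zero, or_assoc]
  refine or_congr Iff.rfl (or_congr ?_ (or_congr ?_ (or_congr Iff.rfl (or_congr Iff.rfl ?_))))
  · simp only [eq_comm]
  · simp only [eq_comm, add_assoc]
  · constructor
    · rintro ⟨i, hi, rfl⟩; exact ⟨i, by omega, by simp; omega⟩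
    · rintro ⟨i, hi, rfl⟩; exact ⟨i, by omega, by simp; omega⟩

theorem core_sub_one (G : Gadget) : G.core - 1 = (G.n + 1) * G.width + (2 * G.d + 1) := by
  have : G.core = (G.n + 1) * G.width + G.width := by unfold core; ring
  rw [this]; unfold width; omega

theorem core_pos (G : Gadget) : 0 < G.core := by unfold core width; positivity

theorem edges_lt (hG : G.Good) {e : ℕ × ℕ} (he : e ∈ G.edges) : e.1 < e.2 ∧ e.2 < G.numVerts := by
  have hw : G.width = 2 * G.d + 2 := rfl
  have hp := hG.pads_pos
  have hc0 := core_pos G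
  unfold numVerts
  rcases mem_edges.1 he with ⟨y, c, hy, hc, rfl⟩ | ⟨y, hy, rfl⟩ | ⟨y, hy, rfl⟩ | rfl | rfl |
    ⟨i, hi, rfl⟩
  · have := idx_lt_core (G := G) hy (c := c + 1) (by omega)
    exact ⟨by simp, by simp only; omega⟩
  · have := idx_lt_core (G := G) (y := y + 1) (c := 0) (by omega) (by omega)
    exact ⟨by simp only [add_mul]; omega, by simp only; omega⟩
  · have := idx_lt_core (G := G) (y := y + 2) (c := 2 * G.d + 1) (by omega) (by omega)
    exact ⟨by simp only [add_mul]; omega, by simp only; omega⟩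
  · exact ⟨by simp only; omega, by simp only; omega⟩
  · exact ⟨by simp only; omega, by simp only; omega⟩
  · exact ⟨by simp only; omega, by simp only; omega⟩

theorem edge_kind (hG : G.Good) {e : ℕ × ℕ} (he : e ∈ G.edges) :
    G.Horizontal e.1 e.2 ∨ G.Horizontal e.2 e.1 ∨ G.Vertical e.1 e.2 := by
  have hw : G.width = 2 * G.d + 2 := rfl
  have hn := hG.n_pos
  rcases mem_edges.1 he with ⟨y, c, hy, hc, rfl⟩ | ⟨y, hy, rfl⟩ | ⟨y, hy, rfl⟩ | rfl | rfl |
    ⟨i, hi, rfl⟩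
  · left
    simp only [Horizontal]
    rw [row_idx hy (by omega), row_idx hy (by omega), col_idx hy (by omega), col_idx hy (by omega)]
    simp
  · right; right
    simp only [Vertical]
    rw [row_idx (by omega) (by omega), row_idx (by omega) (by omega),
      col_idx (by omega) (by omega), col_idx (by omega) (by omega)]
    exact ⟨rfl, rfl, .inl ⟨rfl, by omega⟩⟩
  · right; right
    simp only [Vertical]
    rw [row_idx (by omega) (by omega), row_idx (by omega) (by omega),
      col_idx (by omega) (by omega), col_idx (by omega) (by omega)]
    exact ⟨rfl, rfl, .inr ⟨by push_cast; rfl, by omega⟩⟩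
  · left
    simp only [Horizontal]
    rw [core_sub_one, row_idx (by omega) (by omega), col_idx (by omega) (by omega), row_core,
      col_core]
    exact ⟨rfl, by push_cast; ring⟩
  · right; left
    simp only [Horizontal]
    have h1 := row_idx (G := G) (y := 0) (c := 0) (by omega) (by omega)
    have h2 := col_idx (G := G) (y := 0) (c := 0) (by omega) (by omega)
    simp only [zero_mul, add_zero] at h1 h2
    have h3 := row_pad (G := G) 0
    have h4 := col_pad (G := G) 0
    rw [add_zero] at h3 h4
    rw [h1, h2, h3, h4]
    simp
  · right; left
    simp only [Horizontal]
    rw [row_pad, row_pad, col_pad, col_pad]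
    exact ⟨rfl, by push_cast; ring⟩

/-- Row edges join consecutive numbers, column edges numbers `width` apart with residue `0` on the
left and `width - 1` on the right, and the remaining edges end at `core` or beyond. -/
theorem edges_nodup (G : Gadget) : G.edges.Nodup := by
  have hw : G.width = 2 * G.d + 2 := rfl
  have hmod : ∀ y c, c < G.width → (y * G.width + c) % G.width = c := fun y c hc => by
    rw [mul_comm, Nat.mul_add_mod, Nat.mod_eq_of_lt hc]
  have hinj : ∀ y y', y * G.width = y' * G.width → y = y' := fun y y' h =>
    Nat.eq_of_mul_eq_mul_right (width_pos G) h
  have hc0 := core_pos G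
  have hrowlt : ∀ z < (G.n + 2) * (2 * G.d + 1), (G.rowEdge z).2 < G.core := by
    intro z hz
    have h1 : z / (2 * G.d + 1) < G.n + 2 := by rwa [Nat.div_lt_iff_lt_mul (by omega)]
    have h2 : z % (2 * G.d + 1) < 2 * G.d + 1 := Nat.mod_lt _ (by omega)
    have h3 := Nat.div_add_mod z (2 * G.d + 1)
    have h4 := idx_lt_core (G := G) h1 (c := z % (2 * G.d + 1) + 1) (by omega)
    have : z / (2 * G.d + 1) * G.width =
        (2 * G.d + 1) * (z / (2 * G.d + 1)) + z / (2 * G.d + 1) := by unfold width; ring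
    unfold rowEdge
    simp only
    omega
  have hlt : ∀ y < G.n + 2, y * G.width < G.core := fun y hy => by
    simpa using idx_lt_core hy (width_pos G)
  unfold edges
  rw [List.nodup_append, List.nodup_append, List.nodup_append, List.nodup_append]
  refine ⟨⟨⟨⟨?_, ?_, ?_⟩, ?_, ?_⟩, ?_, ?_⟩, ?_, ?_⟩
  · refine List.Nodup.map_on ?_ List.nodup_range
    intro z _ z' _ h
    simp only [rowEdge, Prod.mk.injEq] at h
    rcases le_total z z' with h' | h'
    · have := Nat.div_le_div_right (c := 2 * G.d + 1) h'; omega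
    · have := Nat.div_le_div_right (c := 2 * G.d + 1) h'; omega
  · refine List.Nodup.map_on ?_ List.nodup_range
    intro y _ y' _ h
    simp only [leftEdge, Prod.mk.injEq] at h
    exact hinj _ _ h.1
  · simp only [List.mem_map, List.mem_range, forall_exists_index, and_imp]
    rintro _ z hz rfl _ y hy rfl h
    simp only [rowEdge, leftEdge, add_mul, Prod.mk.injEq] at h
    omega
  · refine List.Nodup.map_on ?_ List.nodup_range
    intro y _ y' _ h
    simp only [rightEdge, Prod.mk.injEq] at h
    have := hinj (y + 1) (y' + 1) (by omega)
    omega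
  · simp only [List.mem_append, List.mem_map, List.mem_range]
    rintro _ (⟨z, hz, rfl⟩ | ⟨y, hy, rfl⟩) _ ⟨y', hy', rfl⟩ h
    · simp only [rowEdge, rightEdge, add_mul, Prod.mk.injEq] at h
      omega
    · simp only [leftEdge, rightEdge, Prod.mk.injEq] at h
      have h1 := hmod y 0 (by omega)
      have h2 := hmod (y' + 1) (2 * G.d + 1) (by omega)
      rw [add_zero, h.1, add_assoc, h2] at h1
      omega
  · have := width_pos G
    simp only [List.nodup_cons, List.mem_cons, List.not_mem_nil, or_false, Prod.mk.injEq]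
    simp
  · simp only [List.mem_append, List.mem_map, List.mem_range, List.mem_cons, List.not_mem_nil,
      or_false]
    rintro _ ((⟨z, hz, rfl⟩ | ⟨y, hy, rfl⟩) | ⟨y, hy, rfl⟩) _ (rfl | rfl) h
    · have := hrowlt z hz; rw [h] at this; simp at this
    · have := hrowlt z hz; rw [h] at this; simp at this
    · have := hlt (y + 1) (by omega)
      simp only [leftEdge, Prod.mk.injEq] at h; omega
    · have := hlt (y + 1) (by omega)
      simp only [leftEdge, Prod.mk.injEq] at h; omega
    · have := idx_lt_core (G := G) (y := y + 2) (c := 2 * G.d + 1) (by omega) (by omega)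
      simp only [rightEdge, Prod.mk.injEq] at h; omega
    · have := idx_lt_core (G := G) (y := y + 2) (c := 2 * G.d + 1) (by omega) (by omega)
      simp only [rightEdge, Prod.mk.injEq] at h; omega
  · refine List.Nodup.map_on ?_ List.nodup_range
    intro i _ i' _ h
    simp only [padEdge, Prod.mk.injEq] at h
    omega
  · simp only [List.mem_append, List.mem_map, List.mem_range, List.mem_cons, List.not_mem_nil,
      or_false]
    rintro _ (((⟨z, hz, rfl⟩ | ⟨y, hy, rfl⟩) | ⟨y, hy, rfl⟩) | (rfl | rfl)) _ ⟨i, hi, rfl⟩ h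
    · have := hrowlt z hz; rw [h] at this; simp only [padEdge] at this; omega
    · have := hlt y (by omega)
      simp only [leftEdge, padEdge, Prod.mk.injEq] at h; omega
    · have := idx_lt_core (G := G) (y := y + 2) (c := 2 * G.d + 1) (by omega) (by omega)
      simp only [rightEdge, padEdge, Prod.mk.injEq] at h; omega
    · simp only [padEdge, Prod.mk.injEq] at h; omega
    · simp only [padEdge, Prod.mk.injEq] at h; omega

end Gadget

/-! ### Validity of the instance: planarity and connectedness -/

namespace Gadget

variable {G : Gadget}

theorem length_verts (G : Gadget) : G.toInstance.verts.length = G.numVerts := by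
  simp [toInstance]

theorem length_edges (G : Gadget) : G.toInstance.edges.length = G.numEdges := by
  simp [toInstance, edges, numEdges]; omega

theorem q_toInstance (G : Gadget) : G.toInstance.q = G.m * G.blk := by
  simp [toInstance, MapInstance.q]

theorem p_toInstance (G : Gadget) : G.toInstance.p = G.numVerts + G.numEdges := by
  rw [MapInstance.p, length_verts, length_edges]

theorem verts_getD {v : ℕ} (hv : v < G.numVerts) : G.toInstance.verts.getD v (0, 0) = G.pos v := by
  rw [List.getD_eq_getElem _ _ (by rwa [length_verts])]
  simp [toInstance]

theorem toPlane_zero (v : ℤ × ℤ) : toPlane v 0 = v.1 := by simp [toPlane]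

theorem toPlane_one (v : ℤ × ℤ) : toPlane v 1 = v.2 := by simp [toPlane]

theorem pt_eq {v : ℕ} (hv : v < G.numVerts) : G.toInstance.pt v = toPlane (G.pos v) := by
  rw [MapInstance.pt, verts_getD hv]

theorem pt_zero {v : ℕ} (hv : v < G.numVerts) :
    G.toInstance.pt v 0 = (G.X (G.row v) (G.col v) : ℝ) := by rw [pt_eq hv, toPlane_zero]; rfl

theorem pt_one {v : ℕ} (hv : v < G.numVerts) : G.toInstance.pt v 1 = (G.row v : ℝ) := by
  rw [pt_eq hv, toPlane_one]; simp [pos]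

theorem eq_pt {v : ℕ} (hv : v < G.numVerts) {z : Plane} (h0 : z 0 = (G.X (G.row v) (G.col v) : ℝ))
    (h1 : z 1 = (G.row v : ℝ)) : z = G.toInstance.pt v := by
  ext i
  fin_cases i
  · simpa [pt_zero hv] using h0
  · simpa [pt_one hv] using h1

theorem segment_coord {x y z : Plane} (h : z ∈ segment ℝ x y) (i : Fin 2) :
    z i ∈ segment ℝ (x i) (y i) := by
  obtain ⟨a, b, ha, hb, hab, rfl⟩ := h
  exact ⟨a, b, ha, hb, hab, by simp⟩

theorem mem_horizontal (hG : G.Good) {v w : ℕ} (hv : v < G.numVerts) (hw : w < G.numVerts)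
    (h : G.Horizontal v w) {z : Plane} (hz : z ∈ segment ℝ (G.toInstance.pt v) (G.toInstance.pt w)) :
    z 1 = (G.row v : ℝ) ∧ (G.X (G.row v) (G.col v) : ℝ) ≤ z 0 ∧
      z 0 ≤ (G.X (G.row v) (G.col v + 1) : ℝ) := by
  have h0 := segment_coord hz 0
  have h1 := segment_coord hz 1
  rw [pt_zero hv, pt_zero hw, ← h.1, h.2, segment_eq_Icc] at h0
  · rw [pt_one hv, pt_one hw, ← h.1, segment_same] at h1
    exact ⟨h1, h0⟩
  · exact_mod_cast (strictMono_X hG _ (lt_add_one _)).le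

theorem mem_vertical {v w : ℕ} (hv : v < G.numVerts) (hw : w < G.numVerts)
    (h : G.Vertical v w) {z : Plane} (hz : z ∈ segment ℝ (G.toInstance.pt v) (G.toInstance.pt w)) :
    (∀ y, z 0 = (G.X y (G.col v) : ℝ)) ∧ (G.row v : ℝ) ≤ z 1 ∧ z 1 ≤ (G.row v + 1 : ℝ) := by
  have hc : G.col v = 0 ∨ G.col v = 2 * G.d + 1 := h.2.2.imp And.left And.left
  have h0 := segment_coord hz 0
  have h1 := segment_coord hz 1
  rw [pt_zero hv, pt_zero hw, ← h.1, X_congr hc (G.row w) (G.row v), segment_same] at h0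
  rw [pt_one hv, pt_one hw, h.2.1, segment_eq_Icc (by simp)] at h1
  refine ⟨fun y => ?_, h1.1, by simpa using h1.2⟩
  rw [X_congr hc y (G.row v)]; exact h0

theorem X_lt_iff (hG : G.Good) {y : ℕ} {c c' : ℤ} :
    (G.X y c : ℝ) < G.X y c' ↔ c < c' := by
  rw [Int.cast_lt]; exact (strictMono_X hG y).lt_iff_lt

theorem X_le_iff (hG : G.Good) {y : ℕ} {c c' : ℤ} :
    (G.X y c : ℝ) ≤ G.X y c' ↔ c ≤ c' := by
  rw [Int.cast_le]; exact (strictMono_X hG y).le_iff_le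

/-- A point on an edge with the coordinates of a vertex is an endpoint. -/
theorem eq_end_of_horizontal (hG : G.Good) {v w : ℕ} (hv : v < G.numVerts) (hw : w < G.numVerts)
    (h : G.Horizontal v w) {z : Plane} (hz : z ∈ segment ℝ (G.toInstance.pt v) (G.toInstance.pt w))
    {c : ℤ} (hc : z 0 = (G.X (G.row v) c : ℝ)) :
    c = G.col v ∧ z = G.toInstance.pt v ∨ c = G.col w ∧ z = G.toInstance.pt w := by
  obtain ⟨h1, h2, h3⟩ := mem_horizontal hG hv hw h hz
  rw [hc, X_le_iff hG] at h2 h3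
  rcases h3.lt_or_eq with h4 | h4
  · have : c = G.col v := by omega
    exact .inl ⟨this, eq_pt hv (this ▸ hc) h1⟩
  · have : c = G.col w := by rw [h.2, h4]
    exact .inr ⟨this, eq_pt hw (by rw [← h.1, ← this, hc]) (by rw [← h.1, h1])⟩

theorem eq_end_of_vertical {v w : ℕ} (hv : v < G.numVerts) (hw : w < G.numVerts)
    (h : G.Vertical v w) {z : Plane} (hz : z ∈ segment ℝ (G.toInstance.pt v) (G.toInstance.pt w))
    {y : ℕ} (hy : z 1 = (y : ℝ)) :
    y = G.row v ∧ z = G.toInstance.pt v ∨ y = G.row w ∧ z = G.toInstance.pt w := by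
  obtain ⟨h1, h2, h3⟩ := mem_vertical hv hw h hz
  rw [hy] at h2 h3
  have h2' : G.row v ≤ y := Nat.cast_le.1 (show (G.row v : ℝ) ≤ y from h2)
  have h3' : y ≤ G.row v + 1 := by
    exact_mod_cast (show (y : ℝ) ≤ G.row v + 1 from h3)
  rcases h3'.lt_or_eq with h4 | h4
  · have : y = G.row v := by omega
    exact .inl ⟨this, eq_pt hv (h1 _) (this ▸ hy)⟩
  · have : y = G.row w := by rw [h.2.1, h4]
    exact .inr ⟨this, eq_pt hw (by rw [h1 (G.row w), h.1]) (this ▸ hy)⟩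

theorem vertex_on_edge (hG : G.Good) {v w i : ℕ} (hv : v < G.numVerts) (hw : w < G.numVerts)
    (hi : i < G.numVerts) (h : G.Horizontal v w ∨ G.Vertical v w)
    (hz : G.toInstance.pt i ∈ segment ℝ (G.toInstance.pt v) (G.toInstance.pt w)) :
    i = v ∨ i = w := by
  rcases h with h | h
  · have hr : G.row i = G.row v := by
      have := (mem_horizontal hG hv hw h hz).1
      rw [pt_one hi] at this; exact Nat.cast_injective (R := ℝ) this
    rcases eq_end_of_horizontal hG hv hw h hz (c := G.col i) (by rw [pt_zero hi, hr]) with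
      ⟨h1, -⟩ | ⟨h1, -⟩
    · exact .inl (eq_of_row_col hi hv hr h1)
    · exact .inr (eq_of_row_col hi hw (hr.trans h.1) h1)
  · have hc : G.col i = G.col v := by
      have := (mem_vertical hv hw h hz).1 (G.row i)
      rw [pt_zero hi, Int.cast_inj] at this
      exact (strictMono_X hG _).injective this
    rcases eq_end_of_vertical hv hw h hz (y := G.row i) (pt_one hi) with ⟨h1, -⟩ | ⟨h1, -⟩
    · exact .inl (eq_of_row_col hi hv h1 hc)
    · exact .inr (eq_of_row_col hi hw h1 (hc.trans h.1))

/-- In each of the four combinations a common point has, along the first edge, the coordinate of a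
column or of a row: two edges in one line cover intervals that overlap at most in an end, and a
horizontal and a vertical edge meet at a column abscissa and a row height. Such a point of an edge
is one of its ends. -/
theorem edges_meet (hG : G.Good) {v w v' w' : ℕ} (hv : v < G.numVerts) (hw : w < G.numVerts)
    (hv' : v' < G.numVerts) (hw' : w' < G.numVerts) (h : G.Horizontal v w ∨ G.Vertical v w)
    (h' : G.Horizontal v' w' ∨ G.Vertical v' w') (hne : ¬ (v = v' ∧ w = w')) {z : Plane}
    (hz : z ∈ segment ℝ (G.toInstance.pt v) (G.toInstance.pt w))
    (hz' : z ∈ segment ℝ (G.toInstance.pt v') (G.toInstance.pt w')) :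
    z = G.toInstance.pt v ∨ z = G.toInstance.pt w := by
  rcases h with h | h <;> rcases h' with h' | h'
  · have a := mem_horizontal hG hv hw h hz
    have b := mem_horizontal hG hv' hw' h' hz'
    have hr : G.row v = G.row v' := by
      exact Nat.cast_injective (R := ℝ) (a.1.symm.trans b.1)
    have hc : G.col v ≠ G.col v' := by
      intro hc
      exact hne ⟨eq_of_row_col hv hv' hr hc, eq_of_row_col hw hw' (by rw [← h.1, ← h'.1, hr])
        (by rw [h.2, h'.2, hc])⟩
    rw [← hr] at b
    rcases lt_or_gt_of_ne hc with hlt | hlt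
    · have h1 : (G.X (G.row v) (G.col v + 1) : ℝ) ≤ G.X (G.row v) (G.col v') :=
        (X_le_iff hG).2 hlt
      exact (eq_end_of_horizontal hG hv hw h hz
        (le_antisymm (a.2.2) (h1.trans b.2.1))).imp And.right And.right
    · have h1 : (G.X (G.row v) (G.col v' + 1) : ℝ) ≤ G.X (G.row v) (G.col v) :=
        (X_le_iff hG).2 hlt
      exact (eq_end_of_horizontal hG hv hw h hz
        (le_antisymm (b.2.2.trans h1) a.2.1)).imp And.right And.right
  · have b := mem_vertical hv' hw' h' hz'
    exact (eq_end_of_horizontal hG hv hw h hz (b.1 _)).imp And.right And.right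
  · have b := mem_horizontal hG hv' hw' h' hz'
    exact (eq_end_of_vertical hv hw h hz b.1).imp And.right And.right
  · have a := mem_vertical hv hw h hz
    have b := mem_vertical hv' hw' h' hz'
    have hc : G.col v = G.col v' := by
      have := (a.1 0).symm.trans (b.1 0)
      rw [Int.cast_inj] at this
      exact (strictMono_X hG _).injective this
    have hr : G.row v ≠ G.row v' := by
      intro hr
      exact hne ⟨eq_of_row_col hv hv' hr hc, eq_of_row_col hw hw' (by rw [h.2.1, h'.2.1, hr])
        (by rw [← h.1, ← h'.1, hc])⟩
    rcases lt_or_gt_of_ne hr with hlt | hlt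
    · have h1 : (G.row v : ℝ) + 1 ≤ G.row v' := by exact_mod_cast hlt
      exact (eq_end_of_vertical hv hw h hz (y := G.row v + 1)
        (by push_cast; linarith)).imp And.right And.right
    · have h1 : (G.row v' : ℝ) + 1 ≤ G.row v := by exact_mod_cast hlt
      exact (eq_end_of_vertical hv hw h hz (y := G.row v)
        (by linarith)).imp And.right And.right

/-- Every edge is, in one of its two directions, horizontal to the right or vertical upwards. -/
theorem exists_direction (hG : G.Good) {e : ℕ × ℕ} (he : e ∈ G.edges) : ∃ v w, v < G.numVerts ∧
    w < G.numVerts ∧ (G.Horizontal v w ∨ G.Vertical v w) ∧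
    (v = e.1 ∧ w = e.2 ∨ v = e.2 ∧ w = e.1) ∧
    G.toInstance.edgeSegment e = segment ℝ (G.toInstance.pt v) (G.toInstance.pt w) := by
  obtain ⟨h1, h2⟩ := edges_lt hG he
  rcases edge_kind hG he with h | h | h
  · exact ⟨e.1, e.2, h1.trans h2, h2, .inl h, .inl ⟨rfl, rfl⟩, rfl⟩
  · exact ⟨e.2, e.1, h2, h1.trans h2, .inl h, .inr ⟨rfl, rfl⟩, segment_symm _ _ _⟩
  · exact ⟨e.1, e.2, h1.trans h2, h2, .inr h, .inl ⟨rfl, rfl⟩, rfl⟩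

theorem adj_of_mem {v w : Fin G.toInstance.verts.length} (h : ((v : ℕ), (w : ℕ)) ∈ G.edges)
    (hG : G.Good) : G.toInstance.graph.Adj v w := by
  rw [MapInstance.graph, SimpleGraph.fromRel_adj]
  refine ⟨fun hvw => ?_, .inl h⟩
  have := (edges_lt hG h).1
  simp [hvw] at this

/-- The rows up to `n` hang on the left column. The last row does not, and is entered from row `n`
over the right column. -/
theorem reachable_zero (hG : G.Good) {v : ℕ} (hv : v < G.numVerts) :
    G.toInstance.graph.Reachable ⟨v, by rwa [length_verts]⟩
      ⟨0, by rw [length_verts]; exact (Nat.zero_le _).trans_lt hv⟩ := by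
  have hw : G.width = 2 * G.d + 2 := rfl
  have hn := hG.n_pos
  have hp := hG.pads_pos
  have hnv : G.numVerts = G.core + 1 + G.pads := rfl
  have h0 : 0 < G.numVerts := (Nat.zero_le _).trans_lt hv
  let R : ℕ → Prop := fun v => ∀ hv : v < G.numVerts, G.toInstance.graph.Reachable
    ⟨v, by rwa [length_verts]⟩ ⟨0, by rwa [length_verts]⟩
  have step : ∀ {v w : ℕ}, (v, w) ∈ G.edges → R v → R w := fun {v w} he h hw =>
    have hv : v < G.numVerts := (edges_lt hG he).1.trans hw
    (adj_of_mem (v := ⟨v, by rwa [length_verts]⟩)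
      (w := ⟨w, by rwa [length_verts]⟩) he hG).symm.reachable.trans (h hv)
  have step' : ∀ {v w : ℕ}, (v, w) ∈ G.edges → R w → R v := fun {v w} he h hv =>
    have hw : w < G.numVerts := (edges_lt hG he).2
    (adj_of_mem (v := ⟨v, by rwa [length_verts]⟩)
      (w := ⟨w, by rwa [length_verts]⟩) he hG).reachable.trans (h hw)
  have R0 : R 0 := fun _ => SimpleGraph.Reachable.refl _
  have hleft : ∀ y ≤ G.n, R (y * G.width + 0) := by
    intro y
    induction y with
    | zero => intro _; simpa using R0
    | succ y ih =>
      exact fun hy => step (mem_edges.2 (.inr (.inl ⟨y, by omega, rfl⟩))) (ih (by omega))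
  have rows : ∀ y ≤ G.n, ∀ c < G.width, R (y * G.width + c) := by
    intro y hy c
    induction c with
    | zero => exact fun _ => hleft y hy
    | succ c ih =>
      exact fun hc => step (mem_edges.2 (.inl ⟨y, c, by omega, by omega, rfl⟩)) (ih (by omega))
  -- The last row is traversed from its right end to the left.
  have last : ∀ c < G.width, R ((G.n + 1) * G.width + (2 * G.d + 1 - c)) := by
    intro c
    induction c with
    | zero =>
      intro _
      have := step (mem_edges.2 (.inr (.inr (.inl ⟨G.n - 1, by omega, rfl⟩))))
        (by rw [Nat.sub_add_cancel hn]; exact rows G.n le_rfl _ (by omega))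
      rwa [show G.n - 1 + 2 = G.n + 1 by omega] at this
    | succ c ih =>
      intro hc
      refine step' (mem_edges.2 (.inl ⟨G.n + 1, 2 * G.d + 1 - (c + 1), by omega, by omega, rfl⟩)) ?_
      rw [show 2 * G.d + 1 - (c + 1) + 1 = 2 * G.d + 1 - c by omega]
      exact ih (by omega)
  have pads : ∀ i < G.pads, R (G.core + 1 + i) := by
    intro i
    induction i with
    | zero => exact fun _ => step (mem_edges.2 (.inr (.inr (.inr (.inr (.inl rfl)))))) R0
    | succ i ih =>
      exact fun hi => step (mem_edges.2 (.inr (.inr (.inr (.inr (.inr ⟨i, hi, rfl⟩)))))) (ih (by omega))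
  suffices R v from this hv
  rcases vertex_cases hv with ⟨y, c, hy, hc, rfl⟩ | rfl | ⟨i, hi, rfl⟩
  · rcases (show y ≤ G.n + 1 by omega).lt_or_eq with h | rfl
    · exact rows y (by omega) c hc
    · have := last (2 * G.d + 1 - c) (by omega)
      rwa [show 2 * G.d + 1 - (2 * G.d + 1 - c) = c by omega] at this
  · refine step (mem_edges.2 (.inr (.inr (.inr (.inl rfl))))) ?_
    rw [core_sub_one]
    exact last 0 (by omega)
  · exact pads i hi

theorem pos_injOn (hG : G.Good) {v w : ℕ} (hv : v < G.numVerts) (hw : w < G.numVerts)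
    (h : G.pos v = G.pos w) : v = w := by
  simp only [pos, Prod.mk.injEq, Nat.cast_inj] at h
  refine eq_of_row_col hv hw h.2 ((strictMono_X hG (G.row w)).injective ?_)
  rw [← h.2, h.1, h.2]

theorem valid (hG : G.Good) : G.toInstance.Valid where
  verts_nodup := List.Nodup.map_on (fun v hv w hw h =>
    pos_injOn hG (List.mem_range.1 hv) (List.mem_range.1 hw) h) List.nodup_range
  edges_nodup := G.edges_nodup
  edges_lt e he := by rw [length_verts]; exact edges_lt hG he
  noncrossing := by
    have key : ∀ e ∈ G.edges, ∀ f ∈ G.edges, e ≠ f →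
        ∀ z ∈ G.toInstance.edgeSegment e ∩ G.toInstance.edgeSegment f,
        z ∈ ({G.toInstance.pt e.1, G.toInstance.pt e.2} : Set Plane) := by
      rintro e he f hf hne z ⟨hz, hz'⟩
      have he' := (edges_lt hG he).1
      have hf' := (edges_lt hG hf).1
      obtain ⟨v, w, hv, hw, h, hvw, hs⟩ := exists_direction hG he
      obtain ⟨v', w', hv', hw', h', hvw', hs'⟩ := exists_direction hG hf
      rw [hs] at hz
      rw [hs'] at hz'
      have := edges_meet hG hv hw hv' hw' h h' (fun hh => hne (by
        apply Prod.ext <;> omega)) hz hz'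
      simp only [Set.mem_insert_iff, Set.mem_singleton_iff]
      rcases hvw with ⟨rfl, rfl⟩ | ⟨rfl, rfl⟩
      · exact this
      · exact this.symm
    exact fun e he f hf hne z hz =>
      ⟨key e he f hf hne z hz, key f hf e he hne.symm z hz.symm⟩
  vertex_free i hi e he hz := by
    rw [length_verts] at hi
    obtain ⟨v, w, hv, hw, h, hvw, hs⟩ := exists_direction hG he
    rw [hs] at hz
    have := vertex_on_edge hG hv hw hi h hz
    omega
  connected := by
    have : 0 < G.numVerts := by unfold numVerts; omega
    have : Nonempty (Fin G.toInstance.verts.length) := ⟨⟨0, by rwa [length_verts]⟩⟩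
    refine ⟨fun v w => ?_⟩
    exact (reachable_zero hG (by simpa [length_verts] using v.2)).trans
      (reachable_zero hG (by simpa [length_verts] using w.2)).symm
  traj_ne_nil := by
    have h1 := hG.m_pos
    have h2 := hG.blk_ge
    have : 0 < G.m * G.blk := Nat.mul_pos h1 (by omega)
    simp [toInstance]; omega

end Gadget

/-! ### End values and intermediate values of reparametrizations -/

theorem IsReparam.map_zero {n : ℕ} {α : ℝ → ℝ} (h : IsReparam n α) (hn : 1 ≤ n) : α 0 = 0 := by
  have hn' : (1 : ℝ) ≤ n := by exact_mod_cast hn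
  have h0 : (0 : ℝ) ∈ α '' Set.Icc 0 1 := by rw [h.2.2]; exact ⟨le_rfl, by linarith⟩
  obtain ⟨μ, hμ, e⟩ := h0
  have h1 : α 0 ∈ α '' Set.Icc 0 1 := ⟨0, by simp, rfl⟩
  rw [h.2.2] at h1
  have h2 := h.2.1 (by simp) hμ hμ.1
  rw [e] at h2
  exact le_antisymm h2 h1.1

theorem IsReparam.map_one {n : ℕ} {α : ℝ → ℝ} (h : IsReparam n α) (hn : 1 ≤ n) :
    α 1 = n - 1 := by
  have hn' : (1 : ℝ) ≤ n := by exact_mod_cast hn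
  have h0 : (n : ℝ) - 1 ∈ α '' Set.Icc 0 1 := by rw [h.2.2]; exact ⟨by linarith, le_rfl⟩
  obtain ⟨μ, hμ, e⟩ := h0
  have h1 : α 1 ∈ α '' Set.Icc 0 1 := ⟨1, by simp, rfl⟩
  rw [h.2.2] at h1
  have h2 := h.2.1 hμ (by simp) hμ.2
  rw [e] at h2
  exact le_antisymm h1.2 h2

theorem IsReparam.exists_between {n : ℕ} {α : ℝ → ℝ} (h : IsReparam n α) {s t c : ℝ}
    (hs : 0 ≤ s) (hst : s ≤ t) (ht : t ≤ 1) (h1 : α s ≤ c) (h2 : c ≤ α t) :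
    ∃ μ, s ≤ μ ∧ μ ≤ t ∧ α μ = c := by
  obtain ⟨μ, hμ, e⟩ := intermediate_value_Icc hst (h.1.mono (Set.Icc_subset_Icc hs ht)) ⟨h1, h2⟩
  exact ⟨μ, hμ.1, hμ.2, e⟩

theorem interp_apply_zero (a : ℕ → Plane) (t : ℝ) :
    (interp a t) 0 = interp (fun i => a i 0) t := by
  simp [interp]

/-! ### Every walk from the left to the right traverses a row -/

namespace Gadget

variable {G : Gadget}

/-- The vertices from which the beginning of the trajectory can be reached without passing a row
of one of the vectors. -/
def IsLeft (G : Gadget) (v : ℕ) : Prop := G.row v = 0 ∨ G.col v = 0 ∧ G.row v ≤ G.n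

def IsRight (G : Gadget) (v : ℕ) : Prop :=
  G.row v = G.n + 1 ∨ G.col v = 2 * G.d + 1 ∧ 1 ≤ G.row v

/-- Two vertices are neighbours. -/
def Near (G : Gadget) (v w : ℕ) : Prop :=
  (G.Horizontal v w ∨ G.Vertical v w) ∨ G.Horizontal w v ∨ G.Vertical w v

theorem Near.symm {v w : ℕ} (h : G.Near v w) : G.Near w v := Or.symm h

theorem row_of_col_neg {v : ℕ} (hv : v < G.numVerts) (h : G.col v < 0) : G.row v = 0 := by
  rcases vertex_cases hv with ⟨y, c, hy, hc', rfl⟩ | rfl | ⟨i, -, rfl⟩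
  · rw [col_idx hy hc'] at h; omega
  · rw [col_core] at h; omega
  · exact row_pad i

theorem row_of_col_far {v : ℕ} (hv : v < G.numVerts) (h : 2 * G.d + 1 < G.col v) :
    G.row v = G.n + 1 := by
  have hw : G.width = 2 * G.d + 2 := rfl
  rcases vertex_cases hv with ⟨y, c, hy, hc', rfl⟩ | rfl | ⟨i, -, rfl⟩
  · rw [col_idx hy hc'] at h; omega
  · exact row_core
  · rw [col_pad] at h; omega

theorem inner_of_not {v : ℕ} (hv : v < G.numVerts) (hl : ¬ G.IsLeft v) (hr : ¬ G.IsRight v) :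
    1 ≤ G.row v ∧ G.row v ≤ G.n ∧ 0 < G.col v ∧ G.col v < 2 * G.d + 1 := by
  have h1 := row_le hv
  have h2 := row_of_col_neg hv
  have h3 := row_of_col_far hv
  unfold IsLeft at hl
  unfold IsRight at hr
  omega

/-- Positive dimension enters here: for `d = 0` the left and the right end of a row are adjacent. -/
theorem not_near_left_right (hd : 1 ≤ G.d) {v w : ℕ} (hv : G.IsLeft v) (hw : G.IsRight w) :
    ¬ G.Near v w := by
  unfold IsLeft at hv
  unfold IsRight at hw
  unfold Near Horizontal Vertical
  omega

theorem near_left_inner {v w : ℕ} (hw : w < G.numVerts) (hv : G.IsLeft v) (hl : ¬ G.IsLeft w)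
    (hr : ¬ G.IsRight w) (h : G.Near v w) : G.col v = 0 ∧ G.row v = G.row w := by
  have := inner_of_not hw hl hr
  unfold IsLeft at hv
  unfold Near Horizontal Vertical at h
  omega

theorem near_right_inner {v w : ℕ} (hw : w < G.numVerts) (hv : G.IsRight v) (hl : ¬ G.IsLeft w)
    (hr : ¬ G.IsRight w) (h : G.Near v w) : G.col v = 2 * G.d + 1 ∧ G.row v = G.row w := by
  have := inner_of_not hw hl hr
  unfold IsRight at hv
  unfold Near Horizontal Vertical at h
  omega

theorem near_inner_inner {v w : ℕ} (hv : v < G.numVerts) (hl : ¬ G.IsLeft v) (hr : ¬ G.IsRight v)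
    (h : G.Near v w) : G.row v = G.row w := by
  have := inner_of_not hv hl hr
  unfold Near Horizontal Vertical at h
  omega

/-- A sequence of neighbouring vertices from the left to the right traverses a row. -/
theorem exists_crossing (hd : 1 ≤ G.d) {w : ℕ → ℕ} {K : ℕ} (hw : ∀ i ≤ K, w i < G.numVerts)
    (hnear : ∀ i < K, G.Near (w i) (w (i + 1))) (h0 : G.IsLeft (w 0)) (h0' : ¬ G.IsRight (w 0))
    (hK : G.IsRight (w K)) : ∃ s t y, s < t ∧ t ≤ K ∧ 1 ≤ y ∧ y ≤ G.n ∧ G.col (w s) = 0 ∧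
      G.col (w t) = 2 * G.d + 1 ∧
      ∀ i, s < i → i < t → G.row (w i) = y ∧ 0 < G.col (w i) ∧ G.col (w i) < 2 * G.d + 1 := by
  classical
  -- Take the first right vertex and the last left vertex before it. All vertices between them are
  -- inner vertices of rows, where every edge is horizontal, so the row does not change.
  have hex : ∃ t, t ≤ K ∧ G.IsRight (w t) := ⟨K, le_rfl, hK⟩
  obtain ⟨htK, htR⟩ := Nat.find_spec hex
  have hmin : ∀ i < Nat.find hex, ¬ G.IsRight (w i) := fun i hi h =>
    Nat.find_min hex hi ⟨by omega, h⟩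
  set t := Nat.find hex with ht
  have ht0 : 0 < t := Nat.pos_of_ne_zero fun h => h0' (h ▸ htR)
  obtain ⟨s, hst, hsL, hmax⟩ : ∃ s < t, G.IsLeft (w s) ∧ ∀ i, s < i → i < t → ¬ G.IsLeft (w i) := by
    have hs := Nat.findGreatest_spec (P := fun i => G.IsLeft (w i)) (n := t - 1) (Nat.zero_le _) h0
    have hs' := Nat.findGreatest_le (P := fun i => G.IsLeft (w i)) (t - 1)
    exact ⟨_, by omega, hs, fun i h1 h2 => 
      Nat.findGreatest_is_greatest (P := fun i => G.IsLeft (w i)) h1 (by omega)⟩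
  have hst' : s + 1 < t := by
    by_contra h
    have h1 : t = s + 1 := by omega
    rw [h1] at htR
    exact not_near_left_right hd hsL htR (hnear s (by omega))
  have inner : ∀ i, s < i → i < t → ¬ G.IsLeft (w i) ∧ ¬ G.IsRight (w i) := fun i h1 h2 =>
    ⟨hmax i h1 h2, hmin i h2⟩
  have hrow : ∀ i, s < i → i < t → G.row (w i) = G.row (w (s + 1)) := by
    intro i h1
    induction i, h1 using Nat.le_induction with
    | base => exact fun _ => rfl
    | succ i hi ih =>
      intro h2
      obtain ⟨hl, hr⟩ := inner i hi (by omega)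
      rw [← ih (by omega)]
      exact (near_inner_inner (hw i (by omega)) hl hr (hnear i (by omega))).symm
  obtain ⟨hl, hr⟩ := inner (s + 1) (by omega) hst'
  obtain ⟨hl', hr'⟩ := inner (t - 1) (by omega) (by omega)
  have hin := inner_of_not (hw (s + 1) (by omega)) hl hr
  have hn := hnear (t - 1) (by omega)
  rw [Nat.sub_add_cancel ht0] at hn
  refine ⟨s, t, G.row (w (s + 1)), hst, htK, hin.1, hin.2.1, ?_, ?_, fun i h1 h2 => ?_⟩
  · exact (near_left_inner (hw _ (by omega)) hsL hl hr (hnear s (by omega))).1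
  · exact (near_right_inner (hw _ (by omega)) htR hl' hr' hn.symm).1
  · obtain ⟨hl, hr⟩ := inner i h1 h2
    exact ⟨hrow i h1 h2, (inner_of_not (hw i (by omega)) hl hr).2.2⟩

/-! #### The trajectory -/

theorem wiggle_first (j : ℕ) {r : ℕ} (hr : r < 2) : G.wiggle j r = 0 := by
  unfold wiggle; rw [if_pos hr]

theorem wiggle_last (j : ℕ) {r : ℕ} (hr : 2 + 4 * G.d ≤ r) : G.wiggle j r = 16 * G.d + 10 := by
  unfold wiggle; rw [if_neg (by omega), if_neg (by omega)]

theorem wiggle_mid (j : ℕ) {k s : ℕ} (hk : k < G.d) (hs : s < 4) :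
    G.wiggle j (2 + 4 * k + s) = 16 * k + 10 + (if s = 0 then -3
       else if s = 1 then (if G.b j k then 3 else 1)
       else if s = 2 then -(if G.b j k then 3 else 1) else 3) := by
  unfold wiggle
  have h1 : (2 + 4 * k + s - 2) / 4 = k := by omega
  have h2 : (2 + 4 * k + s - 2) % 4 = s := by omega
  rw [if_neg (by omega), if_pos (by omega), h1, h2]

theorem index_cases (d : ℕ) (r : ℕ) : r < 2 ∨ (∃ k s, k < d ∧ s < 4 ∧ r = 2 + 4 * k + s) ∨
    2 + 4 * d ≤ r := by
  rcases lt_or_ge r 2 with h | h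
  · exact .inl h
  rcases lt_or_ge r (2 + 4 * d) with h' | h'
  · exact .inr (.inl ⟨(r - 2) / 4, (r - 2) % 4, by omega, by omega, by omega⟩)
  · exact .inr (.inr h')

theorem wiggle_ge (j : ℕ) {r : ℕ} (hr : 2 ≤ r) : 7 ≤ G.wiggle j r := by
  rcases index_cases G.d r with h | ⟨k, s, hk, hs, rfl⟩ | h
  · omega
  · rw [wiggle_mid j hk hs]; split_ifs <;> omega
  · rw [wiggle_last j h]; omega

theorem wiggle_le (j : ℕ) {r : ℕ} (hr : r < 2 + 4 * G.d) : G.wiggle j r ≤ 16 * G.d := by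
  rcases index_cases G.d r with h | ⟨k, s, hk, hs, rfl⟩ | h
  · rw [wiggle_first j h]; omega
  · rw [wiggle_mid j hk hs]; split_ifs <;> omega
  · omega

theorem block_lt {j r : ℕ} (hj : j < G.m) (hr : r + 1 < G.blk) :
    j * G.blk + r ≠ G.m * G.blk - 1 := by
  have : (j + 1) * G.blk ≤ G.m * G.blk := Nat.mul_le_mul_right _ hj
  rw [add_mul, one_mul] at this
  omega

theorem trajX_idx {j r : ℕ} (hr : r < G.blk) (h0 : j * G.blk + r ≠ 0)
    (hq : j * G.blk + r ≠ G.m * G.blk - 1) : G.trajX (j * G.blk + r) = G.wiggle j r := by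
  unfold trajX
  rw [if_neg h0, if_neg hq, mul_comm, Nat.mul_add_div (by omega), Nat.div_eq_of_lt hr,
    add_zero, Nat.mul_add_mod, Nat.mod_eq_of_lt hr]

theorem trajX_zero : G.trajX 0 = -3 := by simp [trajX]

theorem trajX_last (hG : G.Good) : G.trajX (G.m * G.blk - 1) = 16 * G.d + 13 := by
  have h1 : 1 * G.blk ≤ G.m * G.blk := Nat.mul_le_mul_right _ hG.m_pos
  have := hG.blk_ge
  unfold trajX
  rw [if_neg (by omega), if_pos rfl]

/-! #### No fast traversal without an orthogonal pair -/

/-- While the trajectory moves from the left to the right it passes all wiggles of a block. -/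
theorem exists_block (hG : G.Good) {xt : ℕ → ℝ}
    (hxt : ∀ t < G.m * G.blk, xt t = G.trajX t * G.unit) {τs τt : ℝ} (hst : τs ≤ τt)
    (ht0 : 0 ≤ τt) (htq : τt ≤ (G.m * G.blk : ℕ) - 1) (hbs : interp xt τs < 3 * G.unit)
    (hbt : (16 * G.d + 7) * G.unit < interp xt τt) :
    ∃ j < G.m, τs ≤ ((j * G.blk + 2 : ℕ) : ℝ) ∧
      ((j * G.blk + (4 * G.d + 1) : ℕ) : ℝ) ≤ τt := by
  have hU : (1 : ℝ) ≤ G.unit := by exact_mod_cast hG.unit_pos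
  have hblk := hG.blk_ge
  have hd0 : (0 : ℝ) ≤ G.d := G.d.cast_nonneg
  set f := ⌊τt⌋₊ with hf
  have hf1 : (f : ℝ) ≤ τt := Nat.floor_le ht0
  have hf2 : τt < f + 1 := Nat.lt_floor_add_one _
  have hfq : f + 1 ≤ G.m * G.blk := by
    have : (f : ℝ) + 1 ≤ (G.m * G.blk : ℕ) := by linarith
    exact_mod_cast this
  -- The block in which the trajectory is when the walker leaves the row.
  set j := f / G.blk with hj
  have hjm : j < G.m := by rw [hj, Nat.div_lt_iff_lt_mul (by omega)]; omega
  have hdm := Nat.div_add_mod f G.blk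
  rw [← hj, mul_comm] at hdm
  have hmod := Nat.mod_lt f (show 0 < G.blk by omega)
  have hjq : j * G.blk + G.blk ≤ G.m * G.blk := by
    have : (j + 1) * G.blk ≤ G.m * G.blk := Nat.mul_le_mul_right _ hjm
    rwa [add_mul, one_mul] at this
  set base := j * G.blk with hbase
  have htb : τt < (base + G.blk : ℕ) := by
    have : (f : ℝ) + 1 ≤ (base + G.blk : ℕ) := by exact_mod_cast (by omega)
    linarith
  have hbt0 : (base : ℝ) ≤ τt := le_trans (by exact_mod_cast (by omega)) hf1
  -- Before the last wiggle point of its block the trajectory has abscissa at most `16 * d` units,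
  -- too far left for the time `τt`.
  have hA : ((base + (4 * G.d + 1) : ℕ) : ℝ) ≤ τt := by
    by_contra hlt
    have := interp_mem_of_convex (convex_Iic ((16 * G.d) * G.unit : ℝ)) xt (a := base)
      (b := base + (4 * G.d + 1)) (fun i h1 h2 => ?_) hbt0 (not_le.1 hlt).le
    · rw [Set.mem_Iic] at this; nlinarith
    · obtain ⟨r, rfl⟩ := Nat.exists_eq_add_of_le h1
      rw [Set.mem_Iic, hxt _ (by omega)]
      refine mul_le_mul_of_nonneg_right ?_ (by linarith)
      have : G.trajX (base + r) ≤ 16 * G.d := by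
        by_cases h0 : base + r = 0
        · rw [h0, trajX_zero]; omega
        · rw [trajX_idx (by omega) h0 (block_lt hjm (by omega))]
          exact wiggle_le j (by omega)
      exact_mod_cast this
  -- From index `2` of the block to its end the abscissa is at least `7` units, too far right for
  -- the time `τs`.
  have hB : τs ≤ ((base + 2 : ℕ) : ℝ) := by
    by_contra hlt
    rw [not_le] at hlt
    have hge : ∀ i, base + 2 ≤ i → i ≤ base + G.blk - 1 → xt i ∈ Set.Ici (7 * G.unit : ℝ) := by
      intro i h1 h2
      obtain ⟨r, rfl⟩ := Nat.exists_eq_add_of_le (show base ≤ i by omega)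
      rw [Set.mem_Ici, hxt _ (by omega)]
      refine mul_le_mul_of_nonneg_right ?_ (by linarith)
      have : 7 ≤ G.trajX (base + r) := by
        by_cases hl : base + r = G.m * G.blk - 1
        · rw [hl, trajX_last hG]; omega
        · rw [trajX_idx (by omega) (by omega) hl]
          exact wiggle_ge j (by omega)
      exact_mod_cast this
    rcases le_or_gt (τs) ((base + G.blk - 1 : ℕ) : ℝ) with h | h
    · have := interp_mem_of_convex (convex_Ici (7 * G.unit : ℝ)) xt hge hlt.le h
      rw [Set.mem_Ici] at this; nlinarith
    -- What remains is the edge from the end of the block back to abscissa `0`. On it the trajectory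
    -- moves to the left, whereas `τt`, later on the same edge, lies further to the right than `τs`.
    · have hcast : ((base + G.blk - 1 : ℕ) : ℝ) = ((base + G.blk : ℕ) : ℝ) - 1 := by
        rw [Nat.cast_sub (by omega), Nat.cast_one]
      have hne : base + G.blk < G.m * G.blk := by
        refine lt_of_le_of_ne hjq fun he => ?_
        rw [← he] at htq
        linarith
      have e1 := hge (base + G.blk - 1) (by omega) le_rfl
      have e2 : xt (base + G.blk - 1 + 1) = 0 := by
        rw [Nat.sub_add_cancel (by omega), hxt _ hne]
        have hb1 : base + G.blk = (j + 1) * G.blk + 0 := by rw [hbase]; ring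
        have hj1 : j + 1 < G.m := by
          by_contra hc
          have : j + 1 = G.m := by omega
          rw [hb1, this] at hne; omega
        rw [hb1, trajX_idx (by omega) (by omega) (block_lt hj1 (by omega)),
          wiggle_first _ (by omega)]
        simp
      rw [interp_of_mem xt h.le (by rw [hcast]; linarith)] at hbs
      rw [interp_of_mem xt (h.le.trans hst) (by rw [hcast]; linarith)] at hbt
      rw [e2] at hbs hbt
      rw [Set.mem_Ici] at e1
      simp only [smul_eq_mul, mul_zero, add_zero] at hbs hbt
      nlinarith
  exact ⟨j, hjm, hB, hA⟩

/-- On a single edge the interpolation does not turn back. -/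
theorem interp_lt_of_lt (f : ℕ → ℝ) {z : ℕ} {a b c : ℝ} (ha : z ≤ a) (hab : a ≤ b) (hbc : b ≤ c)
    (hc : c ≤ z + 1) (h : interp f a < interp f b) : interp f b ≤ interp f c := by
  rw [interp_of_mem f (ha.trans hab) (hbc.trans hc)] at h ⊢
  rw [interp_of_mem f ha (hab.trans (hbc.trans hc))] at h
  rw [interp_of_mem f (ha.trans (hab.trans hbc)) hc]
  simp only [smul_eq_mul] at *
  have h1 : 0 < (b - a) * (f (z + 1) - f z) := by linarith
  have h2 : 0 ≤ f (z + 1) - f z := by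
    by_contra hneg
    exact absurd h1 (not_lt.2 (mul_nonpos_of_nonneg_of_nonpos (by linarith) (by linarith)))
  have h3 : 0 ≤ (c - b) * (f (z + 1) - f z) := mul_nonneg (by linarith) h2
  linarith

/-- The vertices of a row are far from the wiggles at the bits `1` of its vector. -/
theorem X_far_from_wiggle (hG : G.Good) {y k : ℕ} (hk : k < G.d) (hay : G.a y k = true) (c : ℤ) :
    G.X y c ≤ (16 * k + 10 - 6) * (G.unit : ℤ) ∨ (16 * k + 10 + 6) * (G.unit : ℤ) ≤ G.X y c := by
  have hgap : G.gap y k = 6 := by simp [gap, hay]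
  have hm : StrictMono (G.X y) := strictMono_X hG y
  rcases le_or_gt c (2 * k + 1) with h | h
  · left
    rw [← hgap, ← X_odd y hk]
    exact hm.monotone h
  · right
    rw [← hgap, ← X_even y hk]
    exact hm.monotone (by omega)

/-- The wiggles of two bits `1` cannot be matched: no vertex is visited during the wiggle of the
trajectory, so that the walker moves monotonically along one edge. -/
theorem no_wiggle (hG : G.Good) {w : ℕ → ℕ} {K : ℕ} {s t y j k : ℕ} (hst : s < t) (htK : t ≤ K)
    (hs0 : G.col (w s) = 0) (ht0 : G.col (w t) = 2 * G.d + 1)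
    (hmid : ∀ i, s < i → i < t → G.row (w i) = y ∧ 0 < G.col (w i) ∧ G.col (w i) < 2 * G.d + 1)
    {xw xt : ℕ → ℝ} (hxw : ∀ i ≤ K, xw i = G.X (G.row (w i)) (G.col (w i)))
    (hxt : ∀ t < G.m * G.blk, xt t = G.trajX t * G.unit) {α β : ℝ → ℝ}
    (hα : IsReparam (K + 1) α) (hβ : IsReparam (G.m * G.blk) β)
    (hdist : ∀ μ ∈ Set.Icc (0 : ℝ) 1, |interp xw (α μ) - interp xt (β μ)| < 3 * G.unit)
    {μs μt : ℝ} (hμs0 : 0 ≤ μs) (hμst : μs ≤ μt) (hμt1 : μt ≤ 1) (hμs : α μs = s) (hμt : α μt = t)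
    (hjm : j < G.m) (hB : β μs ≤ ((j * G.blk + 2 : ℕ) : ℝ))
    (hA : ((j * G.blk + (4 * G.d + 1) : ℕ) : ℝ) ≤ β μt) (hk : k < G.d) (hay : G.a y k = true)
    (hbj : G.b j k = true) : False := by
  have hU : (1 : ℝ) ≤ G.unit := by exact_mod_cast hG.unit_pos
  have hblk := hG.blk_ge
  have hα0 := hα.map_zero (by omega)
  have hμsI : μs ∈ Set.Icc (0 : ℝ) 1 := ⟨hμs0, hμst.trans hμt1⟩
  have hμtI : μt ∈ Set.Icc (0 : ℝ) 1 := ⟨hμs0.trans hμst, hμt1⟩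
  have hxs : xw s = 0 := by rw [hxw s (by omega), hs0, X_zero]; simp
  have hxtt : xw t = (16 * G.d + 10) * G.unit := by
    rw [hxw t htK, ht0, X_last]; push_cast; ring
  have hjq : j * G.blk + G.blk ≤ G.m * G.blk := by
    have : (j + 1) * G.blk ≤ G.m * G.blk := Nat.mul_le_mul_right _ hjm
    rwa [add_mul, one_mul] at this
  set base := j * G.blk with hbase
  set u : ℝ := 16 * k + 10 with hu
  have hkR : (k : ℝ) + 1 ≤ G.d := by exact_mod_cast hk
  have hk0 : (0 : ℝ) ≤ k := k.cast_nonneg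
  -- Three of the four wiggle points suffice: `u - 3`, `u + 3`, `u - 3`.
  have hval : ∀ s < 3, xt (base + 2 + 4 * k + s) = (u + if s = 1 then 3 else -3) * G.unit := by
    intro s hs
    rw [hxt _ (by omega)]
    have e : base + 2 + 4 * k + s = base + (2 + 4 * k + s) := by ring
    rw [e, trajX_idx (by omega) (by omega) (block_lt hjm (by omega)),
      wiggle_mid j hk (by omega)]
    simp only [hbj, if_true]
    interval_cases s <;> simp [hu]
  have hbounds : ∀ s < 3, β μs ≤ ((base + 2 + 4 * k + s : ℕ) : ℝ) ∧
      ((base + 2 + 4 * k + s : ℕ) : ℝ) ≤ β μt := by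
    intro s hs
    refine ⟨hB.trans ?_, le_trans ?_ hA⟩ <;> exact_mod_cast (by omega)
  obtain ⟨μ₁, h11, h12, h13⟩ := hβ.exists_between hμs0 hμst hμt1 (hbounds 0 (by omega)).1
    (hbounds 0 (by omega)).2
  obtain ⟨μ₂, h21, h22, h23⟩ := hβ.exists_between (hμs0.trans h11) h12 hμt1
    (c := ((base + 2 + 4 * k + 1 : ℕ) : ℝ)) (by rw [h13]; exact_mod_cast (by omega))
    (hbounds 1 (by omega)).2
  obtain ⟨μ₃, h31, h32, h33⟩ := hβ.exists_between ((hμs0.trans h11).trans h21) h22 hμt1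
    (c := ((base + 2 + 4 * k + 2 : ℕ) : ℝ)) (by rw [h23]; exact_mod_cast (by omega))
    (hbounds 2 (by omega)).2
  have hI₁ : μ₁ ∈ Set.Icc (0 : ℝ) 1 := ⟨hμs0.trans h11, h12.trans hμt1⟩
  have hI₂ : μ₂ ∈ Set.Icc (0 : ℝ) 1 := ⟨hI₁.1.trans h21, h22.trans hμt1⟩
  have hI₃ : μ₃ ∈ Set.Icc (0 : ℝ) 1 := ⟨hI₂.1.trans h31, h32.trans hμt1⟩
  -- A distance of less than three units from `u - 3` keeps the walker left of the centre `u`, and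
  -- from `u + 3` right of it.
  have x1 : interp xw (α μ₁) < u * G.unit := by
    have h := hdist μ₁ hI₁
    rw [h13, interp_natCast, hval 0 (by omega), abs_lt] at h
    simp only [zero_ne_one, if_false] at h
    linarith [h.2]
  have x2 : u * G.unit < interp xw (α μ₂) := by
    have h := hdist μ₂ hI₂
    rw [h23, interp_natCast, hval 1 (by omega), abs_lt] at h
    simp only [if_true] at h
    linarith [h.1]
  have x3 : interp xw (α μ₃) < u * G.unit := by
    have h := hdist μ₃ hI₃
    rw [h33, interp_natCast, hval 2 (by omega), abs_lt] at h
    simp only [OfNat.ofNat_ne_one, if_false] at h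
    linarith [h.2]
  have a12 := hα.2.1 hI₁ hI₂ h21
  have a23 := hα.2.1 hI₂ hI₃ h31
  -- Meanwhile the trajectory stays within three units of `u`, so the walker stays strictly within
  -- six, where the row has no vertex. The two ends of the row are excluded separately, by `0 ≤ u -
  -- 6` and `u + 6 ≤ 16 * d + 10`.
  have novertex : ∀ μ, μ₁ ≤ μ → μ ≤ μ₃ → ∀ z : ℕ, α μ ≠ z := by
    intro μ hμ1 hμ3 z hz
    have hI : μ ∈ Set.Icc (0 : ℝ) 1 := ⟨hI₁.1.trans hμ1, hμ3.trans hI₃.2⟩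
    have hsz : s ≤ z := by
      have := hα.2.1 hμsI hI (h11.trans hμ1)
      rw [hμs, hz] at this; exact_mod_cast this
    have hzt : z ≤ t := by
      have := hα.2.1 hI hμtI (hμ3.trans h32)
      rw [hμt, hz] at this; exact_mod_cast this
    have hτ : interp xt (β μ) ∈ Set.Icc ((u - 3) * G.unit : ℝ) ((u + 3) * G.unit) := by
      refine interp_mem_of_convex (convex_Icc _ _) xt (a := base + 2 + 4 * k + 0)
        (b := base + 2 + 4 * k + 2) (fun i h1 h2 => ?_)
        (h13 ▸ hβ.2.1 hI₁ hI hμ1) (h33 ▸ hβ.2.1 hI hI₃ hμ3)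
      obtain ⟨r, rfl⟩ := Nat.exists_eq_add_of_le (show base + 2 + 4 * k ≤ i by omega)
      rw [hval r (by omega)]
      constructor <;> refine mul_le_mul_of_nonneg_right ?_ (by linarith) <;> split_ifs <;> linarith
    have hdz := hdist μ hI
    rw [hz, interp_natCast, abs_lt] at hdz
    have hlo : (u - 6) * G.unit < xw z := by linarith [hdz.1, hτ.1]
    have hhi : xw z < (u + 6) * G.unit := by linarith [hdz.2, hτ.2]
    rcases hsz.lt_or_eq with hsz | rfl
    swap
    · rw [hxs] at hlo
      have := mul_nonneg (show (0 : ℝ) ≤ u - 6 by linarith) (show (0 : ℝ) ≤ G.unit by linarith)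
      linarith
    rcases hzt.lt_or_eq with hzt | rfl
    swap
    · rw [hxtt] at hhi
      have := mul_le_mul_of_nonneg_right (show u + 6 ≤ 16 * G.d + 10 by linarith)
        (show (0 : ℝ) ≤ G.unit by linarith)
      linarith
    obtain ⟨hrow, hc0, hc1⟩ := hmid z hsz hzt
    rw [hxw z (by omega), hrow] at hlo hhi
    rcases X_far_from_wiggle hG hk hay (G.col (w z)) with h | h
    · have h' : (G.X y (G.col (w z)) : ℝ) ≤ (16 * k + 10 - 6) * G.unit := by exact_mod_cast h
      linarith
    · have h' : (16 * k + 10 + 6) * G.unit ≤ (G.X y (G.col (w z)) : ℝ) := by exact_mod_cast h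
      linarith
  have hα0' : 0 ≤ α μ₁ := hα0 ▸ hα.2.1 (by simp) hI₁ hI₁.1
  have hz1 := Nat.floor_le hα0'
  have hz2 := Nat.lt_floor_add_one (α μ₁)
  set z := ⌊α μ₁⌋₊
  -- No integer parameter is passed, so the walker stays on one edge, on which it would go right and
  -- then left.
  have hz3 : α μ₃ ≤ z + 1 := by
    by_contra hlt
    obtain ⟨μ, m1, m2, m3⟩ := hα.exists_between hI₁.1 (h21.trans h31) hI₃.2
      (c := ((z + 1 : ℕ) : ℝ)) (by push_cast; exact hz2.le) (by push_cast; exact (not_le.1 hlt).le)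
    exact novertex μ m1 m2 _ m3
  exact absurd (interp_lt_of_lt xw hz1 a12 a23 hz3 (x1.trans x2)) (by linarith)

/-- The ends of the trajectory, three units outside the columns, force the walker to start among the
pads and to end at the extra vertex of the last row. It therefore crosses some row, meanwhile the
trajectory passes all wiggles of a block, and a common bit `1` would contradict `no_wiggle`. The
strict bound is essential. -/
theorem exists_orthogonal (hG : G.Good) (hd : 1 ≤ G.d) {w : ℕ → ℕ} {K : ℕ}
    (hw : ∀ i ≤ K, w i < G.numVerts) (hnear : ∀ i < K, G.Near (w i) (w (i + 1)))
    {xw xt : ℕ → ℝ} (hxw : ∀ i ≤ K, xw i = G.X (G.row (w i)) (G.col (w i)))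
    (hxt : ∀ t < G.m * G.blk, xt t = G.trajX t * G.unit) {α β : ℝ → ℝ}
    (hα : IsReparam (K + 1) α) (hβ : IsReparam (G.m * G.blk) β)
    (hdist : ∀ μ ∈ Set.Icc (0 : ℝ) 1, |interp xw (α μ) - interp xt (β μ)| < 3 * G.unit) :
    ∃ y j, 1 ≤ y ∧ y ≤ G.n ∧ j < G.m ∧ ∀ k < G.d, ¬ (G.a y k = true ∧ G.b j k = true) := by
  have hU : (1 : ℝ) ≤ G.unit := by exact_mod_cast hG.unit_pos
  have hblk := hG.blk_ge
  have hq1 : 1 * G.blk ≤ G.m * G.blk := Nat.mul_le_mul_right _ hG.m_pos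
  have hdR : (1 : ℝ) ≤ G.d := by exact_mod_cast hd
  -- the ends
  have hstart : G.col (w 0) < 0 := by
    have h := hdist 0 (by simp)
    have e1 : interp xw 0 = _ := (interp_zero xw).trans (hxw 0 (by omega))
    have e2 : interp xt 0 = _ := (interp_zero xt).trans (hxt 0 (by omega))
    rw [hα.map_zero (by omega), hβ.map_zero (by omega), e1, e2, trajX_zero, abs_lt] at h
    push_cast at h
    have : (G.X (G.row (w 0)) (G.col (w 0)) : ℝ) < G.X (G.row (w 0)) 0 := by
      rw [X_zero]; push_cast; linarith [h.2]
    exact (X_lt_iff hG).1 this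
  have hend : 2 * G.d + 1 < G.col (w K) := by
    have h := hdist 1 (by simp)
    have e : ((G.m * G.blk : ℕ) : ℝ) - 1 = ((G.m * G.blk - 1 : ℕ) : ℝ) := by
      rw [Nat.cast_sub (by omega), Nat.cast_one]
    have e1 : interp xw K = _ := (interp_natCast xw K).trans (hxw K le_rfl)
    rw [hα.map_one (by omega), hβ.map_one (by omega), e, interp_natCast, hxt _ (by omega),
      trajX_last hG, Nat.cast_add, Nat.cast_one, add_sub_cancel_right, e1, abs_lt] at h
    push_cast at h
    have : (G.X (G.row (w K)) (2 * G.d + 1) : ℝ) < G.X (G.row (w K)) (G.col (w K)) := by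
      rw [X_last]; push_cast; linarith [h.1]
    exact (X_lt_iff hG).1 this
  have hr0 := row_of_col_neg (hw 0 (by omega)) hstart
  have hrK := row_of_col_far (hw K le_rfl) hend
  obtain ⟨s, t, y, hst, htK, hy1, hyn, hs0, ht0, hmid⟩ := exists_crossing hd hw hnear (.inl hr0)
    (by unfold IsRight; omega) (.inl hrK)
  have hxs : xw s = 0 := by rw [hxw s (by omega), hs0, X_zero]; simp
  have hxtt : xw t = (16 * G.d + 10) * G.unit := by
    rw [hxw t htK, ht0, X_last]; push_cast; ring
  -- the times at which the row is entered and left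
  have hα0 := hα.map_zero (by omega)
  have hα1 := hα.map_one (by omega)
  push_cast at hα1
  rw [add_sub_cancel_right] at hα1
  obtain ⟨μs, hμs0, hμs1, hμs⟩ := hα.exists_between (c := s) le_rfl zero_le_one le_rfl
    (by rw [hα0]; positivity) (by rw [hα1]; exact_mod_cast (by omega))
  obtain ⟨μt, hμst, hμt1, hμt⟩ := hα.exists_between (c := t) hμs0 hμs1 le_rfl
    (by rw [hμs]; exact_mod_cast hst.le) (by rw [hα1]; exact_mod_cast htK)
  have hμsI : μs ∈ Set.Icc (0 : ℝ) 1 := ⟨hμs0, hμs1⟩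
  have hμtI : μt ∈ Set.Icc (0 : ℝ) 1 := ⟨hμs0.trans hμst, hμt1⟩
  have hβmem : ∀ μ ∈ Set.Icc (0 : ℝ) 1, β μ ∈ Set.Icc (0 : ℝ) ((G.m * G.blk : ℕ) - 1) :=
    fun μ hμ => hβ.2.2 ▸ ⟨μ, hμ, rfl⟩
  have hbs : interp xt (β μs) < 3 * G.unit := by
    have h := hdist μs hμsI
    rw [hμs, interp_natCast, hxs, abs_lt] at h
    linarith [h.1]
  have hbt : (16 * G.d + 7) * G.unit < interp xt (β μt) := by
    have h := hdist μt hμtI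
    rw [hμt, interp_natCast, hxtt, abs_lt] at h
    linarith [h.2]
  have hβst : β μs ≤ β μt := hβ.2.1 hμsI hμtI hμst
  obtain ⟨ht0', htq⟩ := hβmem μt hμtI
  obtain ⟨j, hjm, hB, hA⟩ := exists_block hG hxt hβst ht0' htq hbs hbt
  exact ⟨y, j, hy1, hyn, hjm, fun k hk ⟨hay, hbj⟩ => no_wiggle hG hst htK hs0 ht0 hmid hxw hxt hα hβ
    hdist hμs0 hμst hμt1 hμs hμt hjm hB hA hk hay hbj⟩

end Gadget

/-! ### The lower bound for the optimum -/

namespace Gadget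

variable {G : Gadget}

/-- The map in the definition of `MapInstance.opt` elaborates to a monadic coercion of the list of
indices; this turns it into a plain map. -/
theorem _root_.List.map_coe_fin {β : Type*} {k : ℕ} (l : List (Fin k)) (f : ℕ → β) :
    (do let a ← l; pure (a : ℕ)).map f = l.map fun a : Fin k => f a := by
  simp [List.map_eq_flatMap, List.flatMap_assoc]

theorem near_of_adj (hG : G.Good) {v w : Fin G.toInstance.verts.length}
    (h : G.toInstance.graph.Adj v w) : G.Near v w := by
  have key : ∀ e ∈ G.edges, G.Near e.1 e.2 := fun e he => by
    rcases edge_kind hG he with h | h | h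
    · exact .inl (.inl h)
    · exact .inr (.inl h)
    · exact .inl (.inr h)
  rw [MapInstance.graph, SimpleGraph.fromRel_adj] at h
  rcases h.2 with h | h
  · exact key _ h
  · exact (key _ h).symm

/-- A matching of radius below three units is projected to the axis, which does not increase
distances; `exists_orthogonal` needs the abscissas only. -/
theorem le_opt (hG : G.Good) (hd : 1 ≤ G.d)
    (h : ¬ ∃ y j, 1 ≤ y ∧ y ≤ G.n ∧ j < G.m ∧ ∀ k < G.d, ¬ (G.a y k = true ∧ G.b j k = true)) :
    3 * (G.unit : ℝ) ≤ G.toInstance.opt := by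
  have hblk := hG.blk_ge
  have hq1 : 1 * G.blk ≤ G.m * G.blk := Nat.mul_le_mul_right _ hG.m_pos
  refine le_csInf ?_ ?_
  · have v : Fin G.toInstance.verts.length := ⟨0, by rw [length_verts, numVerts]; omega⟩
    exact ⟨_, v, v, .nil, rfl⟩
  · rintro _ ⟨u, v, π, rfl⟩
    rw [List.map_coe_fin]
    have hlen : (π.support.map fun i : Fin _ => G.toInstance.pt i).length = π.length + 1 := by simp
    have hget : ∀ i ≤ π.length, (π.support.map fun i : Fin _ => G.toInstance.pt i).getD i 0 =
        G.toInstance.pt (π.getVert i) := by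
      intro i hi
      rw [List.getD_eq_getElem _ _ (by omega), List.getElem_map,
        SimpleGraph.Walk.support_getElem_eq_getVert]
    have hlt : ∀ x : Fin G.toInstance.verts.length, (x : ℕ) < G.numVerts := fun x => by
      simpa [length_verts] using x.2
    refine le_frechetDist (by simp) ?_ fun s hs α β hα hβ hdist => h ?_
    · have := (valid hG).traj_ne_nil
      simpa using this
    · have hlt' : (G.toInstance.traj.map toPlane).length = G.m * G.blk := by simp [toInstance]
      rw [hlen] at hα
      rw [hlt'] at hβ
      refine exists_orthogonal hG hd (w := fun i => (π.getVert i : ℕ)) (K := π.length)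
        (xw := fun i => (π.support.map fun i : Fin _ => G.toInstance.pt i).getD i 0 0)
        (xt := fun i => (G.toInstance.traj.map toPlane).getD i 0 0)
        (fun i _ => hlt _) (fun i hi => near_of_adj hG (π.adj_getVert_succ hi)) (fun i hi => ?_)
        (fun t ht => ?_) hα hβ fun μ hμ => ?_
      · simp only
        rw [hget i hi, pt_zero (hlt _)]
      · simp only
        rw [List.getD_eq_getElem _ _ (by omega)]
        simp [toInstance, toPlane_zero]
      · have h1 := (hdist μ hμ).trans_lt hs
        rw [polyline_eq_interp, polyline_eq_interp, EuclideanSpace.dist_eq] at h1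
        refine lt_of_le_of_lt ?_ h1
        rw [Fin.sum_univ_two, ← interp_apply_zero, ← interp_apply_zero, ← Real.dist_eq]
        exact Real.le_sqrt_of_sq_le (by nlinarith [sq_nonneg (dist
          ((interp (fun i => (π.support.map fun i : Fin _ => G.toInstance.pt i).getD i 0) (α μ)) 1)
          ((interp (fun i => (G.toInstance.traj.map toPlane).getD i 0) (β μ)) 1))])

end Gadget

/-! ### The upper bound for the optimum: constructing a matched walk -/

namespace Gadget

variable {G : Gadget}

/-- The point of the axis with abscissa `x`. -/
noncomputable def axisPt (x : ℤ) : Plane := toPlane (x, 0)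

theorem toPlane_mem_segment {x x₁ x₂ y : ℤ} (h : x₁ ≤ x ∧ x ≤ x₂ ∨ x₂ ≤ x ∧ x ≤ x₁) :
    toPlane (x, y) ∈ segment ℝ (toPlane (x₁, y)) (toPlane (x₂, y)) := by
  wlog h' : x₁ ≤ x ∧ x ≤ x₂ generalizing x₁ x₂
  · rw [segment_symm]
    exact this h.symm (h.resolve_left h')
  obtain ⟨h1, h2⟩ := h'
  have h1' : (x₁ : ℝ) ≤ x := by exact_mod_cast h1
  have h2' : (x : ℝ) ≤ x₂ := by exact_mod_cast h2
  have hx : (x : ℝ) ∈ segment ℝ (x₁ : ℝ) x₂ := by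
    rw [segment_eq_Icc (h1'.trans h2')]; exact ⟨h1', h2'⟩
  obtain ⟨a, b, ha, hb, hab, e⟩ := hx
  refine ⟨a, b, ha, hb, hab, ?_⟩
  ext i
  fin_cases i
  · simpa [toPlane] using e
  · simp [toPlane, ← add_mul, hab]

theorem dist_toPlane_le (x x' y y' : ℤ) :
    dist (toPlane (x, y)) (toPlane (x', y')) ≤ (|x - x'| : ℤ) + (|y - y'| : ℤ) := by
  rw [EuclideanSpace.dist_eq, Fin.sum_univ_two, Real.dist_eq, Real.dist_eq, toPlane_zero,
    toPlane_zero, toPlane_one, toPlane_one]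
  push_cast
  refine Real.sqrt_le_iff.2 ⟨by positivity, ?_⟩
  nlinarith [mul_nonneg (abs_nonneg ((x : ℝ) - x')) (abs_nonneg ((y : ℝ) - y'))]

/-- The bound for the Fréchet distance. -/
def radius (G : Gadget) : ℝ := G.unit + G.n + 1

theorem dist_axisPt_le {x x' : ℤ} {y : ℕ} (hy : y ≤ G.n + 1) (h : |x - x'| ≤ G.unit) :
    dist (toPlane (x, (y : ℤ))) (axisPt x') ≤ G.radius := by
  refine (dist_toPlane_le _ _ _ _).trans ?_
  have h1 : ((|x - x'| : ℤ) : ℝ) ≤ G.unit := by exact_mod_cast h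
  have h2 : ((|(y : ℤ) - 0| : ℤ) : ℝ) ≤ G.n + 1 := by
    rw [sub_zero, abs_of_nonneg (by positivity)]; exact_mod_cast hy
  unfold radius; linarith

theorem dist_pt_le {v : ℕ} (hv : v < G.numVerts) {x : ℤ}
    (h : |G.X (G.row v) (G.col v) - x| ≤ G.unit) :
    dist (G.toInstance.pt v) (axisPt x) ≤ G.radius := by
  rw [pt_eq hv]; exact dist_axisPt_le (row_le hv) h

def Adj (G : Gadget) (v w : ℕ) : Prop := (v, w) ∈ G.edges ∨ (w, v) ∈ G.edges

theorem Adj.symm {v w : ℕ} (h : G.Adj v w) : G.Adj w v := Or.symm h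

theorem Adj.lt (hG : G.Good) {v w : ℕ} (h : G.Adj v w) : v < G.numVerts ∧ w < G.numVerts := by
  rcases h with h | h
  · have := edges_lt hG h; simp only at this; omega
  · have := edges_lt hG h; simp only at this; omega

/-- Some path that starts at the vertex `v` is matched to the curve `b`. -/
def Walks (G : Gadget) (v : ℕ) (b : List Plane) : Prop :=
  ∃ l : List ℕ, (v :: l).IsChain G.Adj ∧ Matched G.radius ((v :: l).map G.toInstance.pt) b

namespace Walks

variable {v w : ℕ} {x y z : Plane} {b : List Plane}

theorem single (h : dist (G.toInstance.pt v) x ≤ G.radius) : G.Walks v [x] :=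
  ⟨[], by simp, Matched.single h⟩

theorem both (h : G.Adj v w) (hd : dist (G.toInstance.pt v) x ≤ G.radius)
    (hw : G.Walks w (y :: b)) : G.Walks v (x :: y :: b) := by
  obtain ⟨l, hl, hm⟩ := hw
  exact ⟨w :: l, List.isChain_cons_cons.2 ⟨h, hl⟩, Matched.both hd hm⟩

theorem left (h : G.Adj v w) (hd : dist (G.toInstance.pt v) x ≤ G.radius)
    (hw : G.Walks w (x :: b)) : G.Walks v (x :: b) := by
  obtain ⟨l, hl, hm⟩ := hw
  exact ⟨w :: l, List.isChain_cons_cons.2 ⟨h, hl⟩, Matched.left hd hm⟩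

theorem right (hd : dist (G.toInstance.pt v) x ≤ G.radius)
    (hw : G.Walks v (y :: b)) : G.Walks v (x :: y :: b) := by
  obtain ⟨l, hl, hm⟩ := hw
  exact ⟨l, hl, Matched.right hd hm⟩

theorem of_subdivided {x y z : ℤ} (h : x ≤ y ∧ y ≤ z ∨ z ≤ y ∧ y ≤ x)
    (hw : G.Walks v (axisPt x :: axisPt y :: axisPt z :: b)) :
    G.Walks v (axisPt x :: axisPt z :: b) := by
  obtain ⟨l, hl, hm⟩ := hw
  exact ⟨l, hl, Matched.of_subdivided_right (toPlane_mem_segment h) hm⟩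

/-- A wiggle of the trajectory at a bit `0` is matched along a single edge. -/
theorem wiggle {y : ℕ} {u z : ℤ} (h : G.Adj v w) (hy : y ≤ G.n + 1)
    (hv : G.toInstance.pt v = toPlane ((u - 6) * G.unit, (y : ℤ)))
    (hw' : G.toInstance.pt w = toPlane ((u + 6) * G.unit, (y : ℤ))) (hz : u + 6 ≤ z)
    (hw : G.Walks w (axisPt ((u + 6) * G.unit) :: axisPt (z * G.unit) :: b)) :
    G.Walks v (axisPt ((u - 6) * G.unit) :: axisPt ((u - 3) * G.unit) ::
      axisPt ((u + 1) * G.unit) :: axisPt ((u - 1) * G.unit) :: axisPt ((u + 3) * G.unit) ::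
      axisPt (z * G.unit) :: b) := by
  obtain ⟨l, hl, hm⟩ := hw
  refine ⟨w :: l, List.isChain_cons_cons.2 ⟨h, hl⟩, ?_⟩
  simp only [List.map_cons, hv, hw'] at hm ⊢
  have U0 : (0 : ℤ) ≤ G.unit := by positivity
  have hdist : ∀ x x' : ℤ, |x - x'| ≤ 1 →
      dist (toPlane (x * G.unit, (y : ℤ))) (axisPt (x' * G.unit)) ≤ G.radius := by
    intro x x' hx
    refine dist_axisPt_le hy ?_
    rw [← sub_mul, abs_mul, abs_of_nonneg U0]
    nlinarith
  have hseg : ∀ {x x₁ x₂ y : ℤ}, x₁ ≤ x → x ≤ x₂ → toPlane (x * G.unit, y) ∈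
      segment ℝ (toPlane (x₁ * G.unit, y)) (toPlane (x₂ * G.unit, y)) := fun h1 h2 =>
    toPlane_mem_segment (.inl ⟨mul_le_mul_of_nonneg_right h1 U0, mul_le_mul_of_nonneg_right h2 U0⟩)
  -- The points `u - 3, u + 1, u - 1, u + 3` are matched to `u - 3, u, u, u + 3` on the edge. These
  -- are inserted from right to left as subdividing points of the walk and dropped again; the walker
  -- rests at `u` during the backward move.
  have m1 := Matched.of_subdivided_right (hseg (by omega) hz) (hm.both (hdist (u + 3) (u + 3) (by simp)))
  have m2 := Matched.of_subdivided_left (hseg (by omega) (by omega))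
    (m1.both (hdist u (u - 1) (by simp)))
  have m3 := Matched.of_subdivided_left (hseg (by omega) (by omega))
    (m2.both (hdist u (u + 1) (by simp)))
  have m4 := Matched.of_subdivided_left (hseg (by omega) (by omega))
    (m3.both (hdist (u - 3) (u - 3) (by simp)))
  exact Matched.of_subdivided_left (hseg (by omega) (by omega))
    (m4.both (hdist (u - 6) (u - 6) (by simp)))

end Walks

theorem exists_walk (hG : G.Good) (l : List ℕ) : ∀ v, (v :: l).IsChain G.Adj →
    (hv : v < G.numVerts) → ∃ (u : Fin G.toInstance.verts.length)
    (π : G.toInstance.graph.Walk ⟨v, by rwa [length_verts]⟩ u),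
    π.support.map (fun i : Fin _ => (i : ℕ)) = v :: l := by
  induction l with
  | nil => exact fun v _ hv => ⟨_, .nil, rfl⟩
  | cons w l ih =>
    intro v h hv
    obtain ⟨h1, h2⟩ := List.isChain_cons_cons.1 h
    have hw := (h1.lt hG).2
    obtain ⟨u, π, hπ⟩ := ih w h2 hw
    have hadj : G.toInstance.graph.Adj ⟨v, by rwa [length_verts]⟩ ⟨w, by rwa [length_verts]⟩ := by
      rcases h1 with h1 | h1
      · exact adj_of_mem (v := ⟨v, by rwa [length_verts]⟩) (w := ⟨w, by rwa [length_verts]⟩) h1 hG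
      · exact (adj_of_mem (v := ⟨w, by rwa [length_verts]⟩) (w := ⟨v, by rwa [length_verts]⟩)
          h1 hG).symm
    exact ⟨u, .cons hadj π, by simp [hπ]⟩

/-- The part of the trajectory from the point with index `t` on. -/
noncomputable def suffix (G : Gadget) (t : ℕ) : List Plane :=
  (List.range' t (G.m * G.blk - t)).map fun t => axisPt (G.trajX t * G.unit)

theorem suffix_eq_cons {t : ℕ} (h : t < G.m * G.blk) :
    G.suffix t = axisPt (G.trajX t * G.unit) :: G.suffix (t + 1) := by
  unfold suffix
  rw [show G.m * G.blk - t = (G.m * G.blk - (t + 1)) + 1 by omega, List.range'_succ, List.map_cons]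

theorem opt_le (hG : G.Good) {v : ℕ} (hv : v < G.numVerts) (h : G.Walks v (G.suffix 0)) :
    G.toInstance.opt ≤ G.radius := by
  obtain ⟨l, hl, hm⟩ := h
  obtain ⟨u, π, hπ⟩ := exists_walk hG l v hl hv
  have hle := hm.frechetDist_le
  refine le_trans (csInf_le ⟨0, ?_⟩ ⟨_, u, π, rfl⟩) ?_
  · rintro _ ⟨_, _, _, rfl⟩
    exact frechetDist_nonneg _ _
  · rw [List.map_coe_fin]
    refine le_trans (le_of_eq ?_) hle
    congr 1
    · rw [← hπ, List.map_map]; rfl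
    · simp [toInstance, suffix, List.range_eq_range', axisPt]

/-! #### Moving through the graph -/

theorem adj_row {y c : ℕ} (hy : y < G.n + 2) (hc : c < 2 * G.d + 1) :
    G.Adj (y * G.width + c) (y * G.width + (c + 1)) :=
  .inl (mem_edges.2 (.inl ⟨y, c, hy, hc, rfl⟩))

theorem dist_idx_le {y c : ℕ} (hy : y < G.n + 2) (hc : c < G.width) {x : ℤ}
    (h : |G.X y c - x| ≤ G.unit) :
    dist (G.toInstance.pt (y * G.width + c)) (axisPt x) ≤ G.radius := by
  have hv : y * G.width + c < G.numVerts := by have := idx_lt_core hy hc; unfold numVerts; omega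
  refine dist_pt_le hv ?_
  rwa [row_idx hy hc, col_idx hy hc]

/-- Staying at a vertex. -/
theorem Walks.stay {v t t' : ℕ} (htt : t' ≤ t) (ht : t < G.m * G.blk)
    (h : ∀ s, t' ≤ s → s < t → dist (G.toInstance.pt v) (axisPt (G.trajX s * G.unit)) ≤ G.radius)
    (hw : G.Walks v (G.suffix t)) : G.Walks v (G.suffix t') := by
  induction t, htt using Nat.le_induction with
  | base => exact hw
  | succ t ht' ih =>
    refine ih (by omega) (fun s h1 h2 => h s h1 (by omega)) ?_
    rw [suffix_eq_cons ht] at hw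
    rw [suffix_eq_cons (by omega), suffix_eq_cons ht]
    exact hw.right (h t ht' (by omega))

/-- Walking back along a row. -/
theorem Walks.back (hG : G.Good) {y : ℕ} (hy : y < G.n + 2) {b : List Plane}
    (hw : G.Walks (y * G.width + 0) (axisPt 0 :: b)) (c : ℕ) (hc : c < G.width) :
    G.Walks (y * G.width + c) (axisPt (G.X y c) :: axisPt 0 :: b) := by
  have hU : (0 : ℤ) ≤ G.unit := by positivity
  have hwd : G.width = 2 * G.d + 2 := rfl
  induction c with
  | zero =>
    rw [Nat.cast_zero, X_zero]
    exact hw.right (dist_idx_le hy hc (by rw [Nat.cast_zero, X_zero]; simp))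
  | succ c ih =>
    -- The trajectory returns to `0` on one straight edge, which is subdivided at the abscissas of
    -- the columns so that the walker is always exactly above or at its point.
    refine Walks.of_subdivided (.inr ⟨?_, ?_⟩)
      ((ih (by omega)).both (adj_row hy (by omega)).symm
        (dist_idx_le hy hc (by rw [sub_self, abs_zero]; exact hU)))
    · rw [← X_zero (G := G) y]
      exact (strictMono_X hG y).monotone (by positivity)
    · exact (strictMono_X hG y).monotone (by push_cast; omega)

theorem trajX_mid {j k s : ℕ} (hG : G.Good) (hj : j < G.m) (hk : k < G.d) (hs : s < 4) :
    G.trajX (j * G.blk + (2 + 4 * k + s)) = 16 * k + 10 + (if s = 0 then -3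
       else if s = 1 then (if G.b j k then 3 else 1)
       else if s = 2 then -(if G.b j k then 3 else 1) else 3) := by
  have := hG.blk_ge
  rw [trajX_idx (by omega) (by omega) (block_lt hj (by omega)), wiggle_mid j hk hs]

theorem trajX_end {j r : ℕ} (h1 : 2 + 4 * G.d ≤ r)
    (h2 : r < G.blk) (h3 : j * G.blk + r ≠ G.m * G.blk - 1) :
    G.trajX (j * G.blk + r) = 16 * G.d + 10 := by
  rw [trajX_idx h2 (by omega) h3, wiggle_last j h1]

theorem idx_lt {j r : ℕ} (hj : j < G.m) (hr : r < G.blk) : j * G.blk + r < G.m * G.blk := by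
  have : (j + 1) * G.blk ≤ G.m * G.blk := Nat.mul_le_mul_right _ hj
  rw [add_mul, one_mul] at this
  omega

theorem abs_unit {U x x' : ℤ} (hU : 0 ≤ U) (h : |x - x'| ≤ 1) : |x * U - x' * U| ≤ U := by
  rw [← sub_mul, abs_mul, abs_of_nonneg hU]; nlinarith

/-- Walking along the row of a vector while the trajectory passes a block of a vector orthogonal
to it. -/
theorem Walks.sweep (hG : G.Good) {y j : ℕ} (hy : y < G.n + 2) (hj : j < G.m)
    (hor : ∀ k < G.d, ¬ (G.a y k = true ∧ G.b j k = true))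
    (hw : G.Walks (y * G.width + (2 * G.d + 1)) (G.suffix (j * G.blk + (2 + 4 * G.d)))) :
    G.Walks (y * G.width + 0) (G.suffix (j * G.blk + 1)) := by
  have hU : (0 : ℤ) ≤ G.unit := by positivity
  have hwd : G.width = 2 * G.d + 2 := rfl
  have hblk := hG.blk_ge
  have hend := trajX_end (le_refl (2 + 4 * G.d)) (by omega) (block_lt hj (by omega))
  have hq : ∀ r < G.blk, j * G.blk + r < G.m * G.blk := fun r hr => idx_lt hj hr
  -- Induction from the right end. Here `e` is the abscissa of the trajectory, in units, when the
  -- walker stands in column `2 * k`; `e ≤ 16 * k + 4` says that it has not passed `u - 6` for the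
  -- next centre `u = 16 * k + 10`.
  have key : ∀ i ≤ G.d, ∀ k, k + i = G.d → ∀ e : ℤ, |G.X y (2 * k : ℕ) - e * G.unit| ≤ G.unit →
      e ≤ 16 * k + 4 → G.Walks (y * G.width + 2 * k)
        (axisPt (e * G.unit) :: G.suffix (j * G.blk + (2 + 4 * k))) := by
    intro i
    induction i with
    | zero =>
      rintro - k hk e he -
      obtain rfl : k = G.d := by omega
      rw [suffix_eq_cons (hq _ (by omega))] at hw ⊢
      exact hw.both (adj_row hy (by omega)) (dist_idx_le hy (by omega) he)
    | succ i ih =>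
      intro hi k hk e he he'
      have hkd : k < G.d := by omega
      have hodd : G.X y (2 * k + 1 : ℕ) = (16 * k + 10 - G.gap y k) * G.unit := by
        rw [← X_odd y hkd]; push_cast; rfl
      have heven : G.X y (2 * k + 2 : ℕ) = (16 * k + 10 + G.gap y k) * G.unit := by
        rw [← X_even y hkd]; push_cast; rfl
      have IH := ih (by omega) (k + 1) (by omega)
      rw [show 2 * (k + 1) = 2 * k + 2 by ring, show 2 + 4 * (k + 1) = 2 + 4 * k + 3 + 1 by ring,
        heven] at IH
      have a0 := adj_row (G := G) hy (c := 2 * k) (by omega)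
      have a1 := adj_row (G := G) hy (c := 2 * k + 1) (by omega)
      rw [show 2 * k + 1 + 1 = 2 * k + 2 by ring] at a1
      -- the next wiggle
      obtain ⟨z, hz1, hz2⟩ : ∃ z, 16 * (k : ℤ) + 16 ≤ z ∧
          G.trajX (j * G.blk + (2 + 4 * k + 3 + 1)) = z := by
        refine ⟨_, ?_, rfl⟩
        rcases (show k + 1 ≤ G.d by omega).lt_or_eq with h | h
        · have := trajX_mid hG hj h (show 0 < 4 by omega)
          rw [show 2 + 4 * (k + 1) + 0 = 2 + 4 * k + 3 + 1 by ring] at this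
          rw [this]; simp; omega
        · rw [show 2 + 4 * k + 3 + 1 = 2 + 4 * G.d by omega, hend, ← h]; push_cast; omega
      have t0 := trajX_mid hG hj hkd (show 0 < 4 by omega)
      have t1 := trajX_mid hG hj hkd (show 1 < 4 by omega)
      have t2 := trajX_mid hG hj hkd (show 2 < 4 by omega)
      have t3 := trajX_mid hG hj hkd (show 3 < 4 by omega)
      simp only [add_zero, if_true, one_ne_zero, if_false, OfNat.ofNat_ne_zero,
        OfNat.ofNat_ne_one, show (3 : ℕ) ≠ 2 by omega] at t0 t1 t2 t3
      rw [suffix_eq_cons (t := j * G.blk + (2 + 4 * k)) (hq _ (by omega)), add_assoc (j * G.blk) _ 1,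
        suffix_eq_cons (t := j * G.blk + (2 + 4 * k + 1)) (hq _ (by omega)),
        add_assoc (j * G.blk) _ 1,
        suffix_eq_cons (t := j * G.blk + (2 + 4 * k + 1 + 1)) (hq _ (by omega)),
        add_assoc (j * G.blk) _ 1,
        suffix_eq_cons (t := j * G.blk + (2 + 4 * k + 1 + 1 + 1)) (hq _ (by omega)),
        add_assoc (j * G.blk) _ 1]
      simp only [show 2 + 4 * k + 1 + 1 + 1 = 2 + 4 * k + 3 by ring,
        show 2 + 4 * k + 1 + 1 = 2 + 4 * k + 2 by ring]
      rw [t0, t1, t2, t3]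
      -- For a bit `1` of the row the bit of the block is `0`, and its flat wiggle is passed along
      -- the single edge from `u - 6` to `u + 6`, after subdividing the trajectory at these
      -- abscissas.
      by_cases ha : G.a y k = true
      · have hb : G.b j k = false := by
          have := hor k hkd; simp only [ha, true_and, Bool.not_eq_true] at this; exact this
        have hg : G.gap y k = 6 := by simp [gap, ha]
        rw [hg] at hodd heven IH
        simp only [hb, Bool.false_eq_true, if_false]
        have IH' := IH (16 * k + 10 + 6) (by simp) (by push_cast; omega)
        rw [suffix_eq_cons (hq _ (by omega)), hz2] at IH'
        rw [suffix_eq_cons (t := j * G.blk + (2 + 4 * k + 3 + 1)) (hq _ (by omega)), hz2]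
        have hpt : ∀ c : ℕ, c < G.width → G.toInstance.pt (y * G.width + c) =
            toPlane (G.X y c, (y : ℤ)) := by
          intro c hc
          have := idx_lt_core hy hc
          rw [pt_eq (by unfold numVerts; omega), pos, row_idx hy hc, col_idx hy hc]
        have hwig := Walks.wiggle (u := 16 * k + 10) (z := z) a1 (by omega : y ≤ G.n + 1)
          (by rw [hpt _ (by omega), hodd]) (by rw [hpt _ (by omega), heven]) (by omega) IH'
        exact Walks.of_subdivided (.inl ⟨mul_le_mul_of_nonneg_right (by omega) hU,
          mul_le_mul_of_nonneg_right (by omega) hU⟩)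
          (hwig.both a0 (dist_idx_le hy (by omega) he))
      · have hg : G.gap y k = 2 := by simp [gap, ha]
        rw [hg] at hodd heven IH
        have d1 : ∀ x : ℤ, |16 * k + 10 - 2 - x| ≤ 1 →
            dist (G.toInstance.pt (y * G.width + (2 * k + 1))) (axisPt (x * G.unit)) ≤ G.radius :=
          fun x hx => dist_idx_le hy (by omega) (by rw [hodd]; exact abs_unit hU hx)
        have d2 : ∀ x : ℤ, |16 * k + 10 + 2 - x| ≤ 1 →
            dist (G.toInstance.pt (y * G.width + (2 * k + 2))) (axisPt (x * G.unit)) ≤ G.radius :=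
          fun x hx => dist_idx_le hy (by omega) (by rw [heven]; exact abs_unit hU hx)
        have IH' := IH (16 * k + 10 + 3) (abs_unit hU (by rw [abs_le]; omega)) (by push_cast; omega)
        -- For a bit `0` of the row the walker goes back and forth between `u - 2` and `u + 2`;
        -- every wiggle point has distance one or three from `u`, hence one from the end on its
        -- side, whichever bit the block has.
        refine Walks.both a0 (dist_idx_le hy (by omega) he) (Walks.both a1 (d1 _ ?_)
          (Walks.both a1.symm (d2 _ ?_) (Walks.both a1 (d1 _ ?_) IH'))) <;>
        · rw [abs_le]; omega
  have h0 := key G.d le_rfl 0 (by omega) 0 (by simp [X_zero]) (by omega)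
  rw [suffix_eq_cons (hq 1 (by omega)), trajX_idx (by omega) (by omega) (block_lt hj (by omega)),
    wiggle_first _ (by omega)]
  exact h0

/-- From the end of a row, where the trajectory is at the end of a block, back to the beginning of
the row for the next block. -/
theorem Walks.around (hG : G.Good) {y j : ℕ} (hy : y < G.n + 2) (hj : j + 1 < G.m)
    (hw : G.Walks (y * G.width + 0) (G.suffix ((j + 1) * G.blk + 1))) :
    G.Walks (y * G.width + (2 * G.d + 1)) (G.suffix (j * G.blk + (2 + 4 * G.d))) := by
  have hU : (0 : ℤ) ≤ G.unit := by positivity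
  have hwd : G.width = 2 * G.d + 2 := rfl
  have hblk := hG.blk_ge
  have hq0 := idx_lt hj (show 0 < G.blk by omega)
  have hq1 := idx_lt hj (show 1 < G.blk by omega)
  have hb : (j + 1) * G.blk = j * G.blk + (G.blk - 1) + 1 := by rw [add_mul]; omega
  have t1 : G.trajX ((j + 1) * G.blk + 1) = 0 := by
    rw [trajX_idx (by omega) (by omega) (block_lt hj (by omega)), wiggle_first _ (by omega)]
  have t0 : G.trajX ((j + 1) * G.blk + 0) = 0 := by
    rw [trajX_idx (by omega) (by omega) (block_lt hj (by omega)), wiggle_first _ (by omega)]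
  have tend : ∀ s, j * G.blk + (2 + 4 * G.d) ≤ s → s < (j + 1) * G.blk →
      G.trajX s = 16 * G.d + 10 := by
    intro s h1 h2
    obtain ⟨r, rfl⟩ := Nat.exists_eq_add_of_le (show j * G.blk ≤ s by omega)
    exact trajX_end (by omega) (by omega) (by omega)
  have hX : G.X y (2 * G.d + 1 : ℕ) = (16 * G.d + 10) * G.unit := by
    rw [← X_last y]; push_cast; rfl
  rw [suffix_eq_cons hq1, t1, zero_mul] at hw
  have h1 := hw.right (x := axisPt 0) (dist_idx_le hy (by omega) (by simp [X_zero]))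
  have h2 := Walks.back hG hy h1 (2 * G.d + 1) (by omega)
  -- The walker waits out the constant end of the block and walks back only on the edge leading to
  -- the next block.
  refine Walks.stay (t := j * G.blk + (G.blk - 1)) (by omega) (by omega) (fun s s1 s2 => ?_) ?_
  · rw [tend s s1 (by omega)]
    exact dist_idx_le hy (by omega) (by rw [hX, sub_self, abs_zero]; exact hU)
  · rw [suffix_eq_cons (by omega), ← hb, tend _ (by omega) (by omega), ← add_zero ((j + 1) * G.blk),
      suffix_eq_cons hq0, t0, suffix_eq_cons (by omega), add_zero, t1, zero_mul, ← hX]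
    exact h2

/-- The end of the trajectory, in the last row. -/
theorem walks_last_row (hG : G.Good) : ∀ i j, j + i + 1 = G.m →
    G.Walks ((G.n + 1) * G.width + (2 * G.d + 1)) (G.suffix (j * G.blk + (2 + 4 * G.d))) := by
  have hU : (0 : ℤ) ≤ G.unit := by positivity
  have hwd : G.width = 2 * G.d + 2 := rfl
  have hblk := hG.blk_ge
  have hX : G.X (G.n + 1) (2 * G.d + 1 : ℕ) = (16 * G.d + 10) * G.unit := by
    rw [← X_last (G.n + 1)]; push_cast; rfl
  have hd : dist (G.toInstance.pt ((G.n + 1) * G.width + (2 * G.d + 1)))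
      (axisPt ((16 * G.d + 10) * G.unit)) ≤ G.radius :=
    dist_idx_le (by omega) (by omega) (by rw [hX, sub_self, abs_zero]; exact hU)
  intro i
  induction i with
  | zero =>
    intro j hj
    have hq : G.m * G.blk = j * G.blk + G.blk := by rw [← hj]; ring
    have tend : ∀ s, j * G.blk + (2 + 4 * G.d) ≤ s → s < G.m * G.blk - 1 →
        G.trajX s = 16 * G.d + 10 := by
      intro s h1 h2
      obtain ⟨r, rfl⟩ := Nat.exists_eq_add_of_le (show j * G.blk ≤ s by omega)
      exact trajX_end (by omega) (by omega) (by omega)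
    have hcore : G.core < G.numVerts := by unfold numVerts; omega
    have hlast : G.Walks G.core (G.suffix (G.m * G.blk - 1)) := by
      rw [suffix_eq_cons (by omega)]
      have : G.suffix (G.m * G.blk - 1 + 1) = [] := by
        unfold suffix
        rw [show G.m * G.blk - (G.m * G.blk - 1 + 1) = 0 by omega]; rfl
      rw [this, trajX_last hG]
      refine Walks.single (dist_pt_le hcore ?_)
      rw [col_core, X_far _ (by omega)]
      have : (16 * (G.d : ℤ) + 10) * G.unit + 3 * G.unit + (2 * G.d + 2 - 2 * G.d - 2) -
        (16 * G.d + 13) * G.unit = 0 := by ring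
      rw [this]; simp
    have hadj : G.Adj ((G.n + 1) * G.width + (2 * G.d + 1)) G.core := by
      rw [← core_sub_one]; exact .inl (mem_edges.2 (.inr (.inr (.inr (.inl rfl)))))
    refine Walks.stay (t := G.m * G.blk - 2) (by omega) (by omega) (fun s s1 s2 => ?_) ?_
    · rw [tend s s1 (by omega)]; exact hd
    · rw [suffix_eq_cons (by omega), tend _ (by omega) (by omega),
        show G.m * G.blk - 2 + 1 = G.m * G.blk - 1 by omega]
      rw [suffix_eq_cons (by omega)] at hlast ⊢
      exact hlast.both hadj hd
  | succ i ih =>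
    intro j hj
    exact Walks.around hG (by omega) (by omega) (Walks.sweep hG (by omega) (by omega)
      (fun k _ => by simp [hG.a_last k]) (ih (j + 1) (by omega)))

theorem opt_le_of_orthogonal (hG : G.Good) {y j : ℕ} (hy1 : 1 ≤ y) (hy : y ≤ G.n) (hj : j < G.m)
    (hor : ∀ k < G.d, ¬ (G.a y k = true ∧ G.b j k = true)) :
    G.toInstance.opt ≤ G.radius := by
  have hU : (0 : ℤ) ≤ G.unit := by positivity
  have hwd : G.width = 2 * G.d + 2 := rfl
  have hblk := hG.blk_ge
  have hpads := hG.pads_pos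
  -- down to row `y`
  have down : ∀ i, i + y ≤ G.n + 1 → G.Walks ((G.n + 1 - i) * G.width + (2 * G.d + 1))
      (G.suffix (j * G.blk + (2 + 4 * G.d))) := by
    intro i
    induction i with
    | zero => exact fun _ => walks_last_row hG (G.m - j - 1) j (by omega)
    | succ i ih =>
      intro hi
      have h := ih (by omega)
      rw [suffix_eq_cons (idx_lt hj (by omega)),
        trajX_end le_rfl (by omega) (block_lt hj (by omega))] at h ⊢
      refine h.left (.inl (mem_edges.2 (.inr (.inr (.inl ⟨G.n - (i + 1), by omega, ?_⟩)))))
        (dist_idx_le (by omega) (by omega) ?_)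
      · rw [show G.n + 1 - (i + 1) = G.n - (i + 1) + 1 by omega,
          show G.n + 1 - i = G.n - (i + 1) + 2 by omega]
      · have : G.X (G.n + 1 - (i + 1)) (2 * G.d + 1 : ℕ) = (16 * G.d + 10) * G.unit := by
          rw [← X_last (G.n + 1 - (i + 1))]; push_cast; rfl
        rw [this, sub_self, abs_zero]; exact hU
  have hrow := down (G.n + 1 - y) (by omega)
  rw [show G.n + 1 - (G.n + 1 - y) = y by omega] at hrow
  have hsweep := Walks.sweep hG (by omega) hj hor hrow
  -- down to row `0`
  have down0 : ∀ i ≤ y, G.Walks ((y - i) * G.width + 0) (G.suffix (j * G.blk + 1)) := by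
    intro i
    induction i with
    | zero => exact fun _ => hsweep
    | succ i ih =>
      intro hi
      have h := ih (by omega)
      rw [suffix_eq_cons (idx_lt hj (by omega)),
        trajX_idx (by omega) (by omega) (block_lt hj (by omega)), wiggle_first _ (by omega)] at h ⊢
      refine h.left (.inl (mem_edges.2 (.inr (.inl ⟨y - (i + 1), by omega, ?_⟩))))
        (dist_idx_le (by omega) (by omega) ?_)
      · rw [show y - i = y - (i + 1) + 1 by omega]
      · rw [Nat.cast_zero, X_zero]; simp
  -- the blocks before block `j`
  have first : ∀ i ≤ j, G.Walks (0 * G.width + 0) (G.suffix ((j - i) * G.blk + 1)) := by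
    intro i
    induction i with
    | zero => intro _; simpa using down0 y le_rfl
    | succ i ih =>
      intro hi
      have h := ih (by omega)
      rw [show j - i = j - (i + 1) + 1 by omega] at h
      exact Walks.sweep hG (by omega) (by omega) (fun k _ => by simp [hG.a_first k])
        (Walks.around hG (by omega) (by omega) h)
  have h := first j le_rfl
  have hq := idx_lt hj (show 1 < G.blk by omega)
  have hpad : G.core + 1 + 0 < G.numVerts := by unfold numVerts; omega
  refine opt_le hG hpad ?_
  rw [suffix_eq_cons (by omega), trajX_zero]
  rw [Nat.sub_self, zero_mul, zero_add, suffix_eq_cons (by omega), zero_mul] at h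
  rw [zero_add, suffix_eq_cons (by omega)]
  refine h.both (.inr (mem_edges.2 (.inr (.inr (.inr (.inr (.inl rfl))))))) (dist_pt_le hpad ?_)
  rw [col_pad, X_neg _ (by omega)]
  rw [abs_le]
  push_cast
  omega

end Gadget

namespace RAM

/-! ### Loops and budgets -/

/-- The time of a program is bounded by its budget, multiplied by the numbers of rounds of nested
loops. -/
def Prog.budget : Prog → ℕ
  | .skip => 1
  | .store a v => a.units + v.units + 1
  | .seq c₁ c₂ => c₁.budget + c₂.budget + 1
  | .ite e c₁ c₂ => e.units + c₁.budget + c₂.budget + 1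
  | .loop e c => 3 * (e.units + c.budget) + 10

theorem Prog.units_le_budget (c : Prog) : c.units ≤ c.budget := by
  induction c with
  | skip => exact le_rfl
  | store a v => exact le_rfl
  | seq c₁ c₂ h₁ h₂ => simp only [units, budget]; omega
  | ite e c₁ c₂ h₁ h₂ => simp only [units, budget]; omega
  | loop e c h => simp only [units, budget]; omega

/-- Separates the constant that depends on the program text from the factor `S` that depends on the
input, so that only `S` has to be tracked. -/
def WPB (X : ℕ) (inp : List ℤ) (S : ℕ) (c : Prog) (Q : (ℕ → ℤ) → List ℤ → Prop) (σ : ℕ → ℤ)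
    (l : List ℤ) : Prop :=
  WP X inp c (c.budget * S) Q σ l

section WPB

variable {X : ℕ} {inp : List ℤ} {σ : ℕ → ℤ} {l : List ℤ} {Q : (ℕ → ℤ) → List ℤ → Prop} {S : ℕ}

theorem WPB.mono {c : Prog} {S' : ℕ} {Q' : (ℕ → ℤ) → List ℤ → Prop} (h : WPB X inp S c Q σ l)
    (hS : S ≤ S') (hQ : ∀ σ' l', Q σ' l' → Q' σ' l') : WPB X inp S' c Q' σ l :=
  WP.mono h (Nat.mul_le_mul_left _ hS) hQ

theorem wpb_of_units {c : Prog} (hS : 1 ≤ S) (h : WP X inp c c.units Q σ l) :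
    WPB X inp S c Q σ l :=
  h.mono (c.units_le_budget.trans (Nat.le_mul_of_pos_right _ hS)) fun _ _ h => h

theorem wpb_seq {c₁ c₂ : Prog} (hS : 1 ≤ S) (h : WPB X inp S c₁ (WPB X inp S c₂ Q) σ l) :
    WPB X inp S (.seq c₁ c₂) Q σ l := by
  refine (wp_seq h).mono ?_ fun _ _ h => h
  simp only [Prog.budget, add_mul]; omega

/-- Overhead arises in each round and once more for the initialization and the final test. Charged
to `S * R` this is twice `forUnits`, which the budget of a loop absorbs because resetting the
counter costs no more than incrementing it. -/
theorem wpb_for {i : ℕ} {e : SExpr} {c : Prog} {N R : ℕ}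
    (Inv : ℕ → (ℕ → ℤ) → List ℤ → Prop) (hS : 1 ≤ S) (hR : 1 ≤ R) (hNR : N ≤ R)
    (hi : i ≠ 0) (hX : N ≤ X) (h0 : Inv 0 (Function.update σ i 0) l)
    (hN : ∀ j ≤ N, ∀ σ l, Inv j σ l → e.Safe inp σ ∧ e.eval inp σ = N ∧ σ i = j)
    (hc : ∀ j < N, ∀ σ l, Inv j σ l → WPB X inp S c
      (fun σ' l' => σ' i = j ∧ Inv (j + 1) (Function.update σ' i ((j + 1 : ℕ) : ℤ)) l') σ l)
    (hQ : ∀ σ l, Inv N σ l → Q σ l) :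
    WPB X inp (S * R) (.for i e c) Q σ l := by
  refine (wp_for Inv hi hX h0 hN hc hQ).mono ?_ fun _ _ h => h
  have hu : (Prog.set i (.lit 0)).units ≤ (Prog.set i (.add (.var i) (.lit 1))).units := by
    simp only [Prog.set, Prog.units, SExpr.compile, Expr.units, Expr.weight]
    have : bitLen 0 ≤ bitLen 1 := by decide
    omega
  have hb : c.budget + 2 * Prog.forUnits i e ≤ (Prog.for i e c).budget := by
    simp only [Prog.for, Prog.forUnits, Prog.budget]
    have h1 := (Prog.set i (.lit 0)).units_le_budget
    have h2 := (Prog.set i (.add (.var i) (.lit 1))).units_le_budget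
    omega
  calc N * (c.budget * S + Prog.forUnits i e) + Prog.forUnits i e
      ≤ R * (c.budget * S + Prog.forUnits i e * S) + Prog.forUnits i e * (S * R) := by
        refine Nat.add_le_add (Nat.mul_le_mul hNR (Nat.add_le_add_left ?_ _)) ?_
        · exact Nat.le_mul_of_pos_right _ hS
        · exact Nat.le_mul_of_pos_right _ (Nat.mul_pos hS hR)
    _ = (c.budget + 2 * Prog.forUnits i e) * (S * R) := by ring
    _ ≤ _ := Nat.mul_le_mul_right _ hb

/-- The variables `1, …, n` have the values `c`. -/
def Agree (n : ℕ) (c σ : ℕ → ℤ) : Prop := ∀ i, 1 ≤ i → i ≤ n → σ i = c i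

theorem Agree.update {n : ℕ} {c : ℕ → ℤ} (h : Agree n c σ) {i : ℕ} (hi : i = 0 ∨ n < i) (v : ℤ) :
    Agree n c (Function.update σ i v) := fun j h1 h2 => by
  rw [Function.update_of_ne (by omega)]; exact h j h1 h2

end WPB

/-! ### Specifying generators by lists of variable values -/

namespace SExpr

/-- All variables lie between `1` and `n`. -/
def Below (n : ℕ) : SExpr → Prop
  | .lit _ => True
  | .var i => 1 ≤ i ∧ i ≤ n
  | .inp a => a.Below n
  | .add a b => a.Below n ∧ b.Below n
  | .sub a b => a.Below n ∧ b.Below n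
  | .mul a b => a.Below n ∧ b.Below n
  | .div a b => a.Below n ∧ b.Below n

theorem below_pow {n : ℕ} {e : SExpr} (h : e.Below n) (k : ℕ) : (e.pow k).Below n := by
  induction k with
  | zero => trivial
  | succ k ih => exact ⟨ih, h⟩

theorem eval_congr {n : ℕ} {inp : List ℤ} {c σ : ℕ → ℤ} (hσ : Agree n c σ) {e : SExpr}
    (he : e.Below n) : e.eval inp σ = e.eval inp c := by
  induction e with
  | lit z => rfl
  | var i => exact hσ i he.1 he.2
  | inp a iha => simp only [eval, iha he]
  | add a b iha ihb => simp only [eval, iha he.1, ihb he.2]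
  | sub a b iha ihb => simp only [eval, iha he.1, ihb he.2]
  | mul a b iha ihb => simp only [eval, iha he.1, ihb he.2]
  | div a b iha ihb => simp only [eval, iha he.1, ihb he.2]

theorem safe_congr {n : ℕ} {inp : List ℤ} {c σ : ℕ → ℤ} (hσ : Agree n c σ) {e : SExpr}
    (he : e.Below n) (h : e.Safe inp c) : e.Safe inp σ := by
  induction e with
  | lit z => trivial
  | var i => trivial
  | inp a iha => exact ⟨by rw [eval_congr (e := a) hσ he]; exact h.1, iha he h.2⟩
  | add a b iha ihb => exact ⟨iha he.1 h.1, ihb he.2 h.2⟩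
  | sub a b iha ihb => exact ⟨iha he.1 h.1, ihb he.2 h.2⟩
  | mul a b iha ihb => exact ⟨iha he.1 h.1, ihb he.2 h.2⟩
  | div a b iha ihb => exact ⟨iha he.1 h.1, ihb he.2 h.2⟩

end SExpr

/-- The variables `1, 2, …` have the values in the list `L`. -/
def env (L : List ℤ) (i : ℕ) : ℤ := L.getD (i - 1) 0

/-- Given the values `L` of the variables `1, 2, …`, the expression has the value `a`. -/
structure Value (inp L : List ℤ) (e : SExpr) (a : ℤ) : Prop where
  below : e.Below L.length
  safe : e.Safe inp (env L)
  eval : e.eval inp (env L) = a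

/-- Started with the values `L` of the variables `1, 2, …`, the program `c` appends `f` to the
generated list and arrives at the values `L'`. -/
def Steps (X : ℕ) (inp : List ℤ) (S : ℕ) (L : List ℤ) (c : Prog) (L' f : List ℤ) : Prop :=
  1 ≤ S → ∀ σ l, Agree L.length (env L) σ → l.length + f.length ≤ X →
    WPB X inp S c (fun σ' l' => Agree L'.length (env L') σ' ∧ l' = l ++ f) σ l

section Steps

variable {X : ℕ} {inp : List ℤ} {S : ℕ} {L L' L'' f g : List ℤ}

theorem Steps.mono {c : Prog} {S' : ℕ} (h : Steps X inp S L c L' f) (hS : 1 ≤ S) (hS' : S ≤ S') :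
    Steps X inp S' L c L' f :=
  fun _ σ l h1 h2 => (h hS σ l h1 h2).mono hS' fun _ _ h => h

theorem Steps.seq {c₁ c₂ : Prog} (h₁ : Steps X inp S L c₁ L' f) (h₂ : Steps X inp S L' c₂ L'' g) :
    Steps X inp S L (.seq c₁ c₂) L'' (f ++ g) := by
  intro hS σ l h1 h2
  rw [List.length_append] at h2
  refine wpb_seq hS ((h₁ hS σ l h1 (by omega)).mono le_rfl ?_)
  rintro σ' l' ⟨h3, rfl⟩
  refine (h₂ hS σ' _ h3 (by rw [List.length_append]; omega)).mono le_rfl ?_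
  rintro σ'' l' ⟨h4, rfl⟩
  exact ⟨h4, by simp⟩

theorem agree_of_append {E : List ℤ} {σ : ℕ → ℤ}
    (h : Agree (L ++ E).length (env (L ++ E)) σ) : Agree L.length (env L) σ := by
  intro i h1 h2
  rw [h i h1 (by rw [List.length_append]; omega)]
  unfold env
  rw [List.getD_append _ _ _ _ (by omega)]

/-- Local variables stand at the end of the list of values and are forgotten after use. -/
theorem Steps.drop {c : Prog} {E : List ℤ} (h : Steps X inp S L c (L' ++ E) f) :
    Steps X inp S L c L' f := fun hS σ l h1 h2 =>
  (h hS σ l h1 h2).mono le_rfl fun _ _ h => ⟨agree_of_append h.1, h.2⟩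

theorem Steps.skip (hf : f = []) : Steps X inp S L .skip L f := by
  rintro hS σ l h1 -
  exact wpb_of_units hS (wp_skip ⟨h1, by simp [hf]⟩)

theorem Steps.set {i : ℕ} {e : SExpr} {a : ℤ} (hi : i = L.length + 1) (h : Value inp L e a)
    (ha : |a| ≤ X) : Steps X inp S L (.set i e) (L ++ [a]) [] := by
  rintro hS σ l h1 -
  have he : e.eval inp σ = a := (SExpr.eval_congr h1 h.below).trans h.eval
  refine wpb_of_units hS (wp_set (by omega) (SExpr.safe_congr h1 h.below h.safe)
    (by rwa [he]) ⟨?_, by simp⟩)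
  intro j h2 h3
  simp only [List.length_append, List.length_singleton] at h3
  rw [he, hi]
  unfold env
  rcases h3.lt_or_eq with h4 | rfl
  · rw [Function.update_of_ne (by omega), h1 j h2 (by omega), List.getD_append _ _ _ _ (by omega)]
    rfl
  · simp

theorem Steps.assign {k : ℕ} {e : SExpr} {a : ℤ} (h : Value inp L e a)
    (ha : |a| ≤ X) : Steps X inp S L (.set (k + 1) e) (L.set k a) [] := by
  rintro hS σ l h1 -
  have he : e.eval inp σ = a := (SExpr.eval_congr h1 h.below).trans h.eval
  refine wpb_of_units hS (wp_set (by omega) (SExpr.safe_congr h1 h.below h.safe)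
    (by rwa [he]) ⟨?_, by simp⟩)
  intro j h2 h3
  simp only [List.length_set] at h3
  rw [he]
  unfold env
  rw [List.getD_eq_getElem _ _ (by rw [List.length_set]; omega), List.getElem_set]
  split_ifs with h4
  · rw [show j = k + 1 by omega, Function.update_self]
  · rw [Function.update_of_ne (by omega), h1 j h2 (by omega)]
    unfold env
    rw [List.getD_eq_getElem]

theorem Steps.emit {e : SExpr} {a : ℤ} (h : Value inp L e a) (ha : |a| ≤ X) :
    Steps X inp S L (.emit e) L [a] := by
  rintro hS σ l h1 h2
  have he : e.eval inp σ = a := (SExpr.eval_congr h1 h.below).trans h.eval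
  exact wpb_of_units hS (wp_emit (SExpr.safe_congr h1 h.below h.safe) (by rwa [he]) h2
    ⟨h1.update (.inl rfl) _, by rw [he]⟩)

theorem Steps.cond {e : SExpr} {c₁ c₂ : Prog} {a : ℤ} (h : Value inp L e a)
    (h₁ : 0 < a → Steps X inp S L c₁ L' f) (h₂ : ¬ 0 < a → Steps X inp S L c₂ L' f) :
    Steps X inp S L (.cond e c₁ c₂) L' f := by
  rintro hS σ l h1 h2
  have he : e.eval inp σ = a := (SExpr.eval_congr h1 h.below).trans h.eval
  intro M hM
  have hs := SExpr.safe_congr h1 h.below h.safe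
  have hc := hM.cost_le e.compile
  have hX := one_le_bitLen X
  have hu : e.compile.units * bitLen X ≤ e.compile.units * S * bitLen X :=
    Nat.mul_le_mul_right _ (Nat.le_mul_of_pos_right _ hS)
  have hv : 1 ≤ S * bitLen X := Nat.mul_pos hS hX
  by_cases h0 : 0 < a
  · obtain ⟨t, M', σ', l', r, ht, hM', hq⟩ := h₁ h0 hS σ l h1 h2 M hM
    refine ⟨_, M', σ', l', .ite_pos (by rwa [hM.eval_compile hs, he]) r, ?_, hM', hq⟩
    have : 0 ≤ c₂.budget * S * bitLen X := Nat.zero_le _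
    simp only [Prog.cond, Prog.budget, add_mul, one_mul] at *; omega
  · obtain ⟨t, M', σ', l', r, ht, hM', hq⟩ := h₂ h0 hS σ l h1 h2 M hM
    refine ⟨_, M', σ', l', .ite_neg (by rwa [hM.eval_compile hs, he]) r, ?_, hM', hq⟩
    have : 0 ≤ c₁.budget * S * bitLen X := Nat.zero_le _
    simp only [Prog.cond, Prog.budget, add_mul, one_mul] at *; omega

theorem agree_append_singleton {a : ℤ} {σ : ℕ → ℤ} (h : Agree L.length (env L) σ)
    (ha : σ (L.length + 1) = a) : Agree (L ++ [a]).length (env (L ++ [a])) σ := by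
  intro j h2 h3
  simp only [List.length_append, List.length_singleton] at h3
  unfold env
  rcases h3.lt_or_eq with h4 | rfl
  · rw [h j h2 (by omega), List.getD_append _ _ _ _ (by omega)]
    rfl
  · simpa using ha

/-- A loop whose round `j` leads from the values `G j` to the values `G (j + 1)` and appends
`f j` to the generated list. -/
theorem Steps.for {i : ℕ} {e : SExpr} {c : Prog} {N R n : ℕ} (G : ℕ → List ℤ) (f : ℕ → List ℤ)
    (hlen : ∀ j, (G j).length = n) (hi : i = n + 1) (hNR : N ≤ R) (hX : N ≤ X)
    (hN : ∀ j ≤ N, Value inp (G j) e N)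
    (hc : ∀ j < N, Steps X inp S (G j ++ [(j : ℤ)]) c (G (j + 1) ++ [(j : ℤ)]) (f j)) :
    Steps X inp (S * R) (G 0) (.for i e c) (G N) ((List.range N).flatMap f) := by
  rintro hSR σ l h1 hl
  have hS : 1 ≤ S := Nat.pos_of_mul_pos_right hSR
  have hR : 1 ≤ R := Nat.pos_of_mul_pos_left hSR
  refine wpb_for (fun j σ l' => (Agree n (env (G j)) σ ∧ σ i = j) ∧
    l' = l ++ (List.range j).flatMap f) hS hR hNR (by omega) hX ?_ ?_ ?_ ?_
  · rw [hlen] at h1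
    exact ⟨⟨h1.update (.inr (by omega)) _, by simp⟩, by simp⟩
  · rintro j hj σ l ⟨⟨h1, h2⟩, -⟩
    have hv := hN j hj
    have hb := hv.below
    rw [hlen] at hb
    exact ⟨SExpr.safe_congr h1 hb hv.safe, (SExpr.eval_congr h1 hb).trans hv.eval, h2⟩
  · rintro j hj σ l' ⟨⟨h1, h2⟩, rfl⟩
    refine (hc j hj hS σ _ (agree_append_singleton (by rwa [hlen]) (by rw [hlen, ← hi, h2])) ?_).mono
      le_rfl ?_
    -- The output of the first `j + 1` rounds is part of the whole output, so round `j` has enough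
    -- room.
    · obtain ⟨r, rfl⟩ := Nat.exists_eq_add_of_lt hj
      rw [show j + r + 1 = j + (1 + r) by ring, List.range_add, List.flatMap_append,
        List.length_append, List.range_add, List.map_append, List.flatMap_append,
        List.length_append] at hl
      simp at hl
      simp
      omega
    · rintro σ' l'' ⟨h3, rfl⟩
      have h4 := agree_of_append h3
      rw [hlen] at h4
      refine ⟨?_, ⟨h4.update (.inr (by omega)) _, by simp⟩, ?_⟩
      · rw [h3 i (by omega) (by simp [hlen, hi])]
        simp [env, hi, hlen]
      · simp [List.range_succ]
  · rintro σ l' ⟨⟨h1, -⟩, rfl⟩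
    exact ⟨by rwa [hlen], rfl⟩

/-- A loop that does not change the variables outside. -/
theorem Steps.for_const {i : ℕ} {e : SExpr} {c : Prog} {N R : ℕ} (f : ℕ → List ℤ)
    (hi : i = L.length + 1) (hNR : N ≤ R) (hX : N ≤ X) (hN : Value inp L e N)
    (hc : ∀ j < N, Steps X inp S (L ++ [(j : ℤ)]) c (L ++ [(j : ℤ)]) (f j)) :
    Steps X inp (S * R) L (.for i e c) L ((List.range N).flatMap f) :=
  Steps.for (fun _ => L) f (fun _ => rfl) hi hNR hX (fun _ _ => hN) hc

end Steps

end RAM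

/-! ### Reading the input of an instance of OV -/

theorem rowMajor_length {n d : ℕ} (A : Fin n → Fin d → ℤ) : (rowMajor A).length = n * d := by
  simp [rowMajor]

theorem rowMajor_getD {n d : ℕ} (A : Fin n → Fin d → ℤ) (i : Fin n) (k : Fin d) :
    (rowMajor A).getD (i * d + k) 0 = A i k := by
  have h : (i : ℕ) * d + k < n * d := by
    calc (i : ℕ) * d + k < (i + 1) * d := by rw [add_mul]; omega
      _ ≤ _ := Nat.mul_le_mul_right _ i.2
  rw [List.getD_eq_getElem _ _ (by rwa [rowMajor_length])]
  simp only [rowMajor, List.getElem_ofFn]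
  have hd : 0 < d := k.pos
  congr 1
  · ext
    simp [Fin.divNat, Nat.mul_comm _ d, Nat.mul_add_div hd, Nat.div_eq_of_lt k.2]
  · ext
    simp [Fin.modNat, Nat.mul_comm _ d, Nat.mod_eq_of_lt k.2]

namespace OVInstance

variable (x : OVInstance)

/-- The entries of the first matrix, extended by `false`. -/
def entryA (y k : ℕ) : Bool := if h : y < x.n ∧ k < x.d then x.A ⟨y, h.1⟩ ⟨k, h.2⟩ else false

/-- The entries of the second matrix, extended by `false`. -/
def entryB (j k : ℕ) : Bool := if h : j < x.m ∧ k < x.d then x.B ⟨j, h.1⟩ ⟨k, h.2⟩ else false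

theorem hasOrthogonalPair_iff : x.HasOrthogonalPair ↔
    ∃ y j, y < x.n ∧ j < x.m ∧ ∀ k < x.d, ¬ (x.entryA y k = true ∧ x.entryB j k = true) := by
  constructor
  · rintro ⟨i, j, h⟩
    refine ⟨i, j, i.2, j.2, fun k hk => ?_⟩
    have := h ⟨k, hk⟩
    simp only [entryA, entryB, i.2, j.2, hk, and_self, dite_true, Fin.eta]
    rintro ⟨h1, h2⟩
    simp [h1, h2] at this
  · rintro ⟨y, j, hy, hj, h⟩
    refine ⟨⟨y, hy⟩, ⟨j, hj⟩, fun k => ?_⟩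
    have := h k k.2
    simp only [entryA, entryB, hy, hj, k.2, and_self, dite_true, Fin.eta] at this
    by_cases hA : x.A ⟨y, hy⟩ k = true
    · right; simpa [hA] using this
    · left; simpa using hA

theorem encode_length : x.encode.length = 3 + x.n * x.d + x.m * x.d := by
  simp [encode, rowMajor_length]; ring

theorem init_encode_zero : RAM.init x.encode 0 = x.n := by simp [RAM.init, encode]

theorem init_encode_one : RAM.init x.encode 1 = x.m := by simp [RAM.init, encode]

theorem init_encode_two : RAM.init x.encode 2 = x.d := by simp [RAM.init, encode]

theorem init_encode_A {y k : ℕ} (hy : y < x.n) (hk : k < x.d) :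
    RAM.init x.encode (3 + y * x.d + k) = if x.entryA y k then 1 else 0 := by
  have h : y * x.d + k < x.n * x.d := by
    calc y * x.d + k < (y + 1) * x.d := by rw [add_mul]; omega
      _ ≤ _ := Nat.mul_le_mul_right _ hy
  unfold RAM.init
  rw [if_pos (by positivity), show (3 + (y : ℤ) * x.d + k).toNat = y * x.d + k + 3 by
    have : (3 + (y : ℤ) * x.d + k) = ((y * x.d + k + 3 : ℕ) : ℤ) := by push_cast; ring
    rw [this, Int.toNat_natCast], encode, List.append_assoc,
    List.getD_append_right _ _ _ _ (by simp), List.getD_append _ _ _ _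
      (by simp [rowMajor_length]; omega)]
  have := rowMajor_getD (fun i k => if x.A i k then (1 : ℤ) else 0) ⟨y, hy⟩ ⟨k, hk⟩
  simp only [entryA, hy, hk, and_self, dite_true]
  simpa using this

theorem init_encode_B {j k : ℕ} (hj : j < x.m) (hk : k < x.d) :
    RAM.init x.encode (3 + x.n * x.d + j * x.d + k) = if x.entryB j k then 1 else 0 := by
  unfold RAM.init
  rw [if_pos (by positivity), show (3 + (x.n : ℤ) * x.d + j * x.d + k).toNat =
      x.n * x.d + (j * x.d + k) + 3 by
    have : (3 + (x.n : ℤ) * x.d + j * x.d + k) = ((x.n * x.d + (j * x.d + k) + 3 : ℕ) : ℤ) := by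
      push_cast; ring
    rw [this, Int.toNat_natCast], encode, List.append_assoc,
    List.getD_append_right _ _ _ _ (by simp), List.getD_append_right _ _ _ _
      (by simp [rowMajor_length])]
  have := rowMajor_getD (fun i k => if x.B i k then (1 : ℤ) else 0) ⟨j, hj⟩ ⟨k, hk⟩
  simp only [entryB, hj, hk, and_self, dite_true]
  simpa [rowMajor_length] using this

theorem mem_encode {z : ℤ} (hz : z ∈ x.encode) : z = x.n ∨ z = x.m ∨ z = x.d ∨ z = 0 ∨ z = 1 := by
  simp only [encode, rowMajor, List.mem_append, List.mem_cons, List.not_mem_nil, or_false,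
    List.mem_ofFn] at hz
  rcases hz with (h | ⟨t, rfl⟩) | ⟨t, rfl⟩
  · tauto
  · split_ifs <;> simp
  · split_ifs <;> simp

/-! ### The instance of map matching -/

/-- The size parameters are chosen such that the complexity of the graph is
`n * (1001 * (2 * d + 1) ^ s)` and that of the trajectory is `m * (4 * (2 * d + 1) ^ r)`. -/
def gadget (r s : ℕ) : Gadget where
  n := x.n
  m := x.m
  d := x.d
  pads := x.n * ((1001 * (2 * x.d + 1) ^ s - 1) / 2 - 2 * x.d - 2) - 4 * (x.d + 1)
  blk := 4 * (2 * x.d + 1) ^ r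
  unit := 10000 * x.n
  a y k := if 1 ≤ y ∧ y ≤ x.n then x.entryA (y - 1) k else false
  b := x.entryB

variable {x} {r s : ℕ}

/-- Each further pad adds a vertex and an edge, so padding changes the complexity by even numbers
only, and without it the complexity has the parity of `n`. An odd multiple of `n` can therefore be
hit exactly; the factor `1001` leaves room for the graph itself. -/
theorem gadget_aux (hs : 1 ≤ s) : ∃ h, 1001 * (2 * x.d + 1) ^ s = 2 * h + 1 ∧
    (1001 * (2 * x.d + 1) ^ s - 1) / 2 = h ∧ 500 + 1000 * x.d ≤ h := by
  have hodd : Odd (1001 * (2 * x.d + 1) ^ s) := by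
    refine Nat.odd_mul.2 ⟨by decide, Odd.pow ⟨x.d, rfl⟩⟩
  obtain ⟨h, hh⟩ := hodd
  have : 2 * x.d + 1 ≤ (2 * x.d + 1) ^ s := Nat.le_self_pow (by omega) _
  exact ⟨h, hh, by omega, by omega⟩

/-- As `h` is at least `500 + 1000 * d`, none of the natural subtractions in the number of pads is
truncated, and the integer formula evaluated by the program agrees with it. -/
theorem pads_add (hn : 0 < x.n) (hs : 1 ≤ s) : ∃ h, 1001 * (2 * x.d + 1) ^ s = 2 * h + 1 ∧
    (x.gadget r s).pads + 4 * (x.d + 1) + x.n * (2 * x.d + 2) = x.n * h ∧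
    (x.gadget r s).pads = x.n * ((h : ℤ) - 2 * x.d - 2) - 4 * (x.d + 1) ∧
    1 ≤ (x.gadget r s).pads := by
  obtain ⟨h, h1, h2, h3⟩ := gadget_aux (x := x) hs
  refine ⟨h, h1, ?_⟩
  have h4 : (x.gadget r s).pads = x.n * (h - 2 * x.d - 2) - 4 * (x.d + 1) := by
    simp only [gadget]; rw [h2]
  clear h1 h2
  obtain ⟨g, rfl⟩ : ∃ g, h = g + (2 * x.d + 2) := ⟨h - (2 * x.d + 2), by omega⟩
  rw [show g + (2 * x.d + 2) - 2 * x.d - 2 = g by omega] at h4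
  have h5 : 4 * (x.d + 1) + 1 ≤ x.n * g := by
    calc 4 * (x.d + 1) + 1 ≤ 1 * g := by omega
      _ ≤ _ := Nat.mul_le_mul_right _ hn
  rw [h4]
  refine ⟨?_, ?_, by omega⟩
  · rw [mul_add x.n g]; omega
  · push_cast [Nat.cast_sub (show 4 * (x.d + 1) ≤ x.n * g by omega)]; ring

theorem gadget_good (hn : 0 < x.n) (hm : 0 < x.m) (hr : 1 ≤ r) (hs : 1 ≤ s) :
    (x.gadget r s).Good where
  n_pos := hn
  m_pos := hm
  unit_pos := by simp only [gadget]; omega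
  pads_pos := by obtain ⟨_, _, _, _, h⟩ := pads_add (r := r) hn hs; exact h
  blk_ge := by
    simp only [gadget]
    have : 2 * x.d + 1 ≤ (2 * x.d + 1) ^ r := Nat.le_self_pow (by omega) _
    rcases Nat.eq_zero_or_pos x.d with h | h
    · simp [h]
    · omega
  a_first k := by simp [gadget]
  a_last k := by simp [gadget]

theorem p_gadget (hn : 0 < x.n) (hs : 1 ≤ s) :
    (x.gadget r s).toInstance.p = x.n * (1001 * (2 * x.d + 1) ^ s) := by
  obtain ⟨h, h1, h2, -, h3⟩ := pads_add (r := r) hn hs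
  rw [Gadget.p_toInstance, h1, Gadget.numVerts, Gadget.numEdges, Gadget.core, Gadget.width]
  simp only [show (x.gadget r s).n = x.n from rfl, show (x.gadget r s).d = x.d from rfl]
  generalize (x.gadget r s).pads = P at *
  have : 2 * P + 8 * (x.d + 1) + 2 * (x.n * (2 * x.d + 2)) = 2 * (x.n * h) := by omega
  obtain ⟨P, rfl⟩ : ∃ P', P = P' + 1 := ⟨P - 1, by omega⟩
  simp only [Nat.add_sub_cancel]
  nlinarith

theorem q_gadget : (x.gadget r s).toInstance.q = x.m * (4 * (2 * x.d + 1) ^ r) :=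
  Gadget.q_toInstance _

theorem gadget_opt_ge (hn : 0 < x.n) (hm : 0 < x.m) (hr : 1 ≤ r) (hs : 1 ≤ s)
    (h : ¬ x.HasOrthogonalPair) :
    3 * (10000 * (x.n : ℝ)) ≤ (x.gadget r s).toInstance.opt := by
  rw [hasOrthogonalPair_iff] at h
  -- In dimension `0` all pairs are orthogonal.
  have hd : 1 ≤ x.d := by
    by_contra h0
    exact h ⟨0, 0, hn, hm, fun k hk => by omega⟩
  have := (x.gadget r s).le_opt (gadget_good hn hm hr hs) hd ?_
  · simpa [gadget] using this
  · rintro ⟨y, j, hy, hy', hj, hk⟩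
    refine h ⟨y - 1, j, ?_, hj, fun k hk' => ?_⟩
    · simp only [gadget] at hy'; omega
    · have := hk k hk'
      simpa [gadget, hy, show y ≤ x.n from hy'] using this

theorem gadget_opt_le (hn : 0 < x.n) (hm : 0 < x.m) (hr : 1 ≤ r) (hs : 1 ≤ s)
    (h : x.HasOrthogonalPair) : (x.gadget r s).toInstance.opt ≤ 10000 * (x.n : ℝ) + x.n + 1 := by
  rw [hasOrthogonalPair_iff] at h
  obtain ⟨y, j, hy, hj, hk⟩ := h
  have := (x.gadget r s).opt_le_of_orthogonal (gadget_good hn hm hr hs) (y := y + 1) (j := j)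
    (by omega) hy hj fun k hk' => by
      have := hk k hk'
      simpa [gadget, show y + 1 ≤ x.n from hy] using this
  simpa [Gadget.radius, gadget] using this

theorem _root_.Gadget.abs_pos_le {G : Gadget} (hG : G.Good) {v : ℕ} (hv : v < G.numVerts) :
    |(G.pos v).1| ≤ (16 * G.d + 13) * G.unit + G.pads ∧ |(G.pos v).2| ≤ G.n + 1 := by
  have hU : (0 : ℤ) ≤ G.unit := by positivity
  have hP : (0 : ℤ) ≤ G.pads := by positivity
  have hd : (0 : ℤ) ≤ G.d := by positivity
  have hdU : 0 ≤ (G.d : ℤ) * G.unit := mul_nonneg hd hU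
  constructor
  · have hc : -(G.pads : ℤ) ≤ G.col v ∧ G.col v ≤ 2 * G.d + 2 := by
      rcases Gadget.vertex_cases hv with ⟨y, c, hy, hc, rfl⟩ | rfl | ⟨i, hi, rfl⟩
      · rw [Gadget.col_idx hy hc]
        have : G.width = 2 * G.d + 2 := rfl
        omega
      · rw [Gadget.col_core]; omega
      · rw [Gadget.col_pad]; omega
    have hp := hG.pads_pos
    have h1 := (Gadget.strictMono_X hG (G.row v)).monotone hc.1
    have h2 := (Gadget.strictMono_X hG (G.row v)).monotone hc.2
    rw [Gadget.X_neg _ (by omega)] at h1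
    rw [Gadget.X_far _ (c := 2 * G.d + 2) (by omega)] at h2
    simp only [Gadget.pos]
    rw [abs_le]
    constructor <;> nlinarith
  · simp only [Gadget.pos, Nat.abs_cast]
    exact_mod_cast Gadget.row_le hv

theorem _root_.Gadget.abs_traj_le (G : Gadget) (t : ℕ) :
    |G.trajX t * G.unit| ≤ (16 * G.d + 13) * G.unit := by
  have hU : (0 : ℤ) ≤ G.unit := by positivity
  rw [abs_mul, abs_of_nonneg hU]
  refine mul_le_mul_of_nonneg_right ?_ hU
  unfold Gadget.trajX
  split_ifs
  · rw [abs_le]; constructor <;> omega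
  · rw [abs_le]; constructor <;> omega
  · generalize t / G.blk = j
    generalize t % G.blk = r
    rw [abs_le]
    rcases Gadget.index_cases G.d r with h | ⟨k, s, hk, hs, rfl⟩ | h
    · rw [Gadget.wiggle_first j h]; constructor <;> omega
    · rw [Gadget.wiggle_mid j hk hs]; split_ifs <;> constructor <;> omega
    · rw [Gadget.wiggle_last j h]; constructor <;> omega

/-- Apart from the pads the abscissas are at most `130000 * n * (2 * d + 1)`, and `p` is at least
`1001 * n * (2 * d + 1)`, so `p ^ 2` exceeds all of them. This is why `κ ≥ 2` suffices. -/
theorem gadget_size (hn : 0 < x.n) (hs : 1 ≤ s) :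
    (16 * x.d + 13) * (10000 * x.n) + (x.gadget r s).pads ≤ (x.gadget r s).toInstance.p ^ 2 ∧
      x.n + 1 ≤ (x.gadget r s).toInstance.p := by
  have h1 : (x.gadget r s).pads ≤ (x.gadget r s).toInstance.p := by
    rw [Gadget.p_toInstance, Gadget.numVerts]; omega
  rw [p_gadget hn hs] at h1 ⊢
  have h2 : 2 * x.d + 1 ≤ (2 * x.d + 1) ^ s := Nat.le_self_pow (by omega) _
  generalize (2 * x.d + 1) ^ s = Q at *
  have h3 : x.n * (2 * x.d + 1) ≤ x.n * Q := Nat.mul_le_mul_left _ h2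
  have h4 : x.n * 1 ≤ x.n * Q := Nat.mul_le_mul_left _ (by omega)
  have h5 : x.n * (1001 * Q) = 1001 * (x.n * Q) := by ring
  rw [h5] at h1 ⊢
  have h6 : (16 * x.d + 13) * (10000 * x.n) ≤ 130000 * (x.n * (2 * x.d + 1)) := by nlinarith
  generalize x.n * Q = Z at *
  have h7 : Z * 1 ≤ Z * Z := Nat.mul_le_mul_left _ (by omega)
  constructor
  · nlinarith
  · omega

theorem gadget_bounded (hn : 0 < x.n) (hm : 0 < x.m) (hr : 1 ≤ r) (hs : 1 ≤ s) {κ : ℕ}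
    (hκ : 2 ≤ κ) : (x.gadget r s).toInstance.Bounded κ := by
  obtain ⟨h1, h2⟩ := gadget_size (r := r) hn hs
  have hG := gadget_good hn hm hr hs
  have h3 : ∀ z : ℤ, z ≤ ((x.gadget r s).toInstance.p : ℤ) ^ 2 →
      z ≤ (((x.gadget r s).toInstance.p + (x.gadget r s).toInstance.q : ℕ) : ℤ) ^ κ := by
    intro z hz
    have h4 : (x.gadget r s).toInstance.p ^ 2 ≤
        ((x.gadget r s).toInstance.p + (x.gadget r s).toInstance.q) ^ κ :=
      (Nat.pow_le_pow_left (Nat.le_add_right _ _) 2).trans (Nat.pow_le_pow_right (by omega) hκ)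
    exact hz.trans (by exact_mod_cast h4)
  have h1' : (16 * (x.d : ℤ) + 13) * (10000 * x.n : ℕ) + (x.gadget r s).pads ≤
      ((x.gadget r s).toInstance.p : ℤ) ^ 2 := by exact_mod_cast h1
  have h2' : (x.n : ℤ) + 1 ≤ ((x.gadget r s).toInstance.p : ℤ) ^ 2 := by
    have : x.n + 1 ≤ (x.gadget r s).toInstance.p ^ 2 := h2.trans (Nat.le_self_pow two_ne_zero _)
    exact_mod_cast this
  intro v hv
  rw [List.mem_append] at hv
  rcases hv with hv | hv
  · obtain ⟨i, hi, rfl⟩ := List.mem_map.1 hv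
    obtain ⟨h5, h6⟩ := Gadget.abs_pos_le hG (List.mem_range.1 hi)
    exact ⟨h3 _ (h5.trans h1'), h3 _ (h6.trans h2')⟩
  · obtain ⟨i, -, rfl⟩ := List.mem_map.1 hv
    refine ⟨h3 _ ((Gadget.abs_traj_le _ i).trans (le_trans ?_ h1')), h3 _ (by simp)⟩
    exact le_add_of_nonneg_right (by positivity)

end OVInstance

/-! ### Arithmetic notation for expressions -/

namespace RAM

namespace SExpr

instance : Add SExpr := ⟨.add⟩
instance : Sub SExpr := ⟨.sub⟩
instance : Mul SExpr := ⟨.mul⟩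
instance : Div SExpr := ⟨.div⟩
instance (k : ℕ) : OfNat SExpr k := ⟨.lit k⟩

variable (e e' : SExpr) (inp : List ℤ) (σ : ℕ → ℤ) (n i : ℕ)

@[simp] theorem eval_add : (e + e').eval inp σ = e.eval inp σ + e'.eval inp σ := rfl
@[simp] theorem eval_sub : (e - e').eval inp σ = e.eval inp σ - e'.eval inp σ := rfl
@[simp] theorem eval_mul : (e * e').eval inp σ = e.eval inp σ * e'.eval inp σ := rfl
@[simp] theorem eval_div : (e / e').eval inp σ = e.eval inp σ / e'.eval inp σ := rfl
@[simp] theorem eval_ofNat : eval inp σ ofNat(i) = (OfNat.ofNat i : ℤ) := rfl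
@[simp] theorem eval_var : (var i).eval inp σ = σ i := rfl
@[simp] theorem eval_lit (z : ℤ) : (lit z).eval inp σ = z := rfl
@[simp] theorem eval_inp : (SExpr.inp e).eval inp σ = init inp (e.eval inp σ) := rfl

@[simp] theorem safe_add : (e + e').Safe inp σ ↔ e.Safe inp σ ∧ e'.Safe inp σ := Iff.rfl
@[simp] theorem safe_sub : (e - e').Safe inp σ ↔ e.Safe inp σ ∧ e'.Safe inp σ := Iff.rfl
@[simp] theorem safe_mul : (e * e').Safe inp σ ↔ e.Safe inp σ ∧ e'.Safe inp σ := Iff.rfl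
@[simp] theorem safe_div : (e / e').Safe inp σ ↔ e.Safe inp σ ∧ e'.Safe inp σ := Iff.rfl
@[simp] theorem safe_ofNat : Safe inp σ ofNat(i) := trivial
@[simp] theorem safe_var : (var i).Safe inp σ := trivial
@[simp] theorem safe_lit (z : ℤ) : (lit z).Safe inp σ := trivial
@[simp] theorem safe_inp : (SExpr.inp e).Safe inp σ ↔ 0 ≤ e.eval inp σ ∧ e.Safe inp σ := Iff.rfl

@[simp] theorem below_add : (e + e').Below n ↔ e.Below n ∧ e'.Below n := Iff.rfl
@[simp] theorem below_sub : (e - e').Below n ↔ e.Below n ∧ e'.Below n := Iff.rfl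
@[simp] theorem below_mul : (e * e').Below n ↔ e.Below n ∧ e'.Below n := Iff.rfl
@[simp] theorem below_div : (e / e').Below n ↔ e.Below n ∧ e'.Below n := Iff.rfl
@[simp] theorem below_ofNat : Below n ofNat(i) := trivial
@[simp] theorem below_var : (var i).Below n ↔ 1 ≤ i ∧ i ≤ n := Iff.rfl
@[simp] theorem below_lit (z : ℤ) : (lit z).Below n := trivial
@[simp] theorem below_inp : (SExpr.inp e).Below n ↔ e.Below n := Iff.rfl

end SExpr

end RAM

/-! ### The program that generates the map matching instance -/

namespace OVInstance

open RAM SExpr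

/-- The parameters of the construction as values of variables. -/
def parameters (x : OVInstance) (r s : ℕ) : List ℤ :=
  [x.n, x.m, x.d, (x.gadget r s).width, (x.gadget r s).core, (x.gadget r s).pads,
    (x.gadget r s).blk, (x.gadget r s).unit, (x.m * (x.gadget r s).blk : ℕ)]

/-- The bound for all numbers in the construction. -/
def bound (x : OVInstance) (r s : ℕ) : ℕ :=
  ((x.gadget r s).toInstance.p + (x.gadget r s).toInstance.q) ^ 2

def genParameters (r s : ℕ) : Prog :=
  .seq (.set 1 (inp 0)) <| .seq (.set 2 (inp 1)) <| .seq (.set 3 (inp 2)) <|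
  .seq (.set 4 (2 * var 3 + 2)) <| .seq (.set 5 ((var 1 + 2) * var 4)) <|
  .seq (.set 6 (var 1 * ((1001 * (2 * var 3 + 1).pow s - 1) / 2 - 2 * var 3 - 2) -
    4 * (var 3 + 1))) <|
  .seq (.set 7 (4 * (2 * var 3 + 1).pow r)) <| .seq (.set 8 (10000 * var 1)) <|
  .set 9 (var 2 * var 7)

/-- Variable `10` holds the vertex number, `11` the row, `12` the column, `13` the bit and `14` its
value. The product `y * (n + 1 - y)` is positive exactly in the rows of proper vectors. The factor
`2 * (c - 1 - 2 * k) - 1` is `-1` left and `1` right of the centre, and `2 + 4 * a` is the gap. -/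
def genVertex : Prog :=
  .seq (.set 11 (var 10 / var 4)) <| .seq (.set 12 (var 10 - var 11 * var 4)) <|
  .seq (.cond (var 12)
    (.cond (2 * var 3 + 1 - var 12)
      (.seq (.set 13 ((var 12 - 1) / 2)) <| .seq (.set 14 0) <|
        .seq (.cond (var 11 * (var 1 + 1 - var 11))
          (.set 14 (inp (3 + (var 11 - 1) * var 3 + var 13))) .skip) <|
        .emit ((16 * var 13 + 10 + (2 * (var 12 - 1 - 2 * var 13) - 1) * (2 + 4 * var 14)) * var 8))
      (.emit ((16 * var 3 + 10) * var 8)))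
    (.emit 0)) <|
  .emit (var 11)

/-- Variable `10` holds the index, `11` the block, `12` the index in the block, `13` the bit, `14`
the position in its wiggle and `15` the amplitude `1` or `3`. Equality tests become positivity
tests: for an index `t < q`, `t + 2 - q` is positive only at the last one. -/
def genTraj : Prog :=
  .seq (.cond (1 - var 10) (.emit (0 - 3 * var 8)) <|
    .cond (var 10 + 2 - var 9) (.emit ((16 * var 3 + 13) * var 8)) <|
    .seq (.set 11 (var 10 / var 7)) <| .seq (.set 12 (var 10 - var 11 * var 7)) <|
    .cond (var 12 - 1)
      (.cond (2 + 4 * var 3 - var 12)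
        (.seq (.set 13 ((var 12 - 2) / 4)) <| .seq (.set 14 (var 12 - 2 - 4 * var 13)) <|
          .seq (.set 15 (1 + 2 * inp (3 + var 1 * var 3 + var 11 * var 3 + var 13))) <|
          .cond (1 - var 14) (.emit ((16 * var 13 + 10 - 3) * var 8)) <|
          .cond (2 - var 14) (.emit ((16 * var 13 + 10 + var 15) * var 8)) <|
          .cond (3 - var 14) (.emit ((16 * var 13 + 10 - var 15) * var 8)) <|
            .emit ((16 * var 13 + 10 + 3) * var 8))
        (.emit ((16 * var 3 + 10) * var 8)))
      (.emit 0)) <|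
  .emit 0

def genPair (e e' : SExpr) : Prog := .seq (.emit e) (.emit e')

/-- The program that generates the instance of map matching. -/
def genMap (r s : ℕ) : Prog :=
  .seq (genParameters r s) <|
  .seq (.emit (var 5 + 1 + var 6)) <|
  .seq (.emit ((var 1 + 2) * (2 * var 3 + 1) + var 1 + var 1 + 2 + (var 6 - 1))) <|
  .seq (.emit (var 9)) <|
  .seq (.for 10 (var 5) genVertex) <|
  .seq (genPair ((16 * var 3 + 13) * var 8) (var 1 + 1)) <|
  .seq (.for 10 (var 6) (genPair (0 - 3 * var 8 - var 10) 0)) <|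
  .seq (.for 10 ((var 1 + 2) * (2 * var 3 + 1)) (genPair (var 10 + var 10 / (2 * var 3 + 1))
    (var 10 + var 10 / (2 * var 3 + 1) + 1))) <|
  .seq (.for 10 (var 1) (genPair (var 10 * var 4) ((var 10 + 1) * var 4))) <|
  .seq (.for 10 (var 1) (genPair ((var 10 + 1) * var 4 + 2 * var 3 + 1)
    ((var 10 + 2) * var 4 + 2 * var 3 + 1))) <|
  .seq (genPair (var 5 - 1) (var 5)) <|
  .seq (genPair 0 (var 5 + 1)) <|
  .seq (.for 10 (var 6 - 1) (genPair (var 5 + 1 + var 10) (var 5 + 2 + var 10))) <|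
  .for 10 (var 9) genTraj

section

variable {x : OVInstance} {r s : ℕ}

theorem q_pos (hm : 0 < x.m) : 1 ≤ (x.gadget r s).toInstance.q := by
  rw [q_gadget]; exact Nat.mul_pos hm (by positivity)

theorem p_ge (hn : 0 < x.n) (hs : 1 ≤ s) : 1001 ≤ (x.gadget r s).toInstance.p := by
  rw [p_gadget hn hs]
  calc 1001 = 1 * (1001 * 1) := rfl
    _ ≤ _ := Nat.mul_le_mul hn (Nat.mul_le_mul_left _ (Nat.one_le_pow _ _ (by omega)))

theorem pq_le_bound (x : OVInstance) (r s : ℕ) :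
    (x.gadget r s).toInstance.p + (x.gadget r s).toInstance.q ≤ x.bound r s :=
  Nat.le_self_pow two_ne_zero _

theorem steps_genPair {X S : ℕ} {inp L : List ℤ} {e e' : SExpr} {a b : ℤ}
    (he : Value inp L e a) (he' : Value inp L e' b) (ha : |a| ≤ X) (hb : |b| ≤ X) :
    Steps X inp S L (genPair e e') L [a, b] := (Steps.emit he ha).seq (.emit he' hb)

theorem traj_le_bound (hn : 0 < x.n) (hs : 1 ≤ s) :
    (16 * x.d + 13) * (10000 * x.n) ≤ x.bound r s :=
  (Nat.le_add_right _ _).trans ((gadget_size (r := r) hn hs).1.trans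
    (Nat.pow_le_pow_left (Nat.le_add_right _ _) 2))

theorem parameters_le (hn : 0 < x.n) (hm : 0 < x.m) (hs : 1 ≤ s) :
    ∀ z ∈ x.parameters r s, |z| ≤ x.bound r s := by
  have hX := pq_le_bound x r s
  have hp := (x.gadget r s).p_toInstance
  have hq := (x.gadget r s).q_toInstance
  have h1 := traj_le_bound (r := r) hn hs
  have h2 := (gadget_size (r := r) hn hs).2
  have hb : 1 ≤ (x.gadget r s).blk := Nat.mul_pos (by omega) (by positivity)
  have hG1 : (x.gadget r s).m = x.m := rfl
  have hG2 : (x.gadget r s).core = (x.n + 2) * (x.gadget r s).width := rfl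
  have hG3 : (x.gadget r s).unit = 10000 * x.n := rfl
  unfold parameters
  unfold Gadget.numVerts at hp
  rw [hG1] at hq
  generalize x.bound r s = X at *
  generalize (x.gadget r s).toInstance = I at *
  generalize (x.gadget r s).core = core at *
  generalize (x.gadget r s).width = width at *
  generalize (x.gadget r s).blk = blk at *
  generalize (x.gadget r s).pads = pads at *
  rw [hG3]
  clear hG1 hG3
  have hm' : x.m * 1 ≤ x.m * blk := Nat.mul_le_mul_left _ hb
  have hb' : 1 * blk ≤ x.m * blk := Nat.mul_le_mul_right _ hm
  have hd' : x.d * 1 ≤ (16 * x.d + 13) * (10000 * x.n) := Nat.mul_le_mul (by omega) (by omega)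
  have hu' : 1 * (10000 * x.n) ≤ (16 * x.d + 13) * (10000 * x.n) :=
    Nat.mul_le_mul_right _ (by omega)
  have hw' : 1 * width ≤ (x.n + 2) * width := Nat.mul_le_mul_right _ (by omega)
  generalize (16 * x.d + 13) * (10000 * x.n) = T at *
  generalize x.m * blk = q at *
  intro z hz
  simp only [List.mem_cons, List.not_mem_nil, or_false] at hz
  rcases hz with rfl | rfl | rfl | rfl | rfl | rfl | rfl | rfl | rfl
  all_goals
    rw [Nat.abs_cast, Nat.cast_le]
    omega

theorem steps_genParameters (hn : 0 < x.n) (hm : 0 < x.m) (hs : 1 ≤ s) {S : ℕ} :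
    Steps (x.bound r s) x.encode S [] (genParameters r s) (x.parameters r s) [] := by
  have hG2 : (x.gadget r s).core = (x.n + 2) * (x.gadget r s).width := rfl
  have hG3 : (x.gadget r s).unit = 10000 * x.n := rfl
  refine (Steps.set (a := x.n) rfl ⟨by simp, by simp, by simp [init_encode_zero]⟩ ?_).seq <|
    (Steps.set (a := x.m) rfl ⟨by simp, by simp, by simp [init_encode_one]⟩ ?_).seq <|
    (Steps.set (a := x.d) rfl ⟨by simp, by simp, by simp [init_encode_two]⟩ ?_).seq <|
    (Steps.set (a := (x.gadget r s).width) rfl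
      ⟨by simp, by simp, by simp [env, Gadget.width, gadget]⟩ ?_).seq <|
    (Steps.set (a := (x.gadget r s).core) rfl
      ⟨by simp, by simp, by simp [env, hG2]⟩ ?_).seq <|
    (Steps.set (a := (x.gadget r s).pads) rfl
      ⟨by simp [below_pow], by simp [safe_pow], ?_⟩ ?_).seq <|
    (Steps.set (a := (x.gadget r s).blk) rfl
      ⟨by simp [below_pow], by simp [safe_pow], by simp [env, gadget, eval_pow]⟩ ?_).seq <|
    (Steps.set (a := (x.gadget r s).unit) rfl
      ⟨by simp, by simp, by simp [env, hG3]⟩ ?_).seq <|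
    (Steps.set (a := (x.m * (x.gadget r s).blk : ℕ)) rfl
      ⟨by simp, by simp, by simp [env]⟩ ?_)
  case refine_6 =>
    obtain ⟨h, h3, -, h4, -⟩ := pads_add (r := r) hn hs
    have h5 : (1001 * (2 * (x.d : ℤ) + 1) ^ s) = 2 * h + 1 := by exact_mod_cast h3
    simp [env, eval_pow, h4, h5]
  all_goals exact parameters_le hn hm hs _ (by simp [parameters])

theorem abs_pos_le_bound (hn : 0 < x.n) (hm : 0 < x.m) (hr : 1 ≤ r) (hs : 1 ≤ s) {v : ℕ}
    (hv : v < (x.gadget r s).numVerts) :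
    |((x.gadget r s).pos v).1| ≤ x.bound r s ∧ |((x.gadget r s).pos v).2| ≤ x.bound r s := by
  have h := gadget_bounded hn hm hr hs le_rfl ((x.gadget r s).pos v)
    (List.mem_append_left _ (List.mem_map_of_mem (List.mem_range.2 hv)))
  simpa [bound] using h

theorem cast_idx_div {y c w : ℕ} (hc : c < w) : ((y * w + c : ℕ) : ℤ) / (w : ℤ) = y := by
  rw [← Int.natCast_ediv, mul_comm, Nat.mul_add_div (by omega), Nat.div_eq_of_lt hc, add_zero]

theorem steps_genVertex (hn : 0 < x.n) (hm : 0 < x.m) (hr : 1 ≤ r) (hs : 1 ≤ s) {S t : ℕ}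
    (ht : t < (x.gadget r s).core) :
    Steps (x.bound r s) x.encode S (x.parameters r s ++ [(t : ℤ)]) genVertex
      (x.parameters r s ++ [(t : ℤ)]) [((x.gadget r s).pos t).1, ((x.gadget r s).pos t).2] := by
  have hv : t < (x.gadget r s).numVerts := by unfold Gadget.numVerts; omega
  obtain ⟨hb1, hb2⟩ := abs_pos_le_bound hn hm hr hs hv
  have hp := pq_le_bound x r s
  rw [Gadget.p_toInstance, Gadget.numVerts] at hp
  rcases Gadget.vertex_cases hv with ⟨y, c, hy, hc, rfl⟩ | rfl | ⟨i, -, rfl⟩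
  rotate_left
  · omega
  · omega
  have hn' : (x.gadget r s).n = x.n := rfl
  have hd' : (x.gadget r s).d = x.d := rfl
  have hw : (x.gadget r s).width = 2 * x.d + 2 := rfl
  have ha : ∀ k, (x.gadget r s).gap y k =
      2 + 4 * (if 1 ≤ y ∧ y ≤ x.n then (if x.entryA (y - 1) k then 1 else 0) else 0) := by
    intro k
    simp only [Gadget.gap, gadget]
    split_ifs <;> simp_all
  have hX1 := Gadget.X_zero (G := x.gadget r s) y
  have hX2 := Gadget.X_last (G := x.gadget r s) y
  have hX3 := fun k => Gadget.X_odd (G := x.gadget r s) y (k := k)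
  have hX4 := fun k => Gadget.X_even (G := x.gadget r s) y (k := k)
  have hpos : (x.gadget r s).pos (y * (x.gadget r s).width + c) = ((x.gadget r s).X y c, (y : ℤ)) := by
    rw [Gadget.pos, Gadget.row_idx hy hc, Gadget.col_idx hy hc]
  rw [hpos] at hb1 hb2 ⊢
  have hidx : y * (x.gadget r s).width + c ≤ x.bound r s := by omega
  have hdiv := cast_idx_div (y := y) hc
  rw [hn'] at hy
  rw [hd'] at hX2 hX3 hX4
  unfold parameters
  generalize ht' : y * (x.gadget r s).width + c = t at *
  have hct : (c : ℤ) = t - y * (x.gadget r s).width := by rw [← ht']; push_cast; ring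
  have hcb : |(c : ℤ)| ≤ x.bound r s := by rw [Nat.abs_cast]; norm_cast; omega
  generalize (x.gadget r s).X y = Z at *
  generalize (x.gadget r s).gap y = gap at *
  generalize x.bound r s = B at *
  generalize (x.gadget r s).width = w at *
  generalize (x.gadget r s).core = core at *
  generalize (x.gadget r s).blk = blk at *
  generalize (x.gadget r s).pads = pads at *
  generalize (x.gadget r s).unit = U at *
  refine Steps.drop (E := [(y : ℤ), (c : ℤ)]) ?_
  refine (Steps.set (a := y) rfl ⟨by simp, by simp, by simp [env, hdiv]⟩ hb2).seq <|
    (Steps.set (a := c) rfl ⟨by simp, by simp, by simp [env, hct]⟩ hcb).seq <|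
    (Steps.cond (a := c) (f := [Z c]) ⟨by simp, by simp, by simp [env]⟩ (fun h0 => ?_)
      (fun h0 => ?_)).seq (Steps.emit (a := y) ⟨by simp, by simp, by simp [env]⟩ hb2)
  swap
  · obtain rfl : c = 0 := by omega
    exact Steps.emit ⟨by simp, by simp, by simp [hX1]⟩ hb1
  refine Steps.cond (a := 2 * x.d + 1 - c) ⟨by simp, by simp, by simp [env]⟩ (fun h1 => ?_)
      (fun h1 => ?_)
  swap
  · obtain rfl : c = 2 * x.d + 1 := by omega
    refine Steps.emit ⟨by simp, by simp, ?_⟩ hb1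
    simp [env, hX2]
  obtain ⟨k, hk, hck⟩ : ∃ k < x.d, c = 2 * k + 1 ∨ c = 2 * k + 2 := 
    ⟨(c - 1) / 2, by omega, by omega⟩
  have hkB : |(k : ℤ)| ≤ B := by rw [Nat.abs_cast]; norm_cast; omega
  have hB : (1 : ℤ) ≤ B := by norm_cast; omega
  have hkdiv : ((c : ℤ) - 1) / 2 = k := by omega
  refine Steps.drop (E := [(k : ℤ), if 1 ≤ y ∧ y ≤ x.n then (if x.entryA (y - 1) k then 1 else 0) else 0]) ?_
  refine (Steps.set (a := k) rfl ⟨by simp, by simp, by simp [env, hkdiv]⟩ hkB).seq <|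
    (Steps.set (a := 0) rfl ⟨by simp, by simp, by simp⟩ (by simp)).seq <|
    (Steps.cond (a := (y : ℤ) * (x.n + 1 - y)) (f := []) ⟨by simp, by simp, by simp [env]⟩
      (fun h2 => ?_) (fun h2 => ?_)).seq <|
    Steps.emit (a := Z c) ⟨by simp, by simp, ?_⟩ hb1
  · have h3 : 1 ≤ y := by
      by_contra h3
      obtain rfl : y = 0 := by omega
      simp at h2
    have h4 : y ≤ x.n := by
      by_contra h4
      obtain rfl : y = x.n + 1 := by omega
      simp at h2
    have h5 : ((y - 1 : ℕ) : ℤ) = y - 1 := by omega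
    have h6 := x.init_encode_A (y := y - 1) (k := k) (by omega) hk
    rw [h5] at h6
    rw [if_pos ⟨h3, h4⟩]
    refine Steps.assign (k := 13) ⟨by simp, ?_, by simpa [env] using h6⟩ (by split_ifs <;> simp [hB])
    have : 0 ≤ 3 + ((y : ℤ) - 1) * x.d + k := by rw [← h5]; positivity
    simpa [env] using this
  · rw [if_neg]
    · exact Steps.skip rfl
    · rintro ⟨h3, h4⟩
      refine h2 (mul_pos ?_ ?_) <;> omega
  · simp only [eval_mul, eval_add, eval_sub, eval_ofNat, eval_var]
    simp [env]
    rcases hck with rfl | rfl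
    · push_cast
      rw [hX3 k hk, ha k]
      split_ifs <;> ring
    · push_cast
      rw [hX4 k hk, ha k]
      split_ifs <;> ring
theorem abs_traj_le_bound (hn : 0 < x.n) (hs : 1 ≤ s) (t : ℕ) :
    |(x.gadget r s).trajX t * (x.gadget r s).unit| ≤ x.bound r s :=
  (Gadget.abs_traj_le _ t).trans (by exact_mod_cast traj_le_bound (r := r) hn hs)

theorem steps_genTraj (hn : 0 < x.n) (hm : 0 < x.m) (hs : 1 ≤ s) {S t : ℕ}
    (ht : t < x.m * (x.gadget r s).blk) :
    Steps (x.bound r s) x.encode S (x.parameters r s ++ [(t : ℤ)]) genTraj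
      (x.parameters r s ++ [(t : ℤ)]) [(x.gadget r s).trajX t * (x.gadget r s).unit, 0] := by
  have hb := abs_traj_le_bound (r := r) hn hs t
  have hp := pq_le_bound x r s
  have hnB := parameters_le (r := r) hn hm hs x.n (by simp [parameters])
  have hdB := parameters_le (r := r) hn hm hs x.d (by simp [parameters])
  have hkB : ∀ k < x.d, |(k : ℤ)| ≤ x.bound r s := fun k hk => by
    rw [Nat.abs_cast] at hdB ⊢; norm_cast at hdB ⊢; omega
  have hp3 := p_ge (r := r) hn hs
  have hB : (3 : ℤ) ≤ x.bound r s := by norm_cast; omega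
  have hblk : 0 < (x.gadget r s).blk := Nat.mul_pos (by omega) (by positivity)
  have htr : (x.gadget r s).trajX t = if t = 0 then (-3 : ℤ) else
      if t = x.m * (x.gadget r s).blk - 1 then 16 * x.d + 13
      else (x.gadget r s).wiggle (t / (x.gadget r s).blk) (t % (x.gadget r s).blk) := rfl
  have hw1 := fun j r' => (x.gadget r s).wiggle_first j (r := r')
  have hw2 := fun j r' => (x.gadget r s).wiggle_last j (r := r')
  have hw3 := fun j k s' => (x.gadget r s).wiggle_mid j (k := k) (s := s')
  have hq : x.m * (x.gadget r s).blk ≤ x.bound r s := by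
    rw [q_gadget] at hp
    exact (Nat.le_add_left _ _).trans hp
  clear hp
  have hd' : (x.gadget r s).d = x.d := rfl
  have hb' : (x.gadget r s).b = x.entryB := rfl
  simp only [hd', hb'] at hw2 hw3
  unfold parameters
  generalize (x.gadget r s).trajX t = T at *
  generalize (x.gadget r s).wiggle = W at *
  generalize x.bound r s = B at *
  generalize (x.gadget r s).width = w at *
  generalize (x.gadget r s).core = core at *
  generalize (x.gadget r s).blk = blk at *
  generalize (x.gadget r s).pads = pads at *
  generalize (x.gadget r s).unit = U at *
  refine Steps.seq (f := [T * U]) ?_ (Steps.emit (a := 0) ⟨by simp, by simp, by simp⟩ (by simp))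
  refine Steps.cond (a := 1 - t) ⟨by simp, by simp, by simp [env]⟩ (fun h1 => ?_) (fun h1 => ?_)
  · rw [if_pos (by omega)] at htr
    exact Steps.emit ⟨by simp, by simp, by simp [env, htr]⟩ hb
  rw [if_neg (by omega)] at htr
  refine Steps.cond (a := t + 2 - (x.m * blk : ℕ)) ⟨by simp, by simp, by simp [env]⟩
    (fun h2 => ?_) (fun h2 => ?_)
  · rw [if_pos (by omega)] at htr
    exact Steps.emit ⟨by simp, by simp, by simp [env, htr]⟩ hb
  rw [if_neg (by omega)] at htr
  have hj : t / blk < x.m := by rwa [Nat.div_lt_iff_lt_mul hblk]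
  have hjr := Nat.div_add_mod t blk
  have hjt := Nat.div_le_self t blk
  have hdiv : (t : ℤ) / blk = (t / blk : ℕ) := by simp
  generalize t / blk = j at *
  generalize t % blk = i at *
  have hij : (i : ℤ) = t - j * blk := by rw [← hjr]; push_cast; ring
  refine Steps.drop (E := [(j : ℤ), (i : ℤ)]) ?_
  refine (Steps.set (a := j) rfl ⟨by simp, by simp, by simp [env, hdiv]⟩ ?_).seq <|
    (Steps.set (a := i) rfl ⟨by simp, by simp, by simp [env, hij]⟩ ?_).seq <|
    (Steps.cond (a := i - 1) (f := [T * U]) ⟨by simp, by simp, by simp [env]⟩ (fun h0 => ?_)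
      (fun h0 => ?_))
  · rw [Nat.abs_cast]; norm_cast; omega
  · rw [Nat.abs_cast]; norm_cast; omega
  swap
  · rw [hw1 _ _ (by omega)] at htr
    exact Steps.emit ⟨by simp, by simp, by simp [htr]⟩ hb
  refine Steps.cond (a := 2 + 4 * x.d - i) ⟨by simp, by simp, by simp [env]⟩ (fun h3 => ?_)
      (fun h3 => ?_)
  swap
  · rw [hw2 _ _ (by omega)] at htr
    exact Steps.emit ⟨by simp, by simp, by simp [env, htr]⟩ hb
  obtain ⟨k, a, hk, ha, rfl⟩ : ∃ k a, k < x.d ∧ a < 4 ∧ i = 2 + 4 * k + a :=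
    ⟨(i - 2) / 4, (i - 2) % 4, by omega, by omega, by omega⟩
  rw [hw3 j k a hk ha] at htr
  have hin := x.init_encode_B hj hk
  refine Steps.drop (E := [(k : ℤ), (a : ℤ), if x.entryB j k then 3 else 1]) ?_
  refine (Steps.set (a := k) rfl ⟨by simp, by simp, ?_⟩ (hkB k hk)).seq <|
    (Steps.set (a := a) rfl ⟨by simp, by simp, ?_⟩ ?_).seq <|
    (Steps.set (a := if x.entryB j k then 3 else 1) rfl ⟨by simp, ?_, ?_⟩ ?_).seq ?_
  · simp [env]; omega
  · simp [env]; omega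
  · rw [Nat.abs_cast]; omega
  · simp [env]; positivity
  · simp [env, hin]; split_ifs <;> simp
  · split_ifs <;> simp <;> omega
  refine Steps.cond (a := 1 - a) ⟨by simp, by simp, by simp [env]⟩ (fun h4 => ?_) (fun h4 => ?_)
  · rw [if_pos (by omega)] at htr
    exact Steps.emit ⟨by simp, by simp, by simp [env, htr, sub_eq_add_neg]⟩ hb
  rw [if_neg (by omega)] at htr
  refine Steps.cond (a := 2 - a) ⟨by simp, by simp, by simp [env]⟩ (fun h5 => ?_) (fun h5 => ?_)
  · rw [if_pos (by omega)] at htr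
    exact Steps.emit ⟨by simp, by simp, by simp [env, htr]⟩ hb
  rw [if_neg (by omega)] at htr
  refine Steps.cond (a := 3 - a) ⟨by simp, by simp, by simp [env]⟩ (fun h6 => ?_) (fun h6 => ?_)
  · rw [if_pos (by omega)] at htr
    exact Steps.emit ⟨by simp, by simp, by simp [env, htr, sub_eq_add_neg]⟩ hb
  · rw [if_neg (by omega)] at htr
    exact Steps.emit ⟨by simp, by simp, by simp [env, htr]⟩ hb

end
end OVInstance

/-! ### The reduction of orthogonal vectors as a program -/

namespace OVInstance

open RAM SExpr

section

variable {x : OVInstance} {r s : ℕ}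

/-- Cuts the encoding into the pieces emitted by `genMap`, associated to the right like the program.
-/
theorem _root_.Gadget.encode_toInstance (G : Gadget) : G.toInstance.encode =
    [(G.numVerts : ℤ)] ++ ([(G.numEdges : ℤ)] ++ ([((G.m * G.blk : ℕ) : ℤ)] ++
    ((List.range G.core).flatMap (fun t => [(G.pos t).1, (G.pos t).2]) ++
    ([(G.pos G.core).1, (G.pos G.core).2] ++
    ((List.range G.pads).flatMap
      (fun i => [(G.pos (G.core + 1 + i)).1, (G.pos (G.core + 1 + i)).2]) ++
    ((List.range ((G.n + 2) * (2 * G.d + 1))).flatMap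
      (fun e => [((G.rowEdge e).1 : ℤ), ((G.rowEdge e).2 : ℤ)]) ++
    ((List.range G.n).flatMap (fun e => [((G.leftEdge e).1 : ℤ), ((G.leftEdge e).2 : ℤ)]) ++
    ((List.range G.n).flatMap (fun e => [((G.rightEdge e).1 : ℤ), ((G.rightEdge e).2 : ℤ)]) ++
    ([((G.core - 1 : ℕ) : ℤ), (G.core : ℤ)] ++ ([0, ((G.core + 1 : ℕ) : ℤ)] ++
    ((List.range (G.pads - 1)).flatMap
      (fun e => [((G.padEdge e).1 : ℤ), ((G.padEdge e).2 : ℤ)]) ++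
    (List.range (G.m * G.blk)).flatMap (fun t => [G.trajX t * G.unit, 0])))))))))))) := by
  unfold MapInstance.encode
  rw [Gadget.length_verts, Gadget.length_edges,
    show G.toInstance.traj.length = G.m * G.blk from Gadget.q_toInstance G]
  simp only [Gadget.toInstance, Gadget.edges, Gadget.numVerts, List.range_add, List.range_one,
    List.map_append, List.flatMap_append, List.map_map, List.flatMap_map, List.append_assoc,
    List.map_cons, List.map_nil, List.flatMap_cons, add_zero,
    Function.comp_def, List.cons_append, List.nil_append, Nat.cast_zero]

/-- No loops are nested and each has at most `p + q` rounds, so the factor `p + q` covers them all.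
-/
theorem steps_genMap (hn : 0 < x.n) (hm : 0 < x.m) (hr : 1 ≤ r) (hs : 1 ≤ s) :
    Steps (x.bound r s) x.encode ((x.gadget r s).toInstance.p + (x.gadget r s).toInstance.q) []
      (genMap r s) (x.parameters r s) (x.gadget r s).toInstance.encode := by
  have hP1 : 1 ≤ (x.gadget r s).toInstance.p + (x.gadget r s).toInstance.q :=
    (q_pos hm).trans (Nat.le_add_left _ _)
  have hG := gadget_good hn hm hr hs
  have hpads := hG.pads_pos
  have hle := parameters_le (r := r) hn hm hs
  have hB := pq_le_bound x r s
  have hp := (x.gadget r s).p_toInstance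
  have hq := (x.gadget r s).q_toInstance
  have hE : ∀ e ∈ (x.gadget r s).edges,
      |(e.1 : ℤ)| ≤ x.bound r s ∧ |(e.2 : ℤ)| ≤ x.bound r s := by
    intro e he
    have := Gadget.edges_lt hG he
    simp only [Nat.abs_cast, Nat.cast_le]
    omega
  have hcore : (x.gadget r s).core < (x.gadget r s).numVerts := by unfold Gadget.numVerts; omega
  have hpad : ∀ i < (x.gadget r s).pads,
      (x.gadget r s).core + 1 + i < (x.gadget r s).numVerts := by unfold Gadget.numVerts; omega
  have hcore0 := Gadget.core_pos (x.gadget r s)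
  rw [Gadget.encode_toInstance]
  have hloop : ∀ {i : ℕ} {e : SExpr} {c : Prog} {N : ℕ} (f : ℕ → List ℤ),
      i = 10 → N ≤ (x.gadget r s).toInstance.p + (x.gadget r s).toInstance.q →
      Value x.encode (x.parameters r s) e N →
      (∀ j < N, Steps (x.bound r s) x.encode 1 (x.parameters r s ++ [(j : ℤ)]) c
        (x.parameters r s ++ [(j : ℤ)]) (f j)) →
      Steps (x.bound r s) x.encode
        ((x.gadget r s).toInstance.p + (x.gadget r s).toInstance.q) (x.parameters r s)
        (.for i e c) (x.parameters r s) ((List.range N).flatMap f) := by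
    intro i e c N f hi hN hv hc
    have := Steps.for_const (i := i) (R := (x.gadget r s).toInstance.p + (x.gadget r s).toInstance.q) f
      (by simp [parameters, hi]) hN (hN.trans hB) hv hc
    rwa [one_mul] at this
  have hn' : (x.gadget r s).n = x.n := rfl
  have hm' : (x.gadget r s).m = x.m := rfl
  have hd' : (x.gadget r s).d = x.d := rfl
  have hw : (x.gadget r s).width = 2 * x.d + 2 := rfl
  have hpb := fun v => abs_pos_le_bound (v := v) hn hm hr hs
  have hV : (x.gadget r s).numVerts = (x.gadget r s).core + 1 + (x.gadget r s).pads := rfl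
  have hEn : (x.gadget r s).numEdges = (x.n + 2) * (2 * x.d + 1) + x.n + x.n + 2 +
    ((x.gadget r s).pads - 1) := rfl
  have hcoreE : (((x.gadget r s).core - 1, (x.gadget r s).core) : ℕ × ℕ) ∈ (x.gadget r s).edges ∧
      ((0, (x.gadget r s).core + 1) : ℕ × ℕ) ∈ (x.gadget r s).edges := by simp [Gadget.edges]
  have hpc : (x.gadget r s).pos (x.gadget r s).core =
      (((16 * x.d + 13) * (x.gadget r s).unit, x.n + 1) : ℤ × ℤ) := by
    rw [Gadget.pos, Gadget.row_core, Gadget.col_core, Gadget.X_far _ (by omega), hd', hn']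
    simp; ring
  have hpp : ∀ i, (x.gadget r s).pos ((x.gadget r s).core + 1 + i) =
      ((0 - 3 * (x.gadget r s).unit - i, 0) : ℤ × ℤ) := by
    intro i
    rw [Gadget.pos, Gadget.row_pad, Gadget.col_pad, Gadget.X_neg _ (by omega)]
    simp; ring
  have hE' : ∀ e, ((((e ∈ _ ∨ e ∈ _) ∨ e ∈ _) ∨ e ∈ _) ∨ e ∈ _) → _ := fun e he => hE e (by
    simpa only [Gadget.edges, List.mem_append] using he)
  rw [hn', hm', hd']
  refine (steps_genParameters hn hm hs).seq (g := _ ++ _) <|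
    (Steps.emit ⟨by simp [parameters], by simp [parameters], ?v1⟩ ?b1).seq <|
    (Steps.emit ⟨by simp [parameters], by simp [parameters], ?v2⟩ ?b2).seq <|
    (Steps.emit ⟨by simp [parameters], by simp [parameters], ?v3⟩ ?b3).seq <|
    (hloop _ rfl ?n1 ⟨by simp [parameters], by simp [parameters], ?v4⟩ fun t ht => steps_genVertex hn hm hr hs ht).seq <|
    (steps_genPair ⟨by simp [parameters], by simp [parameters], ?v5⟩ ⟨by simp [parameters], by simp [parameters], ?v6⟩ (hpb _ hcore).1 (hpb _ hcore).2).seq <|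
    (hloop _ rfl ?n2 ⟨by simp [parameters], by simp [parameters], ?v7⟩ fun i hi =>
      steps_genPair ⟨by simp [parameters], by simp [parameters], ?v8⟩ ⟨by simp [parameters], by simp [parameters], ?v9⟩ (hpb _ (hpad i hi)).1 (hpb _ (hpad i hi)).2).seq <|
    (hloop _ rfl ?n3 ⟨by simp [parameters], by simp [parameters], ?v10⟩ fun i hi =>
      steps_genPair ⟨by simp [parameters], by simp [parameters], ?v11⟩ ⟨by simp [parameters], by simp [parameters], ?v12⟩ (hE' _ ?e1).1 (hE' _ ?e1).2).seq <|
    (hloop _ rfl ?n4 ⟨by simp [parameters], by simp [parameters], ?v13⟩ fun i hi =>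
      steps_genPair ⟨by simp [parameters], by simp [parameters], ?v14⟩ ⟨by simp [parameters], by simp [parameters], ?v15⟩ (hE' _ ?e2).1 (hE' _ ?e2).2).seq <|
    (hloop _ rfl ?n5 ⟨by simp [parameters], by simp [parameters], ?v16⟩ fun i hi =>
      steps_genPair ⟨by simp [parameters], by simp [parameters], ?v17⟩ ⟨by simp [parameters], by simp [parameters], ?v18⟩ (hE' _ ?e3).1 (hE' _ ?e3).2).seq <|
    (steps_genPair ⟨by simp [parameters], by simp [parameters], ?v19⟩ ⟨by simp [parameters], by simp [parameters], ?v20⟩ (hE _ hcoreE.1).1 (hE _ hcoreE.1).2).seq <|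
    (steps_genPair ⟨by simp [parameters], by simp [parameters], ?v21⟩ ⟨by simp [parameters], by simp [parameters], ?v22⟩ (by simp) (hE _ hcoreE.2).2).seq <|
    (hloop _ rfl ?n6 ⟨by simp [parameters], by simp [parameters], ?v23⟩ fun i hi =>
      steps_genPair ⟨by simp [parameters], by simp [parameters], ?v24⟩ ⟨by simp [parameters], by simp [parameters], ?v25⟩ (hE' _ ?e4).1 (hE' _ ?e4).2).seq <|
    hloop _ rfl ?n7 ⟨by simp [parameters], by simp [parameters], ?v26⟩ fun t ht => steps_genTraj hn hm hs ht
  case v1 => simp [parameters, env, hV]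
  case v2 => simp [parameters, env, hEn]; omega
  case v3 => simp [parameters, env]
  case b1 => rw [Nat.abs_cast, Nat.cast_le]; omega
  case b2 => rw [Nat.abs_cast, Nat.cast_le]; omega
  case b3 => exact hle _ (by simp [parameters])
  case n1 => omega
  case n2 => omega
  case n3 => omega
  case n4 => omega
  case n5 => omega
  case n6 => omega
  case n7 => rw [hq, hm']; omega
  case v4 => simp [parameters, env]
  case v5 => simp [parameters, env, hpc]
  case v6 => simp [parameters, env, hpc]
  case v7 => simp [parameters, env]
  case v8 => simp [parameters, env, hpp]
  case v9 => simp [parameters, hpp]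
  case v10 => simp [parameters, env]
  case v11 => simp [parameters, env, Gadget.rowEdge, hd']
  case v12 => simp [parameters, env, Gadget.rowEdge, hd']
  case v13 => simp [parameters, env]
  case v14 => simp [parameters, env, Gadget.leftEdge]
  case v15 => simp [parameters, env, Gadget.leftEdge]
  case v16 => simp [parameters, env]
  case v17 => simp [parameters, env, Gadget.rightEdge, hd']
  case v18 => simp [parameters, env, Gadget.rightEdge, hd']
  case v19 => simp [parameters, env]; omega
  case v20 => simp [parameters, env]
  case v21 => simp
  case v22 => simp [parameters, env]
  case v23 => simp [parameters, env]; omega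
  case v24 => simp [parameters, env, Gadget.padEdge]
  case v25 => simp [parameters, env, Gadget.padEdge]
  case v26 => simp [parameters, env]
  case e1 => exact .inl (.inl (.inl (.inl (List.mem_map_of_mem (List.mem_range.2 hi)))))
  case e2 => exact .inl (.inl (.inl (.inr (List.mem_map_of_mem (List.mem_range.2 hi)))))
  case e3 => exact .inl (.inl (.inr (List.mem_map_of_mem (List.mem_range.2 hi))))
  case e4 => exact .inr (List.mem_map_of_mem (List.mem_range.2 hi))

/-- Compares the approximation computed by the relocated program with the threshold. -/
def testMap : Prog :=
  .ite (.sub (.mul (.mul (.lit 30000) (.cell (.lit 0))) (.cell (.lit (-8)))) (.cell (.lit (-2))))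
    (.store (.lit 0) (.lit 1)) (.store (.lit 0) (.lit 0))

/-- The reduction of OV to map matching. -/
def viaMap (r s : ℕ) (c : Prog) : Prog := .seq (.seq (genMap r s) c.relocate) testMap

/-- The addresses `-2` and `-8` are `reloc 0` and `reloc 1`, the numerator and the denominator of
the approximation, and cell `0` still holds `n`. The test compares the quotient with `30000 * n`
without dividing. -/
theorem run_testMap {M : Memory} {B : ℕ} (hB : 1 ≤ B) (hM : ∀ a, bitLen (M a) ≤ B) :
    ∃ t M', Run testMap M t M' ∧ t ≤ testMap.units * B ∧
      M' 0 = if 0 < 30000 * M 0 * M (-8) - M (-2) then 1 else 0 := by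
  have h1 := (Expr.sub (.mul (.mul (.lit 30000) (.cell (.lit 0))) (.cell (.lit (-8))))
    (.cell (.lit (-2)))).cost_le hB hM
  have h2 := (Expr.lit 0).cost_le hB hM
  have h3 := (Expr.lit 1).cost_le hB hM
  split_ifs with h
  · refine ⟨_, _, .ite_pos h (.store _ _ _), ?_, by simp [Expr.eval]⟩
    simp only [testMap, Prog.units, add_mul] at *; omega
  · refine ⟨_, _, .ite_neg h (.store _ _ _), ?_, by simp [Expr.eval]⟩
    simp only [testMap, Prog.units, add_mul] at *; omega

/-- With an orthogonal pair the approximation is at most `2.999 * (10001 * n + 1)`, hence at most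
`29995.998 * n`; without one it is at least `30000 * n`. -/
theorem viaMap_spec {c : Prog} (hn : 0 < x.n) (hm : 0 < x.m) (hr : 1 ≤ r) (hs : 1 ≤ s) {t : ℕ}
    {M : Memory} (hc : Run c (init (x.gadget r s).toInstance.encode) t M) (h1 : 0 < M 1)
    (hle : (x.gadget r s).toInstance.opt ≤ (M 0 : ℝ) / M 1)
    (hge : (M 0 : ℝ) / M 1 ≤ 2.999 * (x.gadget r s).toInstance.opt) :
    ∃ t' M', Run (viaMap r s c) (init x.encode) t' M' ∧
      t' ≤ (testMap.units + 1) * (((genMap r s).budget + 1) *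
        (((x.gadget r s).toInstance.p + (x.gadget r s).toInstance.q) * bitLen (x.bound r s)) +
        c.slowdown * t + 1) + 1 ∧
      (x.HasOrthogonalPair → M' 0 = 1) ∧ (¬ x.HasOrthogonalPair → M' 0 = 0) := by
  have hpq : 1 ≤ (x.gadget r s).toInstance.p + (x.gadget r s).toInstance.q :=
    (q_pos hm).trans (Nat.le_add_left _ _)
  have hinp : ∀ z ∈ x.encode, |z| ≤ (x.bound r s : ℤ) := by
    intro z hz
    rcases x.mem_encode hz with rfl | rfl | rfl | rfl | rfl
    · exact parameters_le hn hm hs _ (by simp [parameters])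
    · exact parameters_le hn hm hs _ (by simp [parameters])
    · exact parameters_le hn hm hs _ (by simp [parameters])
    · simp
    · rw [abs_one]; exact_mod_cast hpq.trans (pq_le_bound x r s)
  have hlen : (x.gadget r s).toInstance.encode.length ≤ x.bound r s := by
    have h : (x.gadget r s).toInstance.encode.length =
        3 + 2 * ((x.gadget r s).toInstance.p + (x.gadget r s).toInstance.q) := by
      simp only [MapInstance.encode, MapInstance.p, MapInstance.q, List.length_append,
        List.length_flatMap, List.length_cons, List.length_nil, List.map_const', List.sum_replicate,
        smul_eq_mul]
      ring
    have h3 := p_ge (r := r) hn hs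
    rw [h, bound]
    nlinarith
  have hgen : WP (x.bound r s) x.encode (genMap r s) ((genMap r s).budget *
      ((x.gadget r s).toInstance.p + (x.gadget r s).toInstance.q))
      (fun _ l' => l' = (x.gadget r s).toInstance.encode) (fun _ => 0) [] :=
    (steps_genMap hn hm hr hs hpq (fun _ => 0) []
      (fun i h1 h2 => by simp at h2; omega) (by simpa using hlen)).mono le_rfl
      fun _ _ h => by simpa using h.2
  obtain ⟨t₁, M₁, r₁, ht₁, hrel, hin, hbits⟩ := hgen.run_relocate hinp hc
  have hbl := one_le_bitLen (x.bound r s)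
  obtain ⟨t₂, M₂, r₂, ht₂, hM₂⟩ := run_testMap (by omega) hbits
  refine ⟨_, M₂, r₁.seq r₂, ?_, ?_⟩
  · generalize x.bound r s = B at *
    generalize (x.gadget r s).toInstance.p + (x.gadget r s).toInstance.q = S at *
    have h2 : bitLen B ≤ S * bitLen B := Nat.le_mul_of_pos_left _ hpq
    have h3 : bitLen B + t₁ ≤ ((genMap r s).budget + 1) * (S * bitLen B) + c.slowdown * t + 1 := by
      rw [add_mul, one_mul, ← mul_assoc]; omega
    have h4 := Nat.mul_le_mul_left testMap.units h3
    rw [add_mul, one_mul]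
    omega
  · have e0 := hin 0 le_rfl
    rw [init_encode_zero] at e0
    have e1 : M₁ (-2) = M 0 := hrel 0
    have e2 : M₁ (-8) = M 1 := hrel 1
    rw [e0, e1, e2] at hM₂
    have h1' : (0 : ℝ) < M 1 := by exact_mod_cast h1
    have hn1 : (1 : ℝ) ≤ x.n := by exact_mod_cast hn
    constructor
    · intro hy
      have ho := gadget_opt_le (r := r) (s := s) hn hm hr hs hy
      rw [hM₂, if_pos]
      rw [div_le_iff₀ h1'] at hge
      have h5 : (M 0 : ℝ) < 30000 * x.n * M 1 := by
        refine hge.trans_lt ((mul_lt_mul_iff_left₀ h1').2 ?_)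
        nlinarith
      have h6 : M 0 < 30000 * x.n * M 1 := by exact_mod_cast h5
      omega
    · intro hy
      have ho := gadget_opt_ge (r := r) (s := s) hn hm hr hs hy
      rw [hM₂, if_neg]
      have h5 := ho.trans hle
      rw [le_div_iff₀ h1'] at h5
      have h6 : 3 * (10000 * (x.n : ℤ)) * M 1 ≤ M 0 := by exact_mod_cast h5
      have h7 : 30000 * (x.n : ℤ) * M 1 = 3 * (10000 * (x.n : ℤ)) * M 1 := by ring
      omega

end

end OVInstance

/-! ### Running times -/

theorem RAM.bitLen_le_rpow {η : ℝ} (hη : 0 < η) :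
    ∃ C : ℝ, 0 ≤ C ∧ ∀ k : ℕ, 1 ≤ k → (RAM.bitLen k : ℝ) ≤ C * (k : ℝ) ^ η := by
  have hl : 0 < Real.log 2 := Real.log_pos (by norm_num)
  refine ⟨2 + 1 / (η * Real.log 2), by positivity, fun k hk => ?_⟩
  have hk' : (1 : ℝ) ≤ k := by exact_mod_cast hk
  have h1 : (1 : ℝ) ≤ (k : ℝ) ^ η := Real.one_le_rpow hk' hη.le
  have hs : 0 < k.size := Nat.size_pos.2 hk
  have h2 : 2 ^ (k.size - 1) ≤ k := Nat.lt_size.1 (by omega)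
  have h3 : ((2 : ℝ)) ^ (k.size - 1) ≤ k := by exact_mod_cast h2
  have h4 := Real.log_le_log (by positivity) h3
  rw [Real.log_pow, Nat.cast_sub hs, Nat.cast_one] at h4
  have h5 := Real.log_le_rpow_div (x := k) (by positivity) hη
  have h6 : (k.size : ℝ) - 1 ≤ (k : ℝ) ^ η / (η * Real.log 2) := by
    rw [← div_div, le_div_iff₀ hl]; linarith
  have h7 : (RAM.bitLen k : ℝ) = k.size + 1 := by simp [RAM.bitLen]
  rw [h7, add_mul, div_mul_eq_mul_div, one_mul]
  linarith

/-- Since `m` is about `n ^ γ`, the numbers `n` and `m` are about the powers of `n * m` with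
exponents `1 / (1 + γ)` and `γ / (1 + γ)`, both below `1`. Work linear in `n + m` is thus
polynomially smaller than `n * m`. -/
theorem exists_le_mul_rpow {γ c₁ c₂ : ℝ} (hγ : 0 < γ) (hc₁ : 0 < c₁) (hc₂ : 0 < c₂) :
    ∃ θ C : ℝ, 0 < θ ∧ θ < 1 ∧ 0 ≤ C ∧ ∀ n m : ℕ, 0 < n → 0 < m → c₁ * (n : ℝ) ^ γ ≤ m →
      (m : ℝ) ≤ c₂ * (n : ℝ) ^ γ →
      (n : ℝ) ≤ C * ((n : ℝ) * m) ^ θ ∧ (m : ℝ) ≤ C * ((n : ℝ) * m) ^ θ := by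
  have hγ1 : 0 < 1 + γ := by linarith
  have hθ₁ : 1 / (1 + γ) < 1 := by rw [div_lt_one hγ1]; linarith
  have hθ₂ : γ / (1 + γ) < 1 := by rw [div_lt_one hγ1]; linarith
  refine ⟨max (1 / (1 + γ)) (γ / (1 + γ)), max ((1 / c₁) ^ (1 / (1 + γ)))
    (c₂ * ((1 / c₁) ^ (1 / (1 + γ))) ^ γ), lt_max_of_lt_left (by positivity), max_lt hθ₁ hθ₂,
    le_max_of_le_left (by positivity), fun n m hn hm h1 h2 => ?_⟩
  have hn' : (1 : ℝ) ≤ n := by exact_mod_cast hn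
  have hm' : (1 : ℝ) ≤ m := by exact_mod_cast hm
  have hN : 1 ≤ (n : ℝ) * m := one_le_mul_of_one_le_of_one_le hn' hm'
  have h3 : (n : ℝ) ^ (1 + γ) ≤ 1 / c₁ * (n * m) := by
    rw [Real.rpow_add (by linarith), Real.rpow_one, one_div_mul_eq_div, le_div_iff₀ hc₁]
    nlinarith
  have h4 : (n : ℝ) ≤ (1 / c₁) ^ (1 / (1 + γ)) * ((n : ℝ) * m) ^ (1 / (1 + γ)) := by
    have := Real.rpow_le_rpow (by positivity) h3 (show 0 ≤ 1 / (1 + γ) by positivity)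
    rwa [← Real.rpow_mul (by positivity), mul_one_div_cancel hγ1.ne', Real.rpow_one,
      Real.mul_rpow (by positivity) (by positivity)] at this
  constructor
  · refine h4.trans (mul_le_mul (le_max_left _ _)
      (Real.rpow_le_rpow_of_exponent_le hN (le_max_left _ _)) (by positivity)
      (le_max_of_le_left (by positivity)))
  · have h5 : (m : ℝ) ≤ c₂ * ((1 / c₁) ^ (1 / (1 + γ))) ^ γ * ((n : ℝ) * m) ^ (γ / (1 + γ)) := by
      refine h2.trans ?_
      have := Real.rpow_le_rpow (by positivity) h4 hγ.le
      rw [Real.mul_rpow (by positivity) (by positivity), ← Real.rpow_mul (x := n * m)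
        (by positivity), one_div_mul_eq_div] at this
      rw [mul_assoc]
      exact mul_le_mul_of_nonneg_left this hc₂.le
    refine h5.trans (mul_le_mul (le_max_right _ _)
      (Real.rpow_le_rpow_of_exponent_le hN (le_max_right _ _)) (by positivity)
      (le_max_of_le_left (by positivity)))

theorem MapMatchingApproxIn.mono {ρ : ℝ} {κ : ℕ} {R R' : ℕ → ℕ → Prop} {T T' : ℕ → ℕ → ℝ}
    (h : MapMatchingApproxIn ρ κ R T) (hR : ∀ p q, 1 ≤ p → 1 ≤ q → R' p q → R p q)
    (hT : ∀ p q, 1 ≤ p → 1 ≤ q → R' p q → T p q ≤ T' p q) :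
    MapMatchingApproxIn ρ κ R' T' := by
  obtain ⟨c, hc⟩ := h
  refine ⟨c, fun I hI hb hr => ?_⟩
  have hp : 1 ≤ I.p := by
    obtain ⟨v⟩ := hI.connected.nonempty
    have := v.2
    unfold MapInstance.p
    omega
  have hq : 1 ≤ I.q := List.length_pos_iff.2 hI.traj_ne_nil
  obtain ⟨t, M, h1, h2, h3⟩ := hc I hI hb (hR _ _ hp hq hr)
  exact ⟨t, M, h1, h2.trans (hT _ _ hp hq hr), h3⟩

/-- The sizes in the reduction of OV to map matching. -/
theorem reduction_time_le {r s : ℕ} {γ c₁ c₂ δ : ℝ} (hγ : 0 < γ) (hc₁ : 0 < c₁) (hc₂ : 0 < c₂)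
    (hδ : 0 < δ) : ∃ (δ' C : ℝ) (a : ℕ), 0 < δ' ∧ δ' ≤ 1 ∧ 0 ≤ C ∧ ∀ n m d : ℕ, 0 < n → 0 < m →
      c₁ * (n : ℝ) ^ γ ≤ m → (m : ℝ) ≤ c₂ * (n : ℝ) ^ γ → ∀ p q : ℕ,
      p = n * (1001 * (2 * d + 1) ^ s) → q = m * (4 * (2 * d + 1) ^ r) →
      (((p + q) * RAM.bitLen ((p + q) ^ 2 : ℕ) : ℕ) : ℝ) ≤
          C * ((n : ℝ) * m) ^ (1 - δ') * ((d : ℝ) + 1) ^ a ∧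
        ((p : ℝ) * q) ^ (1 - δ) ≤ C * ((n : ℝ) * m) ^ (1 - δ') * ((d : ℝ) + 1) ^ a := by
  obtain ⟨θ, C₀, hθ0, hθ1, hC₀, hθ⟩ := exists_le_mul_rpow hγ hc₁ hc₂
  -- Then `θ * (1 + η) ≤ θ + η = 1 - η`: a logarithmic factor, bounded by a power with exponent `η`,
  -- still leaves a saving.
  set η : ℝ := (1 - θ) / 2 with hη
  have hη0 : 0 < η := by rw [hη]; linarith
  obtain ⟨C₁, hC₁, hbit⟩ := RAM.bitLen_le_rpow (half_pos hη0)
  -- The saving is limited by that of the given algorithm and by that of the generation; `1 / 2`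
  -- keeps the exponent `1 - δ'` positive even for large `δ`.
  set δ' : ℝ := min (min δ (1 / 2)) η with hδ'
  have hδ'1 : δ' ≤ δ := (min_le_left _ _).trans (min_le_left _ _)
  have hδ'2 : δ' ≤ 1 / 2 := (min_le_left _ _).trans (min_le_right _ _)
  have hδ'3 : δ' ≤ η := min_le_right _ _
  have hδ'0 : 0 < δ' := lt_min (lt_min hδ (by norm_num)) hη0
  set E : ℝ := 1005 * C₀ * 2 ^ (r + s) with hE
  have hE0 : 0 ≤ E := by positivity
  refine ⟨δ', C₁ * E ^ (1 + η) + 4004 * 2 ^ (r + s), 2 * (r + s), hδ'0, by linarith, by positivity, ?_⟩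
  rintro n m d hn hm h1 h2 p q hp hq
  obtain ⟨h3, h4⟩ := hθ n m hn hm h1 h2
  have hn' : (1 : ℝ) ≤ n := by exact_mod_cast hn
  have hm' : (1 : ℝ) ≤ m := by exact_mod_cast hm
  have hN : 1 ≤ (n : ℝ) * m := one_le_mul_of_one_le_of_one_le hn' hm'
  have hd : (1 : ℝ) ≤ d + 1 := by linarith [Nat.cast_nonneg (α := ℝ) d]
  have hD0 : (1 : ℝ) ≤ 2 * d + 1 := by linarith [Nat.cast_nonneg (α := ℝ) d]
  have hD : (2 * d + 1 : ℝ) ≤ 2 * (d + 1) := by linarith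
  have hDr : (2 * d + 1 : ℝ) ^ r ≤ 2 ^ (r + s) * (d + 1) ^ (r + s) := by
    rw [← mul_pow]
    exact (pow_le_pow_right₀ hD0 (Nat.le_add_right _ _)).trans (pow_le_pow_left₀ (by linarith) hD _)
  have hDs : (2 * d + 1 : ℝ) ^ s ≤ 2 ^ (r + s) * (d + 1) ^ (r + s) := by
    rw [← mul_pow]
    exact (pow_le_pow_right₀ hD0 (Nat.le_add_left _ _)).trans (pow_le_pow_left₀ (by linarith) hD _)
  have hDrs : (2 * d + 1 : ℝ) ^ (r + s) ≤ 2 ^ (r + s) * (d + 1) ^ (r + s) := by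
    rw [← mul_pow]
    exact pow_le_pow_left₀ (by linarith) hD _
  have hp' : (p : ℝ) = n * (1001 * (2 * d + 1) ^ s) := by rw [hp]; push_cast; ring
  have hq' : (q : ℝ) = m * (4 * (2 * d + 1) ^ r) := by rw [hq]; push_cast; ring
  have hdd : (1 : ℝ) ≤ (d + 1) ^ (r + s) := one_le_pow₀ hd
  have hS1 : 1 ≤ p + q := by
    have : 1 ≤ p := by rw [hp]; exact Nat.mul_pos hn (by positivity)
    omega
  have hNθ : (0 : ℝ) ≤ ((n : ℝ) * m) ^ θ := by positivity
  set W : ℝ := (d + 1) ^ (r + s) with hW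
  constructor
  · have hS : ((p + q : ℕ) : ℝ) ≤ E * ((n : ℝ) * m) ^ θ * W := by
      push_cast
      rw [hp', hq']
      have e1 : (n : ℝ) * (1001 * (2 * d + 1) ^ s) ≤
          C₀ * ((n : ℝ) * m) ^ θ * (1001 * (2 ^ (r + s) * W)) := by gcongr
      have e2 : (m : ℝ) * (4 * (2 * d + 1) ^ r) ≤
          C₀ * ((n : ℝ) * m) ^ θ * (4 * (2 ^ (r + s) * W)) := by gcongr
      calc _ ≤ _ := add_le_add e1 e2
        _ = _ := by rw [hE]; ring
    have hb := hbit ((p + q) ^ 2) (Nat.one_le_pow _ _ hS1)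
    have hS1' : (1 : ℝ) ≤ ((p + q : ℕ) : ℝ) := by exact_mod_cast hS1
    have hpow : ((((p + q) ^ 2 : ℕ)) : ℝ) ^ (η / 2) = ((p + q : ℕ) : ℝ) ^ η := by
      rw [Nat.cast_pow, ← Real.rpow_natCast, ← Real.rpow_mul (by positivity), Nat.cast_two,
        mul_div_cancel₀ _ (two_ne_zero' ℝ)]
    rw [hpow] at hb
    have e3 : (((p + q) * RAM.bitLen ((p + q) ^ 2 : ℕ) : ℕ) : ℝ) ≤
        C₁ * ((p + q : ℕ) : ℝ) ^ (1 + η) := by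
      rw [Nat.cast_mul, Real.rpow_add (by linarith), Real.rpow_one]
      calc _ ≤ ((p + q : ℕ) : ℝ) * (C₁ * ((p + q : ℕ) : ℝ) ^ η) := by gcongr
        _ = _ := by ring
    have e4 : ((p + q : ℕ) : ℝ) ^ (1 + η) ≤ E ^ (1 + η) * ((n : ℝ) * m) ^ (1 - δ') * W ^ 2 := by
      refine (Real.rpow_le_rpow (by positivity) hS (by linarith)).trans ?_
      rw [Real.mul_rpow (by positivity) (by positivity), Real.mul_rpow hE0 hNθ,
        ← Real.rpow_mul (by positivity)]
      have e5 : ((n : ℝ) * m) ^ (θ * (1 + η)) ≤ ((n : ℝ) * m) ^ (1 - δ') := by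
        refine Real.rpow_le_rpow_of_exponent_le hN ?_
        have : θ * η ≤ 1 * η := mul_le_mul_of_nonneg_right hθ1.le hη0.le
        rw [hη] at *
        linarith
      have e6 : W ^ (1 + η) ≤ W ^ 2 := by
        rw [← Real.rpow_natCast]
        refine Real.rpow_le_rpow_of_exponent_le hdd ?_
        rw [hη]; push_cast; linarith
      gcongr
    calc _ ≤ C₁ * (E ^ (1 + η) * ((n : ℝ) * m) ^ (1 - δ') * W ^ 2) :=
          e3.trans (mul_le_mul_of_nonneg_left e4 hC₁)
      _ = C₁ * E ^ (1 + η) * ((n : ℝ) * m) ^ (1 - δ') * ((d : ℝ) + 1) ^ (2 * (r + s)) := by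
          rw [hW, ← pow_mul, mul_comm (r + s) 2]; ring
      _ ≤ _ := by
          gcongr
          exact le_add_of_nonneg_right (by positivity)
  · have hpq : (p : ℝ) * q = 4004 * (2 * d + 1) ^ (r + s) * ((n : ℝ) * m) := by
      rw [hp', hq', pow_add]; ring
    have hpq1 : 1 ≤ (p : ℝ) * q := by
      rw [hpq]
      have := one_le_pow₀ hD0 (n := r + s)
      nlinarith [one_le_mul_of_one_le_of_one_le this hN]
    have hF : (1 : ℝ) ≤ 4004 * (2 * d + 1) ^ (r + s) := by
      have := one_le_pow₀ hD0 (n := r + s)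
      linarith
    calc ((p : ℝ) * q) ^ (1 - δ) ≤ ((p : ℝ) * q) ^ (1 - δ') :=
          Real.rpow_le_rpow_of_exponent_le hpq1 (by linarith)
      _ = (4004 * (2 * d + 1) ^ (r + s)) ^ (1 - δ') * ((n : ℝ) * m) ^ (1 - δ') := by
          rw [hpq, Real.mul_rpow (by positivity) (by positivity)]
      _ ≤ (4004 * (2 * d + 1) ^ (r + s)) ^ (1 : ℝ) * ((n : ℝ) * m) ^ (1 - δ') := by
          gcongr
          linarith
      _ ≤ 4004 * (2 ^ (r + s) * W) * ((n : ℝ) * m) ^ (1 - δ') := by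
          rw [Real.rpow_one]; gcongr
      _ ≤ 4004 * (2 ^ (r + s) * (W * W)) * ((n : ℝ) * m) ^ (1 - δ') := by
          gcongr
          exact le_mul_of_one_le_left (by positivity) hdd
      _ = 4004 * 2 ^ (r + s) * ((n : ℝ) * m) ^ (1 - δ') * ((d : ℝ) + 1) ^ (2 * (r + s)) := by
          rw [hW, two_mul, pow_add]; ring
      _ ≤ _ := by
          gcongr
          exact le_add_of_nonneg_left (by positivity)

/-- Approximate map matching in the given time would yield a fast algorithm for OV. -/
theorem OVH.not_mapMatchingApproxIn (h : OVH) {g : ℚ} {c₁ c₂ δ C : ℝ} {κ : ℕ} (hg : 0 < g)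
    (hc₁ : 0 < c₁) (hc₂ : c₁ < c₂) (hκ : 2 ≤ κ) (hδ : 0 < δ) :
    ¬ MapMatchingApproxIn 2.999 κ
      (fun p q => c₁ * (p : ℝ) ^ (g : ℝ) ≤ q ∧ (q : ℝ) ≤ c₂ * (p : ℝ) ^ (g : ℝ))
      (fun p q => C * ((p : ℝ) * q) ^ (1 - δ)) := by
  rintro ⟨c, hc⟩
  obtain ⟨r, hr⟩ := Int.eq_ofNat_of_zero_le (Rat.num_pos.2 hg).le
  obtain ⟨s, hs⟩ : ∃ s, s = g.den := ⟨_, rfl⟩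
  have hs1 : 1 ≤ s := hs ▸ g.den_pos
  have hr1 : 1 ≤ r := by have := Rat.num_pos.2 hg; omega
  have hgr : (g : ℝ) = r / s := by
    rw [Rat.cast_def, hr, hs]; simp
  have hg' : (0 : ℝ) < g := by exact_mod_cast hg
  -- Since `s * g = r`, the power `p ^ g` is `1001 ^ g * n ^ g * (2 * d + 1) ^ r`, and `q` is `4 * m
  -- * (2 * d + 1) ^ r`. The dimension cancels, and the window for `q` corresponds to the window for
  -- `m` with both constants multiplied by `k`.
  set k : ℝ := (1001 : ℝ) ^ (g : ℝ) / 4 with hk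
  have hk0 : 0 < k := by positivity
  have hc₂' : 0 < c₂ := hc₁.trans hc₂
  obtain ⟨δ', C', a, hδ', hδ'1, hC', htime⟩ := reduction_time_le (r := r) (s := s) hg'
    (mul_pos hc₁ hk0) (mul_pos hc₂' hk0) hδ
  refine h g (c₁ * k) (c₂ * k) δ' hg (mul_pos hc₁ hk0) (mul_lt_mul_of_pos_right hc₂ hk0) hδ'
    ⟨(OVInstance.testMap.units + 1) * (((OVInstance.genMap r s).budget + 1) * C' +
      c.slowdown * (|C| * C')) + (OVInstance.testMap.units + 2), a,
      OVInstance.viaMap r s c, ?_⟩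
  rintro x ⟨hn, hm, h1, h2⟩
  have hp := OVInstance.p_gadget (x := x) (r := r) hn hs1
  have hq := OVInstance.q_gadget (x := x) (r := r) (s := s)
  have hpg : 4 * k * (x.n : ℝ) ^ (g : ℝ) * (2 * x.d + 1) ^ r =
      ((x.gadget r s).toInstance.p : ℝ) ^ (g : ℝ) := by
    have hs0 : (s : ℝ) ≠ 0 := by positivity
    rw [hp]
    push_cast
    rw [Real.mul_rpow (by positivity) (by positivity), Real.mul_rpow (by positivity)
      (by positivity), ← Real.rpow_natCast _ s, ← Real.rpow_mul (by positivity), hk]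
    rw [show (s : ℝ) * (g : ℝ) = r by rw [hgr]; field_simp, Real.rpow_natCast]
    ring
  have hD : (0 : ℝ) ≤ 4 * (2 * x.d + 1) ^ r := by positivity
  obtain ⟨t, M, hrun, ht, h3, h4, h5⟩ := hc (x.gadget r s).toInstance
    (Gadget.valid (OVInstance.gadget_good hn hm hr1 hs1))
    (OVInstance.gadget_bounded hn hm hr1 hs1 hκ) (by
      beta_reduce
      rw [← hpg, hq]
      push_cast
      have e1 := mul_le_mul_of_nonneg_right h1 hD
      have e2 := mul_le_mul_of_nonneg_right h2 hD
      constructor <;> linarith)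
  obtain ⟨t', M', hrun', ht', hyes, hno⟩ := OVInstance.viaMap_spec hn hm hr1 hs1 hrun h3 h4 h5
  refine ⟨t', M', hrun', ?_, hyes, hno⟩
  obtain ⟨e1, e2⟩ := htime x.n x.m x.d hn hm h1 h2 _ _ hp hq
  have ht'' : (t' : ℝ) ≤ (OVInstance.testMap.units + 1) * (((OVInstance.genMap r s).budget + 1) *
      ((((x.gadget r s).toInstance.p + (x.gadget r s).toInstance.q) *
        RAM.bitLen (((x.gadget r s).toInstance.p + (x.gadget r s).toInstance.q) ^ 2 : ℕ) : ℕ) : ℝ) +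
        c.slowdown * t + 1) + 1 := by exact_mod_cast ht'
  have hn' : (1 : ℝ) ≤ x.n := by exact_mod_cast hn
  have hm' : (1 : ℝ) ≤ x.m := by exact_mod_cast hm
  have ht2 : (t : ℝ) ≤ |C| * (C' * ((x.n : ℝ) * x.m) ^ (1 - δ') * ((x.d : ℝ) + 1) ^ a) :=
    ht.trans ((mul_le_mul_of_nonneg_right (le_abs_self C) (by positivity)).trans
      (mul_le_mul_of_nonneg_left e2 (abs_nonneg C)))
  have hZ : 1 ≤ ((x.n : ℝ) * x.m) ^ (1 - δ') * ((x.d : ℝ) + 1) ^ a :=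
    one_le_mul_of_one_le_of_one_le (Real.one_le_rpow (one_le_mul_of_one_le_of_one_le hn' hm')
      (by linarith)) (one_le_pow₀ (by linarith [Nat.cast_nonneg (α := ℝ) x.d]))
  beta_reduce
  rw [mul_assoc] at e1 ht2 ⊢
  generalize ((x.n : ℝ) * x.m) ^ (1 - δ') * ((x.d : ℝ) + 1) ^ a = Z at *
  refine ht''.trans ?_
  have e3 := mul_le_mul_of_nonneg_left e1
    (show (0 : ℝ) ≤ (OVInstance.genMap r s).budget + 1 by positivity)
  have e4 := mul_le_mul_of_nonneg_left ht2 (Nat.cast_nonneg (α := ℝ) c.slowdown)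
  have hu : (0 : ℝ) ≤ OVInstance.testMap.units := Nat.cast_nonneg _
  have e5 := mul_le_mul_of_nonneg_left (add_le_add e3 e4)
    (show (0 : ℝ) ≤ OVInstance.testMap.units + 1 by positivity)
  have e6 := mul_le_mul_of_nonneg_left hZ
    (show (0 : ℝ) ≤ OVInstance.testMap.units + 2 by positivity)
  linarith

theorem OVH.lowerBound (h : OVH) {γ ε c₁ c₂ : ℝ} (hγ : 0 < γ) (hε : 0 ≤ ε)
    (hεγ : ε = 0 → ∃ r : ℚ, γ = r) (hc₁ : 0 < c₁) (hc₂ : c₁ < c₂) {κ : ℕ} (hκ : 2 ≤ κ) {δ : ℝ}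
    (hδ : 0 < δ) (C : ℝ) :
    ¬ MapMatchingApproxIn 2.999 κ
      (fun p q => c₁ * (p : ℝ) ^ (γ - ε) ≤ q ∧ (q : ℝ) ≤ c₂ * (p : ℝ) ^ (γ + ε))
      (fun p q => C * ((p : ℝ) * q) ^ (1 - δ)) := by
  -- A rational exponent inside the allowed range; for `p ≥ 1` its narrower window lies in the given
  -- one.
  obtain ⟨g, hg0, hg1, hg2⟩ : ∃ g : ℚ, 0 < g ∧ γ - ε ≤ g ∧ (g : ℝ) ≤ γ + ε := by
    rcases hε.eq_or_lt with h0 | h0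
    · obtain ⟨g, rfl⟩ := hεγ h0.symm
      exact ⟨g, by exact_mod_cast hγ, by linarith, by linarith⟩
    · obtain ⟨g, h1, h2⟩ := exists_rat_btwn (show γ < γ + ε by linarith)
      exact ⟨g, by exact_mod_cast hγ.trans h1, by linarith, h2.le⟩
  intro hm
  refine h.not_mapMatchingApproxIn (C := C) hg0 hc₁ hc₂ hκ hδ (hm.mono ?_ fun _ _ _ _ _ => le_rfl)
  rintro p q hp - ⟨h1, h2⟩
  have hp' : (1 : ℝ) ≤ p := by exact_mod_cast hp
  exact ⟨(mul_le_mul_of_nonneg_left (Real.rpow_le_rpow_of_exponent_le hp' hg1) hc₁.le).trans h1,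
    h2.trans (mul_le_mul_of_nonneg_left (Real.rpow_le_rpow_of_exponent_le hp' hg2)
      (hc₁.trans hc₂).le)⟩

/-- Half of the saving pays for the logarithm, as `P + 1 ≤ 2 * (P * Q)`. The absolute value allows
for a negative `C`. -/
theorem log_bound_le {C δ P Q : ℝ} (hδ : 0 < δ) (hP : 1 ≤ P) (hQ : 1 ≤ Q) :
    C * (P * Q * Real.log (P + 1)) / (P * Q) ^ δ ≤
      |C| * (2 ^ (δ / 2) / (δ / 2)) * (P * Q) ^ (1 - δ / 2) := by
  have hη : 0 < δ / 2 := half_pos hδ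
  have hPQ : 0 < P * Q := by positivity
  have h1 : Real.log (P + 1) ≤ 2 ^ (δ / 2) / (δ / 2) * (P * Q) ^ (δ / 2) := by
    refine (Real.log_le_rpow_div (by linarith) hη).trans ?_
    rw [div_mul_eq_mul_div, ← Real.mul_rpow (by norm_num) hPQ.le]
    gcongr
    nlinarith
  have h2 : (P * Q) ^ (1 - δ / 2) = P * Q * (P * Q) ^ (δ / 2) / (P * Q) ^ δ := by
    rw [eq_div_iff (by positivity), ← Real.rpow_add hPQ, ← Real.rpow_one_add' hPQ.le (by linarith)]
    congr 1; ring
  have h3 : 0 ≤ Real.log (P + 1) := Real.log_nonneg (by linarith)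
  rw [h2, mul_div_assoc', div_le_div_iff_of_pos_right (by positivity)]
  calc C * (P * Q * Real.log (P + 1)) ≤ |C| * (P * Q * Real.log (P + 1)) :=
        mul_le_mul_of_nonneg_right (le_abs_self C) (by positivity)
    _ ≤ |C| * (P * Q * (2 ^ (δ / 2) / (δ / 2) * (P * Q) ^ (δ / 2))) := by gcongr
    _ = _ := by ring

theorem OVH.lowerBound_log (h : OVH) {γ ε c₁ c₂ : ℝ} (hγ : 0 < γ) (hε : 0 ≤ ε)
    (hεγ : ε = 0 → ∃ r : ℚ, γ = r) (hc₁ : 0 < c₁) (hc₂ : c₁ < c₂) {κ : ℕ} (hκ : 2 ≤ κ) {δ : ℝ}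
    (hδ : 0 < δ) (C : ℝ) :
    ¬ MapMatchingApproxIn 2.999 κ
      (fun p q => c₁ * (p : ℝ) ^ (γ - ε) ≤ q ∧ (q : ℝ) ≤ c₂ * (p : ℝ) ^ (γ + ε))
      (fun p q => C * ((p : ℝ) * q * Real.log (p + 1)) / ((p : ℝ) * q) ^ δ) := fun hm =>
  h.lowerBound hγ hε hεγ hc₁ hc₂ hκ (half_pos hδ) (|C| * (2 ^ (δ / 2) / (δ / 2)))
    (hm.mono (fun _ _ _ _ h => h) fun p q hp hq _ =>
      log_bound_le hδ (by exact_mod_cast hp) (by exact_mod_cast hq))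

/-- The shape in which two nested loops generate a matrix. -/
theorem rowMajor_eq_flatMap (n d : ℕ) (f : ℕ → ℕ → ℤ) :
    rowMajor (fun (i : Fin n) (k : Fin d) => f i k) =
      (List.range n).flatMap fun i => (List.range d).flatMap fun k => [f i k] := by
  have h : ∀ (m : ℕ) (g : ℕ → List ℤ), (List.range m).flatMap g =
      (List.ofFn fun i : Fin m => g i).flatten := by
    intro m g
    induction m with
    | zero => simp
    | succ m ih => rw [List.range_succ, List.flatMap_append, ih, List.ofFn_succ_last]; simp
  have h' : ∀ (m : ℕ) (g : ℕ → ℤ), (List.range m).flatMap (fun k => [g k]) =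
      List.ofFn fun i : Fin m => g i := by
    intro m g
    induction m with
    | zero => simp
    | succ m ih => rw [List.range_succ, List.flatMap_append, ih, List.ofFn_succ_last]; simp
  rw [rowMajor, List.ofFn_mul, h]
  congr 1
  refine congrArg List.ofFn (funext fun i => ?_)
  rw [h']
  refine congrArg List.ofFn (funext fun k => ?_)
  have hd : 0 < d := k.pos
  simp [Fin.divNat, Fin.modNat, Nat.mul_comm _ d, Nat.mul_add_div hd, Nat.div_eq_of_lt k.2,
    Nat.mod_eq_of_lt k.2]

/-! ### Partial assignments as vectors -/

namespace CNF

variable (φ : CNF)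

/-- The literal of the variable `j` with the value `b` occurs in clause `k`. -/
def Holds (k j : ℕ) (b : Bool) : Prop :=
  ∃ (hk : k < φ.M) (hj : j < φ.N), φ.clause ⟨k, hk⟩ ⟨j, hj⟩ = if b then 1 else -1

open Classical in
/-- Clause `k` has no literal among the `len` variables after `lo` that is satisfied by the bits
of `i`. -/
noncomputable def fails (lo len i k : ℕ) : Bool :=
  decide (∀ j < len, ¬ φ.Holds k (lo + j) (i.testBit j))

/-- The number of variables that are assigned by the first set of vectors. -/
def half (r s : ℕ) : ℕ := s * (φ.N / (r + s))

/-- All variables left over by the division go to the second set of vectors. The additional `r + s`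
rounds make room for them and cost only a constant factor, while both numbers of vectors remain
exact powers up to `u` and `v`. -/
def rounds (r s : ℕ) : ℕ := φ.N / (r + s) + (r + s)

/-- The instance of OV whose vectors are the partial assignments. -/
noncomputable def toOV (r s u v : ℕ) : OVInstance where
  n := u ^ s * (2 ^ s) ^ φ.rounds r s
  m := v * (2 ^ r) ^ φ.rounds r s
  d := φ.M
  A i k := φ.fails 0 (φ.half r s) i k
  B j k := φ.fails (φ.half r s) (φ.N - φ.half r s) j k

variable {φ} {r s u v : ℕ}

theorem half_le (hr : 1 ≤ r) : φ.half r s ≤ φ.N ∧ φ.half r s ≤ s * φ.rounds r s ∧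
    φ.N - φ.half r s ≤ r * φ.rounds r s := by
  have h1 := Nat.div_add_mod φ.N (r + s)
  have h2 := Nat.mod_lt φ.N (show 0 < r + s by omega)
  unfold half rounds
  generalize φ.N / (r + s) = e at *
  rw [add_mul] at h1
  have h3 : 1 * (r + s) ≤ r * (r + s) := Nat.mul_le_mul_right _ hr
  refine ⟨by omega, Nat.mul_le_mul_left _ (by omega), ?_⟩
  rw [Nat.mul_add]; omega

theorem fails_eq_false {lo len i k : ℕ} :
    φ.fails lo len i k = false ↔ ∃ j < len, φ.Holds k (lo + j) (i.testBit j) := by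
  simp [fails]

/-- The binary digits of an index form a partial assignment, and an entry vanishes exactly if the
clause is satisfied by it; orthogonality says that each clause is satisfied by one of the two parts.
Surplus indices are harmless: their higher digits are never read, so they repeat assignments. -/
theorem toOV_hasOrthogonalPair (hr : 1 ≤ r) (hu : 1 ≤ u) (hv : 1 ≤ v) :
    (φ.toOV r s u v).HasOrthogonalPair ↔ φ.Satisfiable := by
  obtain ⟨h1, h2, h3⟩ := half_le (φ := φ) (s := s) hr
  constructor
  · rintro ⟨i, j, h⟩
    refine ⟨fun l => if (l : ℕ) < φ.half r s then (i : ℕ).testBit l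
      else (j : ℕ).testBit (l - φ.half r s), fun k => ?_⟩
    rcases h k with h | h
    · obtain ⟨l, hl, _, hl', hc⟩ := fails_eq_false.1 h
      refine ⟨⟨0 + l, hl'⟩, ?_⟩
      simp only [zero_add] at hc ⊢
      rw [if_pos hl]
      exact hc
    · obtain ⟨l, hl, _, hl', hc⟩ := fails_eq_false.1 h
      refine ⟨⟨φ.half r s + l, hl'⟩, ?_⟩
      simp only [add_lt_iff_neg_left, not_lt_zero, if_false, Nat.add_sub_cancel_left]
      exact hc
  · rintro ⟨y, hy⟩
    let f : Fin (φ.half r s) → Bool := fun l => y ⟨l, by omega⟩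
    let g : Fin (φ.N - φ.half r s) → Bool := fun l => y ⟨φ.half r s + l, by omega⟩
    have hi : Nat.ofBits f < u ^ s * (2 ^ s) ^ φ.rounds r s := by
      rw [← pow_mul]
      calc Nat.ofBits f < 2 ^ φ.half r s := Nat.ofBits_lt_two_pow f
        _ ≤ 2 ^ (s * φ.rounds r s) := Nat.pow_le_pow_right (by omega) h2
        _ ≤ _ := Nat.le_mul_of_pos_left _ (Nat.pow_pos hu)
    have hj : Nat.ofBits g < v * (2 ^ r) ^ φ.rounds r s := by
      rw [← pow_mul]
      calc Nat.ofBits g < 2 ^ (φ.N - φ.half r s) := Nat.ofBits_lt_two_pow g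
        _ ≤ 2 ^ (r * φ.rounds r s) := Nat.pow_le_pow_right (by omega) h3
        _ ≤ _ := Nat.le_mul_of_pos_left _ hv
    refine ⟨⟨_, hi⟩, ⟨_, hj⟩, fun k => ?_⟩
    obtain ⟨l, hl⟩ := hy k
    rcases lt_or_ge (l : ℕ) (φ.half r s) with h | h
    · refine .inl (fails_eq_false.2 ⟨l, h, k.2, by simp, ?_⟩)
      simp only [zero_add, Nat.testBit_ofBits_lt f l h]
      exact hl
    · refine .inr (fails_eq_false.2 ⟨l - φ.half r s, by omega, k.2, by omega, ?_⟩)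
      simp only [Nat.testBit_ofBits_lt g (l - φ.half r s) (by omega), g]
      simp only [Nat.add_sub_cancel' h]
      exact hl

theorem init_encode_zero : RAM.init φ.encode 0 = φ.N := by simp [RAM.init, encode]

theorem init_encode_one : RAM.init φ.encode 1 = φ.M := by simp [RAM.init, encode]

theorem init_encode {k j : ℕ} (hk : k < φ.M) (hj : j < φ.N) :
    RAM.init φ.encode (2 + k * φ.N + j) = (φ.clause ⟨k, hk⟩ ⟨j, hj⟩ : ℤ) := by
  unfold RAM.init
  rw [if_pos (by positivity), show (2 + (k : ℤ) * φ.N + j).toNat = k * φ.N + j + 2 by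
    have : (2 + (k : ℤ) * φ.N + j) = ((k * φ.N + j + 2 : ℕ) : ℤ) := by push_cast; ring
    rw [this, Int.toNat_natCast]]
  exact rowMajor_getD (fun i j => (φ.clause i j : ℤ)) ⟨k, hk⟩ ⟨j, hj⟩

/-- The second factor is the bit written as a sign, so the product is positive exactly if the
literal occurs with that sign. -/
theorem holds_iff {k j : ℕ} (hk : k < φ.M) (hj : j < φ.N) (i l : ℕ) :
    φ.Holds k j (i.testBit l) ↔ 0 < RAM.init φ.encode (2 + k * φ.N + j) *
      (2 * (((i / 2 ^ l : ℕ) : ℤ) - ((i / 2 ^ l : ℕ) : ℤ) / 2 * 2) - 1) := by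
  rw [init_encode hk hj, Nat.testBit_eq_decide_div_mod_eq]
  generalize i / 2 ^ l = q
  simp only [Holds, hk, hj, exists_true_left]
  generalize φ.clause ⟨k, hk⟩ ⟨j, hj⟩ = z
  have hq : (q : ℤ) - (q : ℤ) / 2 * 2 = ((q % 2 : ℕ) : ℤ) := by push_cast; omega
  rw [hq]
  rcases Nat.mod_two_eq_zero_or_one q with h | h <;> rw [h] <;> revert z <;> decide

theorem abs_le_of_mem_encode {z : ℤ} (hz : z ∈ φ.encode) : |z| ≤ ((φ.N + 1) * (φ.M + 1) : ℕ) := by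
  simp only [encode, rowMajor, List.mem_cons, List.mem_ofFn] at hz
  rcases hz with rfl | rfl | ⟨t, rfl⟩
  · rw [Nat.abs_cast]; norm_cast; nlinarith
  · rw [Nat.abs_cast]; norm_cast; nlinarith
  · have h : ∀ z : SignType, |(z : ℤ)| ≤ 1 := by decide
    refine (h _).trans ?_
    exact_mod_cast Nat.mul_pos (Nat.succ_pos _) (Nat.succ_pos _)

end CNF

/-! ### The program that generates the orthogonal vectors instance -/

namespace CNF

open RAM SExpr

/-- The values of the variables in the generation of the instance of OV. -/
def sizes (φ : CNF) (r s : ℕ) : List ℤ :=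
  [φ.N, φ.M, (φ.N / (r + s) : ℕ), φ.half r s, (φ.N - φ.half r s : ℕ)]

noncomputable def counts (φ : CNF) (r s u v : ℕ) : List ℤ :=
  φ.sizes r s ++ [((φ.toOV r s u v).n : ℤ), ((φ.toOV r s u v).m : ℤ)]

/-- The bound for all numbers in the construction. -/
noncomputable def bound (φ : CNF) (r s u v : ℕ) : ℕ :=
  ((φ.toOV r s u v).n + (φ.toOV r s u v).m + 3) * ((φ.N + 1) * (φ.M + 1))

def genSizes (r s : ℕ) : Prog :=
  .seq (.set 1 (inp 0)) <| .seq (.set 2 (inp 1)) <|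
  .seq (.set 3 (var 1 / lit (r + s))) <| .seq (.set 4 (lit s * var 3)) <|
  .set 5 (var 1 - var 4)

/-- Computes `c * b ^ (var 3 + w)` in variable `i`. -/
def genPow (i : ℕ) (c b w : ℤ) : Prog :=
  .seq (.set i (lit c)) (.for (i + 1) (var 3 + lit w) (.set i (var i * lit b)))

/-- Variable `10` holds the index shifted by the number of literals treated, so its lowest bit is
the current one. Variable `11` is the entry: it starts at `1` and is cleared by any satisfied
literal. -/
def genEntry (lo len : SExpr) : Prog :=
  .seq (.set 10 (var 8)) <| .seq (.set 11 1) <|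
  .seq (.for 12 len <|
    .seq (.cond (inp (2 + var 9 * var 1 + (lo + var 12)) * (2 * (var 10 - var 10 / 2 * 2) - 1))
      (.set 11 0) .skip) <|
    .set 10 (var 10 / 2)) <|
  .emit (var 11)

def genRows (n lo len : SExpr) : Prog := .for 8 n (.for 9 (var 2) (genEntry lo len))

/-- The program that generates the instance of OV. -/
def genOV (r s u v : ℕ) : Prog :=
  .seq (genSizes r s) <|
  .seq (genPow 6 (u ^ s : ℕ) (2 ^ s : ℕ) (r + s : ℕ)) <|
  .seq (genPow 7 v (2 ^ r : ℕ) (r + s : ℕ)) <|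
  .seq (.emit (var 6)) <| .seq (.emit (var 7)) <| .seq (.emit (var 2)) <|
  .seq (genRows (var 6) 0 (var 4)) (genRows (var 7) (var 4) (var 5))

section

variable {φ : CNF} {r s u v : ℕ}

/-- Lets the loops that compute the powers be charged to the number of vectors. -/
theorem rounds_le (hr : 1 ≤ r) (hs : 1 ≤ s) (hu : 1 ≤ u) (hv : 1 ≤ v) :
    φ.rounds r s ≤ (φ.toOV r s u v).n ∧ φ.rounds r s ≤ (φ.toOV r s u v).m := by
  have h : ∀ c b k : ℕ, 1 ≤ c → 1 ≤ b → k ≤ c * (2 ^ b) ^ k := fun c b k hc hb =>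
    calc k ≤ 2 ^ k := Nat.lt_two_pow_self.le
      _ ≤ (2 ^ b) ^ k := Nat.pow_le_pow_left (Nat.le_self_pow (by omega) 2) _
      _ ≤ _ := Nat.le_mul_of_pos_left _ hc
  exact ⟨h _ _ _ (Nat.pow_pos hu) hs, h _ _ _ hv hr⟩

theorem le_bound {z : ℕ} (h : z ≤ (φ.toOV r s u v).n + (φ.toOV r s u v).m + 3 ∨ z ≤ φ.N ∨ z ≤ φ.M ∨
    z ≤ (φ.N + 1) * (φ.M + 1)) : z ≤ φ.bound r s u v := by
  unfold bound
  generalize (φ.toOV r s u v).n + (φ.toOV r s u v).m = a at *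
  have h1 : φ.N ≤ (φ.N + 1) * (φ.M + 1) := by nlinarith
  have h2 : φ.M ≤ (φ.N + 1) * (φ.M + 1) := by nlinarith
  have h3 : 1 ≤ (φ.N + 1) * (φ.M + 1) := by nlinarith
  generalize (φ.N + 1) * (φ.M + 1) = b at *
  rcases h with h | h
  · exact h.trans (Nat.le_mul_of_pos_right _ h3)
  · exact le_trans (by omega) (Nat.le_mul_of_pos_left b (by omega : 0 < a + 3))

theorem steps_genSizes (hr : 1 ≤ r) {S : ℕ} :
    Steps (φ.bound r s u v) φ.encode S [] (genSizes r s) (φ.sizes r s) [] := by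
  have hh := (half_le (φ := φ) (s := s) hr).1
  have hB : ∀ z : ℕ, z ≤ φ.N ∨ z ≤ φ.M → |(z : ℤ)| ≤ φ.bound r s u v := by
    intro z hz
    rw [Nat.abs_cast, Nat.cast_le]
    exact le_bound (by tauto)
  refine (Steps.set (a := φ.N) rfl ⟨by simp, by simp, by simp [init_encode_zero]⟩
      (hB _ (.inl le_rfl))).seq <|
    (Steps.set (a := φ.M) rfl ⟨by simp, by simp, by simp [init_encode_one]⟩
      (hB _ (.inr le_rfl))).seq <|
    (Steps.set (a := (φ.N / (r + s) : ℕ)) rfl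
      ⟨by simp, by simp, by simp [env]⟩
      (hB _ (.inl (Nat.div_le_self _ _)))).seq <|
    (Steps.set (a := φ.half r s) rfl
      ⟨by simp, by simp, by simp [env, half]⟩
      (hB _ (.inl hh))).seq <|
    Steps.set (a := (φ.N - φ.half r s : ℕ)) rfl
      ⟨by simp, by simp, by simp [env, Nat.cast_sub hh]⟩ (hB _ (.inl (Nat.sub_le _ _)))

theorem steps_genPow {X S w c b i : ℕ} {inp L : List ℤ} {e : ℕ} (hi : i = L.length + 1)
    (h3 : Value inp L (var 3) e) (hX : c * b ^ (e + w) ≤ X) (hb : 1 ≤ b) (hS : e + w ≤ S)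
    (hS0 : 1 ≤ S) (hX' : e + w ≤ X) :
    Steps X inp S L (genPow i c b w) (L ++ [((c * b ^ (e + w) : ℕ) : ℤ)]) [] := by
  have hle : ∀ j ≤ e + w, |((c * b ^ j : ℕ) : ℤ)| ≤ X := fun j hj => by
    rw [Nat.abs_cast, Nat.cast_le]
    exact (Nat.mul_le_mul_left _ (Nat.pow_le_pow_right hb hj)).trans hX
  have h1 : Steps X inp (1 * S) (L ++ [((c * b ^ 0 : ℕ) : ℤ)])
      (.for (i + 1) (var 3 + lit w) (.set i (var i * lit b)))
      (L ++ [((c * b ^ (e + w) : ℕ) : ℤ)]) ((List.range (e + w)).flatMap fun _ => []) := by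
    have h3L := h3.below
    simp only [below_var] at h3L
    have h3e : env L 3 = e := h3.eval
    refine Steps.for (n := L.length + 1) (fun j => L ++ [((c * b ^ j : ℕ) : ℤ)]) (fun _ => [])
      (by simp) (by omega) hS hX' (fun j hj => ⟨?_, by simp, ?_⟩) ?_
    · simp; omega
    · have : env (L ++ [((c * b ^ j : ℕ) : ℤ)]) 3 = e := by
        rw [← h3e, env, env, List.getD_append _ _ _ _ (by omega)]
      simp only [eval_add, eval_var, eval_lit, this]
      push_cast; rfl
    · intro j hj
      have hv : Value inp (L ++ [((c * b ^ j : ℕ) : ℤ)] ++ [(j : ℤ)])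
          (var i * lit b) ((c * b ^ (j + 1) : ℕ) : ℤ) := by
        refine ⟨by simp [hi], by simp, ?_⟩
        simp [env, hi, pow_succ]; ring
      have h4 := Steps.assign (X := X) (S := 1) (k := L.length) hv (hle _ (by omega))
      rw [← hi] at h4
      simpa [List.set_append] using h4
  have h2 := (Steps.set (X := X) (S := S) (L := L) (e := lit c) (a := ((c * b ^ 0 : ℕ) : ℤ)) hi
    ⟨by simp, by simp, by simp⟩ (hle 0 (Nat.zero_le _))).seq
    (h1.mono (by omega) (by omega))
  have hf : ∀ l : List ℕ, (l.flatMap fun _ => ([] : List ℤ)) = [] := fun l => by simp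
  rw [hf] at h2
  simpa only [genPow, List.append_nil] using h2

/-- The entry of a vector after the literals of the first variables. -/
theorem fails_succ (lo len i k : ℕ) : (φ.fails lo (len + 1) i k = true) ↔
    φ.fails lo len i k = true ∧ ¬ φ.Holds k (lo + len) (i.testBit len) := by
  simp only [fails, decide_eq_true_eq]
  constructor
  · exact fun h => ⟨fun j hj => h j (by omega), h len (by omega)⟩
  · rintro ⟨h1, h2⟩ j hj
    rcases (Nat.lt_succ_iff.1 hj).lt_or_eq with h | rfl
    · exact h1 j h
    · exact h2

theorem steps_genEntry {X i k lo len : ℕ} {e₁ e₂ e₃ e₄ e₅ : ℤ} {eLo eLen : SExpr}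
    (hk : k < φ.M) (hl : lo + len ≤ φ.N) (hi : i ≤ X) (hX : φ.N ≤ X) (hX1 : 1 ≤ X)
    (hlo : ∀ E, Value φ.encode ([(φ.N : ℤ), φ.M, e₁, e₂, e₃, e₄, e₅, i, k] ++ E) eLo lo)
    (hlen : ∀ E, Value φ.encode ([(φ.N : ℤ), φ.M, e₁, e₂, e₃, e₄, e₅, i, k] ++ E) eLen len) :
    Steps X φ.encode (1 * (φ.N + 1)) [(φ.N : ℤ), φ.M, e₁, e₂, e₃, e₄, e₅, i, k]
      (genEntry eLo eLen) [(φ.N : ℤ), φ.M, e₁, e₂, e₃, e₄, e₅, i, k]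
      [if φ.fails lo len i k then 1 else 0] := by
  have hiX : ∀ j, |((i / 2 ^ j : ℕ) : ℤ)| ≤ X := fun j => by
    rw [Nat.abs_cast, Nat.cast_le]
    exact (Nat.div_le_self _ _).trans hi
  have hX1' : (1 : ℤ) ≤ X := by exact_mod_cast hX1
  -- The state after `j` literals: the shifted index and the entry for these literals alone.
  let G : ℕ → List ℤ := fun j => [(φ.N : ℤ), φ.M, e₁, e₂, e₃, e₄, e₅, i, k] ++
    [((i / 2 ^ j : ℕ) : ℤ), if φ.fails lo j i k then 1 else 0]
  have hloop : Steps X φ.encode (1 * (φ.N + 1)) (G 0)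
      (.for 12 eLen <|
        .seq (.cond (inp (2 + var 9 * var 1 + (eLo + var 12)) *
          (2 * (var 10 - var 10 / 2 * 2) - 1)) (.set 11 0) .skip) <|
        .set 10 (var 10 / 2)) (G len) ((List.range len).flatMap fun _ => []) := by
    refine Steps.for (n := 11) G (fun _ => []) (fun _ => rfl) rfl (by omega) (by omega)
      (fun j _ => hlen _) fun j hj => ?_
    have hlo' := hlo ([((i / 2 ^ j : ℕ) : ℤ), if φ.fails lo j i k then 1 else 0] ++ [(j : ℤ)])
    rw [← List.append_assoc] at hlo'
    have hb := hlo'.below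
    have hsf := hlo'.safe
    have hev := hlo'.eval
    simp only [G]
    have hh := holds_iff (φ := φ) hk (j := lo + j) (by omega) i j
    refine (Steps.cond (f := []) (L' := [(φ.N : ℤ), φ.M, e₁, e₂, e₃, e₄, e₅, i, k] ++
      [((i / 2 ^ j : ℕ) : ℤ), if φ.fails lo (j + 1) i k then 1 else 0] ++ [(j : ℤ)])
      (a := RAM.init φ.encode (2 + k * φ.N + (lo + j : ℕ)) *
      (2 * (((i / 2 ^ j : ℕ) : ℤ) - ((i / 2 ^ j : ℕ) : ℤ) / 2 * 2) - 1)) ⟨?_, ?_, ?_⟩ (fun h0 => ?_)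
      fun h0 => ?_).seq (g := []) ?_
    · simp only [below_mul, below_inp, below_add, below_sub, below_div, below_var, below_ofNat]
      refine ⟨⟨by simp, hb, by simp⟩, by simp⟩
    · have : 0 ≤ 2 + (k : ℤ) * φ.N + (lo + j) := by positivity
      simp only [safe_mul, safe_inp, safe_add, safe_sub, safe_div, safe_var, safe_ofNat, eval_add,
        hev]
      refine ⟨⟨by simpa [env] using this, by simp, hsf, trivial⟩, by simp⟩
    · simp only [eval_mul, eval_inp, eval_add, hev]
      simp [env]
    · have hf : φ.fails lo (j + 1) i k = false := by
        rw [← Bool.not_eq_true, fails_succ]; exact fun h => h.2 (hh.2 h0)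
      rw [hf]
      exact Steps.assign (k := 10) ⟨by simp, by simp, by simp⟩ (by simp)
    · have hf : φ.fails lo (j + 1) i k = φ.fails lo j i k := by
        rw [Bool.eq_iff_iff, fails_succ]; exact ⟨fun h => h.1, fun h => ⟨h, fun h' => h0 (hh.1 h')⟩⟩
      rw [hf]
      exact Steps.skip rfl
    · have hdiv : ((i / 2 ^ (j + 1) : ℕ) : ℤ) = ((i / 2 ^ j : ℕ) : ℤ) / 2 := by
        rw [pow_succ, ← Nat.div_div_eq_div_mul]; push_cast; rfl
      refine Steps.assign (k := 9) (a := ((i / 2 ^ (j + 1) : ℕ) : ℤ)) ⟨by simp, by simp, ?_⟩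
        (hiX (j + 1))
      rw [hdiv]
      simp [env]
  refine Steps.drop (E := [((i / 2 ^ len : ℕ) : ℤ), if φ.fails lo len i k then 1 else 0]) ?_
  have h0 : G 0 = [(φ.N : ℤ), φ.M, e₁, e₂, e₃, e₄, e₅, i, k] ++ [(i : ℤ)] ++ [1] := by
    simp [G, fails]
  rw [h0] at hloop
  have hf : ∀ l : List ℕ, (l.flatMap fun _ => ([] : List ℤ)) = [] := fun l => by simp
  rw [hf] at hloop
  have hiX0 := hiX 0
  rw [pow_zero, Nat.div_one] at hiX0
  exact (Steps.set (a := i) rfl ⟨by simp, by simp, by simp [env]⟩ hiX0).seq <|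
    (Steps.set (a := 1) rfl ⟨by simp, by simp, by simp⟩ (by simpa using hX1)).seq <|
    hloop.seq <| Steps.emit ⟨by simp [G], by simp [G], by simp [G, env]⟩ (by split_ifs <;> simp [hX1])

theorem steps_genRows {X R n lo len : ℕ} {e₁ e₂ e₃ e₄ e₅ : ℤ} {en eLo eLen : SExpr}
    (hl : lo + len ≤ φ.N) (hnX : n ≤ X) (hNX : φ.N ≤ X) (hMX : φ.M ≤ X) (hX1 : 1 ≤ X) (hnR : n ≤ R)
    (hn : Value φ.encode [(φ.N : ℤ), φ.M, e₁, e₂, e₃, e₄, e₅] en n)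
    (hlo : ∀ E, Value φ.encode ([(φ.N : ℤ), φ.M, e₁, e₂, e₃, e₄, e₅] ++ E) eLo lo)
    (hlen : ∀ E, Value φ.encode ([(φ.N : ℤ), φ.M, e₁, e₂, e₃, e₄, e₅] ++ E) eLen len) :
    Steps X φ.encode (1 * (φ.N + 1) * (φ.M + 1) * R) [(φ.N : ℤ), φ.M, e₁, e₂, e₃, e₄, e₅]
      (genRows en eLo eLen) [(φ.N : ℤ), φ.M, e₁, e₂, e₃, e₄, e₅]
      ((List.range n).flatMap fun i => (List.range φ.M).flatMap fun k =>
        [if φ.fails lo len i k then 1 else 0]) := by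
  refine Steps.for_const _ rfl hnR hnX hn fun i hi => ?_
  refine Steps.for_const _ rfl (by omega) hMX ⟨by simp, by simp, by simp [env]⟩ fun k hk => ?_
  exact steps_genEntry hk hl (by omega) hNX hX1 (fun E => by simpa using hlo (i :: k :: E))
    fun E => by simpa using hlen (i :: k :: E)

theorem encode_toOV (φ : CNF) (r s u v : ℕ) : (φ.toOV r s u v).encode =
    [((φ.toOV r s u v).n : ℤ)] ++ ([((φ.toOV r s u v).m : ℤ)] ++ ([(φ.M : ℤ)] ++
    (((List.range (φ.toOV r s u v).n).flatMap fun i => (List.range φ.M).flatMap fun k =>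
      [if φ.fails 0 (φ.half r s) i k then 1 else 0]) ++
    ((List.range (φ.toOV r s u v).m).flatMap fun j => (List.range φ.M).flatMap fun k =>
      [if φ.fails (φ.half r s) (φ.N - φ.half r s) j k then 1 else 0])))) := by
  have h1 := rowMajor_eq_flatMap (φ.toOV r s u v).n φ.M
    fun i k => if φ.fails 0 (φ.half r s) i k then 1 else 0
  have h2 := rowMajor_eq_flatMap (φ.toOV r s u v).m φ.M
    fun i k => if φ.fails (φ.half r s) (φ.N - φ.half r s) i k then 1 else 0
  rw [← h1, ← h2]
  simp only [OVInstance.encode, List.cons_append, List.nil_append]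
  rfl

/-- The number of steps of the reduction of satisfiability to OV. -/
noncomputable def work (φ : CNF) (r s u v : ℕ) : ℕ :=
  (φ.N + 1) * (φ.M + 1) * ((φ.toOV r s u v).n + (φ.toOV r s u v).m)

theorem steps_genOV (hr : 1 ≤ r) (hs : 1 ≤ s) (hu : 1 ≤ u) (hv : 1 ≤ v) :
    Steps (φ.bound r s u v) φ.encode (φ.work r s u v) [] (genOV r s u v) (φ.counts r s u v)
      (φ.toOV r s u v).encode := by
  obtain ⟨hrn, hrm⟩ := rounds_le (φ := φ) hr hs hu hv
  have hh := half_le (φ := φ) (s := s) hr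
  have hB := fun z => le_bound (φ := φ) (r := r) (s := s) (u := u) (v := v) (z := z)
  have hnX := hB _ (.inl (show (φ.toOV r s u v).n ≤ _ by omega))
  have hmX := hB _ (.inl (show (φ.toOV r s u v).m ≤ _ + (φ.toOV r s u v).m + 3 by omega))
  have hNX := hB φ.N (.inr (.inl le_rfl))
  have hMX := hB φ.M (.inr (.inr (.inl le_rfl)))
  have h1X := hB 1 (.inl (by omega))
  have hr0 : 1 ≤ φ.rounds r s := le_trans (by omega) (Nat.le_add_left (r + s) _)
  have hwork : (φ.toOV r s u v).n + (φ.toOV r s u v).m ≤ φ.work r s u v :=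
    Nat.le_mul_of_pos_left _ (by positivity)
  have hcast : ∀ {z : ℕ}, z ≤ φ.bound r s u v → |(z : ℤ)| ≤ φ.bound r s u v := fun {z} hz => by
    rw [Nat.abs_cast, Nat.cast_le]; exact hz
  have h1 : Steps (φ.bound r s u v) φ.encode (φ.work r s u v) (φ.sizes r s)
      (genPow 6 (u ^ s : ℕ) (2 ^ s : ℕ) (r + s : ℕ))
      (φ.sizes r s ++ [((φ.toOV r s u v).n : ℤ)]) [] :=
    steps_genPow (e := φ.N / (r + s)) rfl ⟨by simp [sizes], by simp, by simp [sizes, env]⟩ hnX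
      (Nat.one_le_two_pow) (by change φ.rounds r s ≤ _; omega) (by omega)
      (by change φ.rounds r s ≤ _; omega)
  have h2 : Steps (φ.bound r s u v) φ.encode (φ.work r s u v)
      (φ.sizes r s ++ [((φ.toOV r s u v).n : ℤ)]) (genPow 7 v (2 ^ r : ℕ) (r + s : ℕ))
      (φ.sizes r s ++ [((φ.toOV r s u v).n : ℤ)] ++ [((φ.toOV r s u v).m : ℤ)]) [] :=
    steps_genPow (e := φ.N / (r + s)) rfl ⟨by simp [sizes], by simp, by simp [sizes, env]⟩ hmX
      (Nat.one_le_two_pow) (by change φ.rounds r s ≤ _; omega) (by omega)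
      (by change φ.rounds r s ≤ _; omega)
  have hL : φ.sizes r s ++ [((φ.toOV r s u v).n : ℤ)] ++ [((φ.toOV r s u v).m : ℤ)] =
      φ.counts r s u v := by simp [counts]
  rw [hL] at h2
  rw [encode_toOV]
  have hw : 1 * (φ.N + 1) * (φ.M + 1) * ((φ.toOV r s u v).n + (φ.toOV r s u v).m) =
      φ.work r s u v := by rw [one_mul]; rfl
  refine (steps_genSizes hr).seq (g := _ ++ _) <| h1.seq (g := _ ++ _) <| h2.seq (g := _ ++ _) <|
    (Steps.emit ⟨by simp [counts, sizes], by simp, by simp [counts, sizes, env]⟩ (hcast hnX)).seq <|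
    (Steps.emit ⟨by simp [counts, sizes], by simp, by simp [counts, sizes, env]⟩ (hcast hmX)).seq <|
    (Steps.emit ⟨by simp [counts, sizes], by simp, by simp [counts, sizes, env]⟩ (hcast hMX)).seq <|
    Steps.seq (L' := φ.counts r s u v) ?_ ?_
  · rw [← hw]
    exact steps_genRows (by omega) hnX hNX hMX h1X (by omega)
      ⟨by simp, by simp, by simp [env]⟩ (fun E => ⟨by simp, by simp, by simp⟩)
      fun E => ⟨by simp, by simp, by simp [env]⟩
  · rw [← hw]
    exact steps_genRows (by omega) hmX hNX hMX h1X (by omega)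
      ⟨by simp, by simp, by simp [env]⟩ (fun E => ⟨by simp, by simp, by simp [env]⟩)
      fun E => ⟨by simp, by simp, by simp [env]⟩

/-- The reduction of satisfiability to OV. -/
def viaOV (r s u v : ℕ) (c : Prog) : Prog :=
  .seq (.seq (genOV r s u v) c.relocate) (.store (.lit 0) (.cell (.lit (-2))))

/-- The relocated program leaves its answer in cell `reloc 0 = -2`, from where it is copied to cell
`0`. -/
theorem viaOV_spec {c : Prog} (hr : 1 ≤ r) (hs : 1 ≤ s) (hu : 1 ≤ u) (hv : 1 ≤ v) {t : ℕ}
    {M : Memory} (hc : Run c (init (φ.toOV r s u v).encode) t M)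
    (hyes : (φ.toOV r s u v).HasOrthogonalPair → M 0 = 1)
    (hno : ¬ (φ.toOV r s u v).HasOrthogonalPair → M 0 = 0) :
    ∃ t' M', Run (viaOV r s u v c) (init φ.encode) t' M' ∧
      t' ≤ 20 * (((genOV r s u v).budget + 1) * (φ.work r s u v * bitLen (φ.bound r s u v)) +
        c.slowdown * t + 1) ∧
      (φ.Satisfiable → M' 0 = 1) ∧ (¬ φ.Satisfiable → M' 0 = 0) := by
  have hn : 1 ≤ (φ.toOV r s u v).n := Nat.mul_pos (Nat.pow_pos hu) (by positivity)
  have hwork : 1 ≤ φ.work r s u v := Nat.mul_pos (by positivity) (by omega)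
  have hinp : ∀ z ∈ φ.encode, |z| ≤ (φ.bound r s u v : ℤ) := fun z hz =>
    (abs_le_of_mem_encode hz).trans
      (by exact_mod_cast le_bound (.inr (.inr (.inr le_rfl))))
  have hlen : (φ.toOV r s u v).encode.length ≤ φ.bound r s u v := by
    rw [OVInstance.encode_length, bound, show (φ.toOV r s u v).d = φ.M from rfl]
    generalize (φ.toOV r s u v).n = a
    generalize (φ.toOV r s u v).m = b
    have h1 : 1 * (φ.M + 1) ≤ (φ.N + 1) * (φ.M + 1) := Nat.mul_le_mul_right _ (by omega)
    have h2 := Nat.mul_le_mul_left (a + b + 3) h1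
    nlinarith
  have hgen : WP (φ.bound r s u v) φ.encode (genOV r s u v)
      ((genOV r s u v).budget * φ.work r s u v)
      (fun _ l' => l' = (φ.toOV r s u v).encode) (fun _ => 0) [] :=
    (steps_genOV hr hs hu hv hwork (fun _ => 0) []
      (fun i h1 h2 => by simp at h2; omega) (by simpa using hlen)).mono le_rfl
      fun _ _ h => by simpa using h.2
  obtain ⟨t₁, M₁, r₁, ht₁, hrel, -, hbits⟩ := hgen.run_relocate hinp hc
  have hbl := one_le_bitLen (φ.bound r s u v)
  refine ⟨_, _, r₁.seq (.store _ _ _), ?_, ?_⟩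
  · have h0 := hbits (-2)
    have e0 : bitLen 0 = 1 := by decide
    have e2 : bitLen (-2) = 3 := by decide
    simp only [Expr.cost, Expr.eval, e0, e2]
    generalize φ.bound r s u v = B at *
    have h2 : bitLen B ≤ φ.work r s u v * bitLen B := Nat.le_mul_of_pos_left _ hwork
    rw [add_mul, one_mul, ← mul_assoc]
    omega
  · have e1 : M₁ (-2) = M 0 := hrel 0
    simp only [Expr.eval, Function.update_self, e1, ← toOV_hasOrthogonalPair (φ := φ) (s := s) hr hu hv]
    exact ⟨hyes, hno⟩

end

end CNF

/-! ### Satisfiability and orthogonal vectors -/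

theorem SETH.seth' (h : SETH) : SETH' := by
  rintro δ hδ ⟨C, a, c, hc⟩
  obtain ⟨k, hk⟩ := h δ hδ
  exact hk ⟨C, a, c, fun x _ => hc x trivial⟩

/-- For large `u` the interval from `c₁ * u ^ r` to `c₂ * u ^ r` has length at least `1` and
contains an integer. These factors place the numbers of vectors in an arbitrarily narrow window. -/
theorem exists_ratio {c₁ c₂ : ℝ} (hc₁ : 0 < c₁) (hc₂ : c₁ < c₂) {r : ℕ} (hr : 1 ≤ r) :
    ∃ u v : ℕ, 1 ≤ u ∧ 1 ≤ v ∧ c₁ * (u : ℝ) ^ r ≤ v ∧ (v : ℝ) ≤ c₂ * (u : ℝ) ^ r := by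
  have h0 : 0 < c₂ - c₁ := by linarith
  obtain ⟨u, hu⟩ := exists_nat_ge (1 / (c₂ - c₁))
  have hu0 : (0 : ℝ) < u := (by positivity : (0 : ℝ) < 1 / (c₂ - c₁)).trans_le hu
  have hu1 : 1 ≤ u := by exact_mod_cast hu0
  have h1 : (u : ℝ) ≤ (u : ℝ) ^ r := le_self_pow₀ (by exact_mod_cast hu1) (by omega)
  have h2 : 1 ≤ (c₂ - c₁) * (u : ℝ) ^ r := by
    rw [div_le_iff₀ h0] at hu
    nlinarith
  have h3 : 0 < c₁ * (u : ℝ) ^ r := by positivity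
  refine ⟨u, ⌈c₁ * (u : ℝ) ^ r⌉₊, hu1, Nat.ceil_pos.2 h3, Nat.le_ceil _, ?_⟩
  have := Nat.ceil_lt_add_one h3.le
  linarith

/-! ### Size bounds for the orthogonal vectors instance -/

namespace CNF

variable {φ : CNF} {r s u v : ℕ}

/-- The numbers of vectors are bounded by this constant, up to a power of two. -/
def factor (r s u v : ℕ) : ℕ := u ^ s * v * 2 ^ ((r + s) * (r + s))

theorem mul_rounds_le : (r + s) * φ.rounds r s ≤ φ.N + (r + s) * (r + s) := by
  unfold rounds
  rw [mul_add]
  exact Nat.add_le_add_right (Nat.mul_div_le _ _) _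

theorem toOV_mul_le : (φ.toOV r s u v).n * (φ.toOV r s u v).m ≤ factor r s u v * 2 ^ φ.N := by
  have h : (φ.toOV r s u v).n * (φ.toOV r s u v).m =
      u ^ s * v * 2 ^ ((r + s) * φ.rounds r s) := by
    simp only [toOV, ← pow_mul, add_mul, pow_add]; ring
  rw [h, factor, mul_assoc (u ^ s * v), ← pow_add]
  refine Nat.mul_le_mul_left _ (Nat.pow_le_pow_right (by omega) ?_)
  have := mul_rounds_le (φ := φ) (r := r) (s := s)
  omega

theorem pow_rounds_le {k : ℕ} (h0 : 0 < r + s) (hk : k ≤ r + s) {β : ℝ} (hβ : (k : ℝ) ≤ β * (r + s)) :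
    ((2 ^ k) ^ φ.rounds r s : ℝ) ≤ 2 ^ ((r + s) * (r + s)) * ((2 : ℝ) ^ β) ^ φ.N := by
  have hw : (0 : ℝ) < r + s := by exact_mod_cast h0
  rw [rounds, pow_add, mul_comm]
  refine mul_le_mul ?_ ?_ (by positivity) (by positivity)
  · rw [← pow_mul]
    exact pow_le_pow_right₀ (by norm_num) (Nat.mul_le_mul_right _ hk)
  · rw [← pow_mul, ← Real.rpow_natCast, ← Real.rpow_natCast, ← Real.rpow_mul (by norm_num)]
    refine Real.rpow_le_rpow_of_exponent_le (by norm_num) ?_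
    have h1 : ((φ.N / (r + s) : ℕ) : ℝ) * (r + s) ≤ φ.N := by
      exact_mod_cast Nat.div_mul_le_self φ.N (r + s)
    have h2 : (0 : ℝ) ≤ ((φ.N / (r + s) : ℕ) : ℝ) := Nat.cast_nonneg _
    have hβ0 : 0 ≤ β := by
      by_contra hneg
      have := mul_neg_of_neg_of_pos (not_le.1 hneg) hw
      linarith [Nat.cast_nonneg (α := ℝ) k]
    push_cast at *
    calc (k : ℝ) * ((φ.N / (r + s) : ℕ) : ℝ) ≤ β * (r + s) * ((φ.N / (r + s) : ℕ) : ℝ) := by gcongr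
      _ = β * (((φ.N / (r + s) : ℕ) : ℝ) * (r + s)) := by ring
      _ ≤ β * φ.N := by gcongr

/-- All numbers are at most exponential in `N + M`, so the logarithmic cost of an operation is
linear in it. -/
theorem bitLen_bound_le (hu : 1 ≤ u) (hv : 1 ≤ v) :
    RAM.bitLen (φ.bound r s u v) ≤ (5 * factor r s u v + 3) * (φ.N + φ.M + 1) := by
  have hA : 1 ≤ factor r s u v :=
    Nat.mul_pos (Nat.mul_pos (Nat.pow_pos hu) hv) (by positivity)
  have hmul := toOV_mul_le (φ := φ) (r := r) (s := s) (u := u) (v := v)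
  have hn : 1 ≤ (φ.toOV r s u v).n := Nat.mul_pos (Nat.pow_pos hu) (by positivity)
  have hm : 1 ≤ (φ.toOV r s u v).m := Nat.mul_pos hv (by positivity)
  have h1 : (φ.toOV r s u v).n + (φ.toOV r s u v).m + 3 ≤ 5 * (factor r s u v * 2 ^ φ.N) := by
    generalize (φ.toOV r s u v).n = n at *
    generalize (φ.toOV r s u v).m = m at *
    nlinarith
  have h2 : (φ.N + 1) * (φ.M + 1) ≤ 2 ^ φ.N * 2 ^ φ.M :=
    Nat.mul_le_mul Nat.lt_two_pow_self Nat.lt_two_pow_self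
  have h3 : φ.bound r s u v < 2 ^ (5 * factor r s u v + 2 * φ.N + φ.M) := by
    calc φ.bound r s u v ≤ 5 * (factor r s u v * 2 ^ φ.N) * (2 ^ φ.N * 2 ^ φ.M) :=
          Nat.mul_le_mul h1 h2
      _ = 5 * factor r s u v * (2 ^ (2 * φ.N) * 2 ^ φ.M) := by ring
      _ < 2 ^ (5 * factor r s u v) * (2 ^ (2 * φ.N) * 2 ^ φ.M) :=
          Nat.mul_lt_mul_of_pos_right Nat.lt_two_pow_self (by positivity)
      _ = _ := by rw [pow_add, pow_add, mul_assoc]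
  have h4 : (φ.bound r s u v).size ≤ 5 * factor r s u v + 2 * φ.N + φ.M := Nat.size_le.2 h3
  have h5 : RAM.bitLen (φ.bound r s u v) = (φ.bound r s u v).size + 1 := by simp [RAM.bitLen]
  rw [h5]
  generalize factor r s u v = A at *
  nlinarith

end CNF

/-- For `g = r / s` the variables are split in the ratio `s : r`, giving about `2 ^ (s * N / (r +
s))` and `2 ^ (r * N / (r + s))` vectors. Their product is `2 ^ N` up to a constant, and both
numbers are polynomially smaller, so a polynomial saving for orthogonal vectors becomes an
exponential one for satisfiability. -/
theorem SETH'.ovh (h : SETH') : OVH := by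
  rintro g c₁ c₂ δ hg hc₁ hc₂ hδ ⟨C, a, c, hc⟩
  obtain ⟨r, hr⟩ := Int.eq_ofNat_of_zero_le (Rat.num_pos.2 hg).le
  obtain ⟨s, hs⟩ : ∃ s, s = g.den := ⟨_, rfl⟩
  have hs1 : 1 ≤ s := hs ▸ g.den_pos
  have hr1 : 1 ≤ r := by have := Rat.num_pos.2 hg; omega
  have hgr : (g : ℝ) = r / s := by rw [Rat.cast_def, hr, hs]; simp
  obtain ⟨u, v, hu, hv, huv1, huv2⟩ := exists_ratio hc₁ hc₂ hr1
  have hr1' : (1 : ℝ) ≤ r := by exact_mod_cast hr1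
  have hs1' : (1 : ℝ) ≤ s := by exact_mod_cast hs1
  have hw : (0 : ℝ) < r + s := by linarith
  -- Dominates the exponents of the given algorithm and of the two numbers of vectors, and stays
  -- below `1`, so that `2 ^ β < 2` is the new base.
  set β : ℝ := max (1 - δ) (max (r / (r + s)) (s / (r + s))) with hβ
  have hβr : (r : ℝ) ≤ β * (r + s) := by
    rw [← div_le_iff₀ hw]; exact (le_max_left _ _).trans (le_max_right _ _)
  have hβs : (s : ℝ) ≤ β * (r + s) := by
    rw [← div_le_iff₀ hw]; exact (le_max_right _ _).trans (le_max_right _ _)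
  have hβδ : 1 - δ ≤ β := le_max_left _ _
  have hβ1 : β < 1 := by
    refine max_lt (by linarith) (max_lt ?_ ?_) <;> rw [div_lt_one hw] <;> linarith
  have hβ0 : 0 < β := by
    by_contra hneg
    nlinarith
  have h2β : (2 : ℝ) ^ β < 2 := by
    calc (2 : ℝ) ^ β < 2 ^ (1 : ℝ) := Real.rpow_lt_rpow_of_exponent_lt (by norm_num) hβ1
      _ = 2 := Real.rpow_one 2
  set A : ℕ := CNF.factor r s u v with hA
  have hA1 : 1 ≤ A := Nat.mul_pos (Nat.mul_pos (Nat.pow_pos hu) hv) (by positivity)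
  have hA1' : (1 : ℝ) ≤ A := by exact_mod_cast hA1
  refine h (2 - (2 : ℝ) ^ β) (by linarith) ⟨20 * (((CNF.genOV r s u v).budget + 1) *
    (2 * A * (5 * A + 3)) + c.slowdown * (|C| * A) + 1), a + 3, CNF.viaOV r s u v c, ?_⟩
  rintro φ -
  have hn : 1 ≤ (φ.toOV r s u v).n := Nat.mul_pos (Nat.pow_pos hu) (by positivity)
  have hm : 1 ≤ (φ.toOV r s u v).m := Nat.mul_pos hv (by positivity)
  -- The number `n` is an exact `s`-th power, so `n ^ g` and `m` contain the same power of two, and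
  -- their ratio is that of `u ^ r` and `v`.
  have hng : ((φ.toOV r s u v).n : ℝ) ^ (g : ℝ) = u ^ r * (2 ^ r) ^ φ.rounds r s := by
    have hs0 : (s : ℝ) ≠ 0 := by positivity
    have e : (φ.toOV r s u v).n = (u * 2 ^ φ.rounds r s) ^ s := by
      simp only [CNF.toOV]; rw [mul_pow, ← pow_mul, ← pow_mul, mul_comm s]
    rw [e, Nat.cast_pow, ← Real.rpow_natCast _ s, ← Real.rpow_mul (by positivity),
      show (s : ℝ) * (g : ℝ) = r by rw [hgr]; field_simp, Real.rpow_natCast]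
    push_cast
    rw [mul_pow, ← pow_mul, ← pow_mul, mul_comm r]
  have hmv : ((φ.toOV r s u v).m : ℝ) = v * (2 ^ r) ^ φ.rounds r s := by simp [CNF.toOV]
  have hpow : (0 : ℝ) ≤ (2 ^ r) ^ φ.rounds r s := by positivity
  obtain ⟨t, M, hrun, ht, hyes, hno⟩ := hc (φ.toOV r s u v) ⟨hn, hm, by
    rw [hng, hmv, ← mul_assoc]
    exact mul_le_mul_of_nonneg_right huv1 hpow, by
    rw [hng, hmv, ← mul_assoc]
    exact mul_le_mul_of_nonneg_right huv2 hpow⟩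
  obtain ⟨t', M', hrun', ht', hyes', hno'⟩ := CNF.viaOV_spec hr1 hs1 hu hv hrun hyes hno
  refine ⟨t', M', hrun', ?_, hyes', hno'⟩
  beta_reduce
  rw [sub_sub_cancel]
  have hY : (1 : ℝ) ≤ ((2 : ℝ) ^ β) ^ φ.N :=
    one_le_pow₀ (Real.one_le_rpow (by norm_num) hβ0.le)
  have hZ : (1 : ℝ) ≤ (φ.N : ℝ) + φ.M + 1 := by
    have := Nat.cast_nonneg (α := ℝ) φ.N
    have := Nat.cast_nonneg (α := ℝ) φ.M
    linarith
  have hAuv : (A : ℝ) = u ^ s * v * 2 ^ ((r + s) * (r + s)) := by simp [hA, CNF.factor]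
  have hu1 : (1 : ℝ) ≤ u ^ s := one_le_pow₀ (by exact_mod_cast hu)
  have hv1 : (1 : ℝ) ≤ v := by exact_mod_cast hv
  have hnA : ((φ.toOV r s u v).n : ℝ) ≤ A * ((2 : ℝ) ^ β) ^ φ.N := by
    have := CNF.pow_rounds_le (φ := φ) (by omega) (show s ≤ r + s by omega) hβs
    have e : ((φ.toOV r s u v).n : ℝ) = u ^ s * (2 ^ s) ^ φ.rounds r s := by simp [CNF.toOV]
    rw [e, hAuv]
    calc (u : ℝ) ^ s * (2 ^ s) ^ φ.rounds r s
        ≤ (u ^ s * v) * (2 ^ ((r + s) * (r + s)) * ((2 : ℝ) ^ β) ^ φ.N) :=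
          mul_le_mul (le_mul_of_one_le_right (by positivity) hv1) this (by positivity)
            (by positivity)
      _ = _ := by ring
  have hmA : ((φ.toOV r s u v).m : ℝ) ≤ A * ((2 : ℝ) ^ β) ^ φ.N := by
    have := CNF.pow_rounds_le (φ := φ) (by omega) (show r ≤ r + s by omega) hβr
    rw [hmv, hAuv]
    calc (v : ℝ) * (2 ^ r) ^ φ.rounds r s
        ≤ (u ^ s * v) * (2 ^ ((r + s) * (r + s)) * ((2 : ℝ) ^ β) ^ φ.N) :=
          mul_le_mul (le_mul_of_one_le_left (by positivity) hu1) this (by positivity)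
            (by positivity)
      _ = _ := by ring
  have hnm : (((φ.toOV r s u v).n : ℝ) * (φ.toOV r s u v).m) ^ (1 - δ) ≤
      A * ((2 : ℝ) ^ β) ^ φ.N := by
    have hn' : (1 : ℝ) ≤ (φ.toOV r s u v).n := by exact_mod_cast hn
    have hm' : (1 : ℝ) ≤ (φ.toOV r s u v).m := by exact_mod_cast hm
    have h1 : ((φ.toOV r s u v).n : ℝ) * (φ.toOV r s u v).m ≤ A * 2 ^ φ.N := by
      exact_mod_cast CNF.toOV_mul_le (φ := φ) (r := r) (s := s) (u := u) (v := v)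
    calc _ ≤ (((φ.toOV r s u v).n : ℝ) * (φ.toOV r s u v).m) ^ β :=
          Real.rpow_le_rpow_of_exponent_le (one_le_mul_of_one_le_of_one_le hn' hm') hβδ
      _ ≤ ((A : ℝ) * 2 ^ φ.N) ^ β := Real.rpow_le_rpow (by positivity) h1 hβ0.le
      _ = (A : ℝ) ^ β * ((2 : ℝ) ^ β) ^ φ.N := by
          rw [Real.mul_rpow (by positivity) (by positivity), ← Real.rpow_natCast 2,
            ← Real.rpow_mul (by norm_num), ← Real.rpow_natCast _ φ.N,
            ← Real.rpow_mul (by norm_num), mul_comm β]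
      _ ≤ (A : ℝ) ^ (1 : ℝ) * ((2 : ℝ) ^ β) ^ φ.N := by gcongr
      _ = _ := by rw [Real.rpow_one]
  have hwork : (φ.work r s u v : ℝ) * RAM.bitLen (φ.bound r s u v) ≤
      2 * A * (5 * A + 3) * (((2 : ℝ) ^ β) ^ φ.N * ((φ.N : ℝ) + φ.M + 1) ^ 3) := by
    have hb : (RAM.bitLen (φ.bound r s u v) : ℝ) ≤ (5 * A + 3) * ((φ.N : ℝ) + φ.M + 1) := by
      exact_mod_cast CNF.bitLen_bound_le (φ := φ) (r := r) (s := s) hu hv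
    have hwk : (φ.work r s u v : ℝ) =
        ((φ.N : ℝ) + 1) * (φ.M + 1) * ((φ.toOV r s u v).n + (φ.toOV r s u v).m) := by
      simp [CNF.work]
    have hN0 := Nat.cast_nonneg (α := ℝ) φ.N
    have hM0 := Nat.cast_nonneg (α := ℝ) φ.M
    rw [hwk]
    calc _ ≤ ((φ.N : ℝ) + φ.M + 1) * ((φ.N : ℝ) + φ.M + 1) *
          (A * ((2 : ℝ) ^ β) ^ φ.N + A * ((2 : ℝ) ^ β) ^ φ.N) *
          ((5 * A + 3) * ((φ.N : ℝ) + φ.M + 1)) := by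
            gcongr <;> linarith
      _ = _ := by ring
  have hbase : (t : ℝ) ≤ |C| * A * (((2 : ℝ) ^ β) ^ φ.N * ((φ.N : ℝ) + φ.M + 1) ^ a) := by
    have hN0 := Nat.cast_nonneg (α := ℝ) φ.N
    calc (t : ℝ) ≤ C * (((φ.toOV r s u v).n : ℝ) * (φ.toOV r s u v).m) ^ (1 - δ) *
          ((φ.M : ℝ) + 1) ^ a := ht
      _ ≤ |C| * (A * ((2 : ℝ) ^ β) ^ φ.N) * ((φ.N : ℝ) + φ.M + 1) ^ a := by
          gcongr
          · exact le_abs_self C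
          · linarith
      _ = _ := by ring
  have hmono : ∀ k ≤ a + 3, ((2 : ℝ) ^ β) ^ φ.N * ((φ.N : ℝ) + φ.M + 1) ^ k ≤
      ((2 : ℝ) ^ β) ^ φ.N * ((φ.N : ℝ) + φ.M + 1) ^ (a + 3) := fun k hk =>
    mul_le_mul_of_nonneg_left (pow_le_pow_right₀ hZ hk) (by positivity)
  have hm3 := hmono 3 (by omega)
  have hma := hmono a (by omega)
  have hm0 : 1 ≤ ((2 : ℝ) ^ β) ^ φ.N * ((φ.N : ℝ) + φ.M + 1) ^ (a + 3) :=
    one_le_mul_of_one_le_of_one_le hY (one_le_pow₀ hZ)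
  have ht'' : (t' : ℝ) ≤ 20 * (((CNF.genOV r s u v).budget + 1) *
      (φ.work r s u v * RAM.bitLen (φ.bound r s u v)) + c.slowdown * t + 1) := by
    exact_mod_cast ht'
  have e1 := hwork.trans (mul_le_mul_of_nonneg_left hm3 (by positivity))
  have e2 := hbase.trans (mul_le_mul_of_nonneg_left hma (by positivity))
  rw [mul_assoc]
  generalize ((2 : ℝ) ^ β) ^ φ.N * ((φ.N : ℝ) + φ.M + 1) ^ (a + 3) = Z at *
  have e3 := mul_le_mul_of_nonneg_left e1
    (show (0 : ℝ) ≤ (CNF.genOV r s u v).budget + 1 by positivity)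
  have e4 := mul_le_mul_of_nonneg_left e2 (Nat.cast_nonneg (α := ℝ) c.slowdown)
  linarith

theorem mainTheorem5 (hyp : SETH ∨ SETH' ∨ OVH)
    (γ ε c₁ c₂ : ℝ) (hγ : 0 < γ) (hε : 0 ≤ ε) (hεγ : ε = 0 → ∃ r : ℚ, γ = r)
    (hc₁ : 0 < c₁) (hc₂ : c₁ < c₂) (κ : ℕ) (hκ : 2 ≤ κ) (δ : ℝ) (hδ : 0 < δ) (C : ℝ) :
    (¬ MapMatchingApproxIn 2.999 κ
      (fun p q => c₁ * (p : ℝ) ^ (γ - ε) ≤ q ∧ (q : ℝ) ≤ c₂ * (p : ℝ) ^ (γ + ε))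
      (fun p q => C * ((p : ℝ) * q) ^ (1 - δ))) ∧
    (¬ MapMatchingApproxIn 2.999 κ
      (fun p q => c₁ * (p : ℝ) ^ (γ - ε) ≤ q ∧ (q : ℝ) ≤ c₂ * (p : ℝ) ^ (γ + ε))
      (fun p q => C * ((p : ℝ) * q * Real.log (p + 1)) / ((p : ℝ) * q) ^ δ)) := by
  have h : OVH := by
    rcases hyp with h | h | h
    exacts [h.seth'.ovh, h.ovh, h]
  exact ⟨h.lowerBound hγ hε hεγ hc₁ hc₂ hκ hδ C, h.lowerBound_log hγ hε hεγ hc₁ hc₂ hκ hδ C⟩
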